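/- **Setting.** Let $b,\sigma:[0,\infty)\to\mathbb R$ be locally Lipschitz with $\sigma>0$ on $(0,\infty)$. Let $p'(x)=\exp\bigl(-2\int_1^x b(s)\sigma(s)^{-2}\,ds\bigr)$ and $m(dx)=\frac{2}{\sigma^2(x)p'(x)}\,dx$ be the scale density and the speed measure of the diffusion $dX_t=b(X_t)\,dt+\sigma(X_t)\,dW_t$, $X_0=x>0$, on $(0,\infty)$. Assume that $0$ is inaccessible and that $\infty$ is natural in Feller's classification. Let $r:[0,\infty)\to\mathbb R$ be bounded and continuous with $r\ge r_0$ for some constant $r_0>0$. Put $\Lambda_t=\int_0^t r(X_s)\,ds$ and $\mathscr L w=\frac12\sigma^2w''+bw'-rw$. Let $\varphi,\psi$ be the fundamental $C^2$ solutions of $\mathscr Lw=0$ on $(0,\infty)$ with $\varphi,\psi>0$, $\varphi'<0<\psi'$ and $\lim_{x\downarrow0}\varphi(x)=\lim_{x\uparrow\infty}\psi(x)=\infty$ (unique up to positive factors). For $F$ with $\mathbb E_x\int_0^\infty e^{-\Lambda_t}|F(X_t)|\,dt<\infty$ for all $x>0$, put $R_F(x)=\mathbb E_x\int_0^\infty e^{-\Lambda_t}F(X_t)\,dt$.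 Let $h,k:(0,\infty)\to\mathbb R$ satisfy the following conditions. (i) $h$ is continuous and bounded from below, $\lim_{x\downarrow0}h(x)/r(x)$ exists in $\mathbb R$, and $\mathbb E_x\int_0^\infty e^{-\Lambda_t}|h(X_t)|\,dt<\infty$ for all $x>0$. (ii) $k$ is absolutely continuous on compact subintervals of $(0,\infty)$, $\int_0^1|k(s)|\,ds<\infty$, and the function $\kappa(x)=\int_0^xk(s)\,ds$ is bounded from below. Also, $\mathbb E_x\int_0^\infty e^{-\Lambda_t}|\mathscr L\kappa(X_t)|\,dt<\infty$ for all $x>0$, and $\limsup_{x\uparrow\infty}\kappa(x)/\psi(x)\in[0,\infty)$. (iii) The function $\Theta=h+\mathscr L\kappa$ is continuous, and for some $\xi\in(0,\infty)$ the function $\Theta/r$ is strictly increasing on $(0,\xi)$ and strictly decreasing on $(\xi,\infty)$. Let $c>0$. Put $\rho=R_\Theta'/\psi'$ and $G=R_\Theta-\rho\,\psi$. * Let $\underline x\in(\xi,\infty]$ be the point such that $\rho'<0$ on $(0,\underline x)$ and $\rho'>0$ on $(\underline x,\infty)$. * If $\underline x<\infty$, let $\overline x=\inf\{s>0:\rho(s)>\lim_{x\downarrow0}\rho(x)\}$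 (with $\inf\emptyset=\infty$). For $\beta\in(\underline x,\overline x)$ let $\Gamma(\beta)$ be the unique $\gamma\in(0,\beta)$ with $\rho(\gamma)=\rho(\beta)$, and put $c^\star=-\lim_{\beta\uparrow\overline x}\bigl(G(\beta)-G(\Gamma(\beta))\bigr)$. * If moreover $\overline x<\infty$, put $c^\circ=-\lim_{\beta\uparrow\infty}\bigl(G(\beta)-\lim_{x\downarrow0}G(x)\bigr)$. **Claim.** If $\underline x<\infty$, then $$\lim_{x\uparrow\infty}\frac{\Theta(x)}{r(x)}>-\infty\iff(\overline x=\infty\text{ and }c^\star<\infty)\ \text{ or }\ (\overline x<\infty\text{ and }c^\circ<\infty).$$ Suppose that one of the following two cases holds: (a) $\underline x<\infty$, $\lim_{x\uparrow\infty}\Theta(x)/r(x)>-\infty$, and $c\ge c^\star$ if $\overline x=\infty$, while $c\ge c^\circ$ if $\overline x<\infty$; (b) $\underline x=\infty$. Then the limit $K_\infty=\lim_{x\uparrow\infty}\kappa(x)/\psi(x)$ exists in $[0,\infty)$, and the function $w(x)=R_h(x)+K_\infty\psi(x)$, $x>0$, is $C^2$, is bounded from below, and solves the HJB equation $$\max\Bigl\{\mathscr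 Lw(x)+h(x),\ -c+\sup_{z\in[0,x)}\int_{x-z}^x\bigl(k(s)-w'(s)\bigr)\,ds\Bigr\}=0\qquad\text{for all }x>0.$$ -/

import Mathlib

open Filter Topology MeasureTheory ProbabilityTheory Set
open scoped NNReal ENNReal

noncomputable section

namespace ImpulseControl

/-! ### The uncontrolled diffusion on the state space `(0, ∞)` -/

/-- Generator of the uncontrolled diffusion: `(1/2) σ² f'' + b f'`. -/
def generator (b σ f : ℝ → ℝ) (x : ℝ) : ℝ :=
  (1 / 2) * σ x ^ 2 * deriv (deriv f) x + b x * deriv f x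

/-- The operator `ℒ w = (1/2) σ² w'' + b w' - r w`. -/
def opL (b σ r w : ℝ → ℝ) (x : ℝ) : ℝ :=
  (1 / 2) * σ x ^ 2 * deriv (deriv w) x + b x * deriv w x - r x * w x

/-- Derivative `p'` of the scale function. -/
def scaleDensity (b σ : ℝ → ℝ) (x : ℝ) : ℝ :=
  Real.exp (-2 * ∫ s in (1 : ℝ)..x, b s / σ s ^ 2)

/-- Lebesgue density of the speed measure `m`. -/
def speedDensity (b σ : ℝ → ℝ) (x : ℝ) : ℝ :=
  2 / (σ x ^ 2 * scaleDensity b σ x)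

/-- Feller's criterion for `0` to be inaccessible: `∫₀¹ m((a,1)) p(da) = ∞`. -/
def ZeroInaccessible (b σ : ℝ → ℝ) : Prop :=
  (∫⁻ a in Ioo (0 : ℝ) 1, ENNReal.ofReal (scaleDensity b σ a) *
    (∫⁻ y in Ioo a 1, ENNReal.ofReal (speedDensity b σ y))) = ∞

/-- Feller's criterion for `∞` to be natural: neither accessible
(`∫₁^∞ m((1,a)) p(da) = ∞`) nor entrance (`∫₁^∞ (p(a) - p(1)) m(da) = ∞`). -/
def InftyNatural (b σ : ℝ → ℝ) : Prop :=
  (∫⁻ a in Ioi (1 : ℝ), ENNReal.ofReal (scaleDensity b σ a) *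
    (∫⁻ y in Ioo 1 a, ENNReal.ofReal (speedDensity b σ y))) = ∞ ∧
  (∫⁻ a in Ioi (1 : ℝ), ENNReal.ofReal (speedDensity b σ a) *
    (∫⁻ y in Ioo 1 a, ENNReal.ofReal (scaleDensity b σ y))) = ∞

/-- Local Lipschitz coefficients on `[0, ∞)`, with `σ > 0` on `(0, ∞)`. -/
structure CoefficientsRegular (b σ : ℝ → ℝ) : Prop where
  b_lip : LocallyLipschitzOn (Ici 0) b
  σ_lip : LocallyLipschitzOn (Ici 0) σ
  σ_pos : ∀ x, 0 < x → 0 < σ x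

/-- The discount rate is continuous, bounded, and bounded away from `0`. -/
structure DiscountRegular (r : ℝ → ℝ) : Prop where
  cont : ContinuousOn r (Ici 0)
  bdd : ∃ M : ℝ, ∀ x, 0 ≤ x → |r x| ≤ M
  pos : ∃ r₀ : ℝ, 0 < r₀ ∧ ∀ x, 0 ≤ x → r₀ ≤ r x

/-- `X` is the diffusion `dX = b(X) dt + σ(X) dW`, `X₀ = x`, in `(0, ∞)`: a continuous adapted
process solving the (Stroock-Varadhan) martingale problem for the generator. -/
structure IsDiffusion {Ω : Type*} {mΩ : MeasurableSpace Ω} (b σ : ℝ → ℝ)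
    (ℱ : Filtration ℝ≥0 mΩ) (P : Measure Ω) (x : ℝ) (X : ℝ≥0 → Ω → ℝ) : Prop where
  init : ∀ ω, X 0 ω = x
  pos : ∀ t ω, 0 < X t ω
  cont : ∀ ω, Continuous fun t => X t ω
  adapted : ∀ t, Measurable[ℱ t] (X t)
  martingale : ∀ f : ℝ → ℝ, ContDiff ℝ 2 f → HasCompactSupport f → tsupport f ⊆ Ioi 0 →
    Martingale
      (fun (t : ℝ≥0) ω =>
        f (X t ω) - ∫ s in (0 : ℝ)..t, generator b σ f (X s.toNNReal ω)) ℱ P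

/-- The discount factor `exp (-Λ_t)`, with `Λ_t = ∫₀ᵗ r(X_s) ds`. -/
def discount {Ω : Type*} (r : ℝ → ℝ) (X : ℝ≥0 → Ω → ℝ) (t : ℝ) (ω : Ω) : ℝ :=
  Real.exp (-∫ s in (0 : ℝ)..t, r (X s.toNNReal ω))

/-- `E_x [∫₀^∞ e^{-Λ_t} |F(X_t)| dt] < ∞` for every `x > 0`; `X x` is the diffusion started
at `x`. -/
def DiscountedIntegrable {Ω : Type*} [MeasurableSpace Ω] (r : ℝ → ℝ) (P : Measure Ω)
    (X : ℝ → ℝ≥0 → Ω → ℝ) (F : ℝ → ℝ) : Prop :=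
  ∀ x, 0 < x →
    (∫⁻ ω, (∫⁻ t in Ioi (0 : ℝ),
      ENNReal.ofReal (discount r (X x) t ω * |F (X x t.toNNReal ω)|)) ∂P) < ∞

/-- `R_F(x) = E_x [∫₀^∞ e^{-Λ_t} F(X_t) dt]`. -/
def resolvent {Ω : Type*} [MeasurableSpace Ω] (r : ℝ → ℝ) (P : Measure Ω)
    (X : ℝ → ℝ≥0 → Ω → ℝ) (F : ℝ → ℝ) (x : ℝ) : ℝ :=
  ∫ ω, (∫ t in Ioi (0 : ℝ), discount r (X x) t ω * F (X x t.toNNReal ω)) ∂P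

/-- `φ` and `ψ` are the decreasing and the increasing fundamental solution of `ℒ w = 0` on
`(0, ∞)`; each is determined by these properties up to a positive factor. -/
structure IsFundamentalPair (b σ r φ ψ : ℝ → ℝ) : Prop where
  φ_C2 : ContDiffOn ℝ 2 φ (Ioi 0)
  ψ_C2 : ContDiffOn ℝ 2 ψ (Ioi 0)
  φ_ode : ∀ x, 0 < x → opL b σ r φ x = 0
  ψ_ode : ∀ x, 0 < x → opL b σ r ψ x = 0
  φ_pos : ∀ x, 0 < x → 0 < φ x
  ψ_pos : ∀ x, 0 < x → 0 < ψ x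
  φ_deriv : ∀ x, 0 < x → deriv φ x < 0
  ψ_deriv : ∀ x, 0 < x → 0 < deriv ψ x
  φ_zero : Tendsto φ (𝓝[>] 0) atTop
  ψ_infty : Tendsto ψ atTop atTop

/-! ### The payoff functions -/

/-- `x ↦ ∫₀ˣ k(s) ds`. -/
def primitive (k : ℝ → ℝ) (x : ℝ) : ℝ := ∫ s in (0 : ℝ)..x, k s

/-- `Θ = h + ℒ (∫₀^· k(s) ds)`. -/
def Theta (b σ r h k : ℝ → ℝ) (x : ℝ) : ℝ := h x + opL b σ r (primitive k) x

/-- Standing assumptions on the running payoff `h`. -/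
structure RunningPayoffRegular {Ω : Type*} [MeasurableSpace Ω] (r h : ℝ → ℝ) (P : Measure Ω)
    (X : ℝ → ℝ≥0 → Ω → ℝ) : Prop where
  cont : ContinuousOn h (Ioi 0)
  bddBelow : ∃ m : ℝ, ∀ x, 0 < x → m ≤ h x
  lim_zero : ∃ l : ℝ, Tendsto (fun x => h x / r x) (𝓝[>] 0) (𝓝 l)
  integrable : DiscountedIntegrable r P X h

/-- Standing assumptions on the marginal profit `k`. -/
structure MarginalProfitRegular {Ω : Type*} [MeasurableSpace Ω] (b σ r k ψ : ℝ → ℝ)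
    (P : Measure Ω) (X : ℝ → ℝ≥0 → Ω → ℝ) : Prop where
  absCont : ∀ x y, 0 < x → x ≤ y → AbsolutelyContinuousOnInterval k x y
  integrable_zero : IntegrableOn k (Ioo 0 1)
  bddBelow : ∃ m : ℝ, ∀ x, 0 < x → m ≤ primitive k x
  integrable : DiscountedIntegrable r P X (opL b σ r (primitive k))
  limsup_infty : ∃ l : ℝ, 0 ≤ l ∧
    limsup (fun x => ((primitive k x / ψ x : ℝ) : EReal)) atTop = (l : EReal)

/-- `Θ` is continuous and `Θ / r` is strictly increasing on `(0, ξ)` and strictly decreasing on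
`(ξ, ∞)` for some `ξ > 0`. -/
def ThetaUnimodal (b σ r h k : ℝ → ℝ) : Prop :=
  ContinuousOn (Theta b σ r h k) (Ioi 0) ∧
  ∃ ξ : ℝ, 0 < ξ ∧
    StrictMonoOn (fun x => Theta b σ r h k x / r x) (Ioo 0 ξ) ∧
    StrictAntiOn (fun x => Theta b σ r h k x / r x) (Ioi ξ)

/-! ### The critical points and the critical costs

In what follows `R` stands for `R_Θ`.  All limits are taken in `[-∞, ∞]`, and limits that exist
are written as upper limits. -/

/-- `R' / ψ'`. -/
def slopeRatio (R ψ : ℝ → ℝ) (x : ℝ) : ℝ := deriv R x / deriv ψ x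

/-- The point `x̲ ∈ (0, ∞]` such that `(R'/ψ')' < 0` on `(0, x̲)` and `(R'/ψ')' > 0` on
`(x̲, ∞)`, namely the right end point of the largest interval `(0, y)` on which
`(R'/ψ')' < 0`. -/
def xLower (R ψ : ℝ → ℝ) : EReal :=
  sSup {y : EReal | ∀ x : ℝ, 0 < x → (x : EReal) < y → deriv (slopeRatio R ψ) x < 0}

/-- `lim_{x ↓ 0} R'(x) / ψ'(x)`. -/
def slopeRatioZero (R ψ : ℝ → ℝ) : EReal :=
  limsup (fun x : ℝ => (slopeRatio R ψ x : EReal)) (𝓝[>] 0)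

/-- `x̄ = inf {s > 0 | R'(s)/ψ'(s) > lim_{x ↓ 0} R'(x)/ψ'(x)}`, with `inf ∅ = ∞`. -/
def xUpper (R ψ : ℝ → ℝ) : EReal :=
  sInf ((fun s : ℝ => (s : EReal)) ''
    {s : ℝ | 0 < s ∧ slopeRatioZero R ψ < (slopeRatio R ψ s : EReal)})

/-- `G = R - (R'/ψ') ψ`. -/
def G (R ψ : ℝ → ℝ) (x : ℝ) : ℝ := R x - slopeRatio R ψ x * ψ x

/-- `F(γ, β) = G(β) - G(γ)`. -/
def F (R ψ : ℝ → ℝ) (γ β : ℝ) : ℝ := G R ψ β - G R ψ γ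

/-- `F(0, β) = G(β) - lim_{γ ↓ 0} G(γ)`. -/
def FZero (R ψ : ℝ → ℝ) (β : ℝ) : EReal :=
  (G R ψ β : EReal) - limsup (fun γ : ℝ => (G R ψ γ : EReal)) (𝓝[>] 0)

/-- For `β` in `(x̲, x̄)`, the unique point `γ ∈ (0, β)` at which `R'/ψ'` takes the same value
as at `β`. -/
def Gam (R ψ : ℝ → ℝ) (β : ℝ) : ℝ :=
  sInf {γ : ℝ | 0 < γ ∧ γ < β ∧ slopeRatio R ψ γ = slopeRatio R ψ β}

/-- `c⋆ = - lim_{β ↑ x̄} F(Γ(β), β)`; the filter is that of real `β` tending to `x̄ ∈ (0, ∞]`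
from below. -/
def cStar (R ψ : ℝ → ℝ) : EReal :=
  -limsup (fun β : ℝ => (F R ψ (Gam R ψ β) β : EReal))
    (comap (fun β : ℝ => (β : EReal)) (𝓝[<] (xUpper R ψ)))

/-- `c° = - lim_{β ↑ ∞} F(0, β)`. -/
def cCirc (R ψ : ℝ → ℝ) : EReal := -limsup (FZero R ψ) atTop

/-- `lim_{x ↑ ∞} Θ(x) / r(x)`. -/
def ratioInfty (Θ r : ℝ → ℝ) : EReal :=
  limsup (fun x : ℝ => ((Θ x / r x : ℝ) : EReal)) atTop

/-! ### The HJB equation -/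

/-- The values `∫_{x-z}^x (k(s) - w'(s)) ds`, for `z ∈ [0, x)`. -/
def impulseGains (k w : ℝ → ℝ) (x : ℝ) : Set ℝ :=
  (fun z : ℝ => ∫ s in (x - z)..x, (k s - deriv w s)) '' Ico 0 x

/-- `max {ℒ w + h, -c + sup_{0 ≤ z < x} ∫_{x-z}^x (k - w') ds} = 0` at every `x > 0`, the
supremum being finite. -/
def SolvesHJB (b σ r h k : ℝ → ℝ) (c : ℝ) (w : ℝ → ℝ) : Prop :=
  ∀ x, 0 < x → BddAbove (impulseGains k w x) ∧
    max (opL b σ r w x + h x) (-c + sSup (impulseGains k w x)) = 0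

end ImpulseControl

end

namespace ImpulseControl

/-! ### Calculus on the half-line -/

/-! Probability enters only through a Green kernel. The martingale problem gives `∫ ℒf dμ = -f(x)`
for the discounted occupation measure `μ` of the process started at `x` and every C² function `f`
with compact support in `(0, ∞)` (`integral_opL_occupation`). This fixes `μ` up to a density `(αφ +
βψ)m`. Positivity of `μ` forces `α, β ≥ 0`. The identity `∫ r dμ = 1`, shared by the Green kernel
because `ψ'/p'` vanishes at `0` and `φ'/p'` at `∞`, forces `α = β = 0`. So `R_f` is a Green
potential (`isGreenPotential_resolvent`): it is C², solves `ℒR = -f`, is `o(ψ)` at `∞` and `o(φ)` at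
`0`.

For `R = R_Θ` one has `G · ψ'/p' = ∫₀ˣ ψΘ dm` (`G_mul_flux`), so `G(x)` is the average of `Θ/r` over
`(0, x)` with weight `ψ r dm`. Moreover `ρ'` has the sign of `G - Θ/r` (`hasDerivAt_slopeRatio`).
Comparing a unimodal function with its running average gives at most one sign change, from minus to
plus. As `ψ'/p' → ∞`, the average `G` tends to `-∞` if `Θ/r` does, and is eventually bounded below
otherwise. This decides whether the critical cost is finite (`bot_lt_ratioInfty_iff_cost`).

A jump from `v` down to `u` gains `R(u) - R(v)` before the fixed cost. With `λ = ρ(β) = ρ(γ)`, `γ =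
Γ(β)`, the tilted function `R - λψ` increases up to `γ` and decreases from `γ` to `β`, so `F(γ, β)`
is its largest drop on `(0, β)`. Since `R = o(ψ)`, `λ → 0` as `β → ∞`, and a cost `c` above the
critical one yields `R(u) - R(v) ≤ c` for all `u ≤ v` (`le_of_cStar_le`, and `le_of_cCirc_le` with
`γ` replaced by `0`). If `ρ` decreases throughout, then `ρ ≥ 0` and `R` is nondecreasing.

Finally `κ + R_{ℒκ}` is annihilated by `ℒ` and is `o(φ)` at `0`, so it equals `Kψ` with `K = lim
κ/ψ` (`exists_primitive_add_eq_mul_ψ`). Hence `w - κ = R_Θ`: the differential part of the HJB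
equation holds with equality, and the impulse part is the bound on `R_Θ(u) - R_Θ(v)`. -/

lemma IntervalIntegrable.of_continuousOn_Ioi {f : ℝ → ℝ} (hf : ContinuousOn f (Ioi 0)) {x y : ℝ}
    (hx : 0 < x) (hy : 0 < y) : IntervalIntegrable f volume x y :=
  (hf.mono fun _ hz => (lt_min hx hy).trans_le hz.1).intervalIntegrable

lemma hasDerivAt_integral_of_continuousOn_Ioi {f : ℝ → ℝ} (hf : ContinuousOn f (Ioi 0)) {a x : ℝ}
    (hx : 0 < x) (hfi : IntervalIntegrable f volume a x) :
    HasDerivAt (fun y => ∫ s in a..y, f s) (f x) x :=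
  intervalIntegral.integral_hasDerivAt_right hfi
    (hf.stronglyMeasurableAtFilter isOpen_Ioi x hx) (hf.continuousAt (Ioi_mem_nhds hx))

lemma monotoneOn_Ioi_of_hasDerivAt_nonneg {a : ℝ} {f f' : ℝ → ℝ}
    (hf : ∀ x, a < x → HasDerivAt f (f' x) x) (h : ∀ x, a < x → 0 ≤ f' x) :
    MonotoneOn f (Ioi a) := by
  refine monotoneOn_of_deriv_nonneg (convex_Ioi a)
    (fun x hx => (hf x hx).continuousAt.continuousWithinAt) ?_ ?_
  · rw [interior_Ioi]
    exact fun x hx => (hf x hx).differentiableAt.differentiableWithinAt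
  · rw [interior_Ioi]
    intro x hx
    rw [(hf x hx).deriv]
    exact h x hx

lemma antitoneOn_Ioi_of_hasDerivAt_nonpos {a : ℝ} {f f' : ℝ → ℝ}
    (hf : ∀ x, a < x → HasDerivAt f (f' x) x) (h : ∀ x, a < x → f' x ≤ 0) :
    AntitoneOn f (Ioi a) := by
  have := monotoneOn_Ioi_of_hasDerivAt_nonneg (fun x hx => (hf x hx).neg)
    (fun x hx => neg_nonneg.mpr (h x hx))
  intro x hx y hy hxy
  simpa using this hx hy hxy

lemma strictMonoOn_of_hasDerivAt_pos {D : Set ℝ} (hD : Convex ℝ D) {f f' : ℝ → ℝ}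
    (hf : ∀ x ∈ D, HasDerivAt f (f' x) x) (h : ∀ x ∈ interior D, 0 < f' x) :
    StrictMonoOn f D := by
  refine strictMonoOn_of_deriv_pos hD
    (fun x hx => (hf x hx).continuousAt.continuousWithinAt) ?_
  intro x hx
  rw [(hf x (interior_subset hx)).deriv]
  exact h x hx

lemma strictAntiOn_of_hasDerivAt_neg {D : Set ℝ} (hD : Convex ℝ D) {f f' : ℝ → ℝ}
    (hf : ∀ x ∈ D, HasDerivAt f (f' x) x) (h : ∀ x ∈ interior D, f' x < 0) :
    StrictAntiOn f D := by
  refine strictAntiOn_of_deriv_neg hD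
    (fun x hx => (hf x hx).continuousAt.continuousWithinAt) ?_
  intro x hx
  rw [(hf x (interior_subset hx)).deriv]
  exact h x hx

lemma eq_of_hasDerivAt_zero_Ioi {f f' : ℝ → ℝ} (hf : ∀ x, 0 < x → HasDerivAt f (f' x) x)
    (h : ∀ x, 0 < x → f' x = 0) {x y : ℝ} (hx : 0 < x) (hy : 0 < y) : f x = f y := by
  have h1 := monotoneOn_Ioi_of_hasDerivAt_nonneg hf fun x hx => (h x hx).ge
  have h2 := antitoneOn_Ioi_of_hasDerivAt_nonpos hf fun x hx => (h x hx).le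
  rcases le_total x y with hxy | hxy
  · exact le_antisymm (h1 hx hy hxy) (h2 hx hy hxy)
  · exact le_antisymm (h2 hy hx hxy) (h1 hy hx hxy)

lemma contDiffOn_two_of_hasDerivAt {f f' f'' : ℝ → ℝ}
    (hf : ∀ x, 0 < x → HasDerivAt f (f' x) x) (hf' : ∀ x, 0 < x → HasDerivAt f' (f'' x) x)
    (hc : ContinuousOn f'' (Ioi 0)) :
    ContDiffOn ℝ 2 f (Ioi 0) ∧ ∀ x, 0 < x → deriv (deriv f) x = f'' x := by
  have hd : ∀ x, 0 < x → deriv f x = f' x := fun x hx => (hf x hx).deriv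
  have hdd : ∀ x, 0 < x → HasDerivAt (deriv f) (f'' x) x := by
    intro x hx
    refine (hf' x hx).congr_of_eventuallyEq ?_
    filter_upwards [Ioi_mem_nhds hx] with y hy using hd y hy
  refine ⟨?_, fun x hx => (hdd x hx).deriv⟩
  rw [show (2 : WithTop ℕ∞) = 1 + 1 by norm_num, contDiffOn_succ_iff_deriv_of_isOpen isOpen_Ioi]
  refine ⟨fun x hx => (hf x hx).differentiableAt.differentiableWithinAt, by simp, ?_⟩
  rw [show (1 : WithTop ℕ∞) = 0 + 1 by norm_num, contDiffOn_succ_iff_deriv_of_isOpen isOpen_Ioi]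
  refine ⟨fun x hx => (hdd x hx).differentiableAt.differentiableWithinAt, by simp, ?_⟩
  rw [contDiffOn_zero]
  exact hc.congr fun x hx => (hdd x hx).deriv

lemma hasDerivAt_of_contDiffOn_two {u : ℝ → ℝ} (hu : ContDiffOn ℝ 2 u (Ioi 0)) {x : ℝ}
    (hx : 0 < x) : HasDerivAt u (deriv u x) x :=
  ((hu.differentiableOn (by norm_num)).differentiableAt (Ioi_mem_nhds hx)).hasDerivAt

lemma hasDerivAt_deriv_of_contDiffOn_two {u : ℝ → ℝ} (hu : ContDiffOn ℝ 2 u (Ioi 0)) {x : ℝ}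
    (hx : 0 < x) : HasDerivAt (deriv u) (deriv (deriv u) x) x := by
  rw [show (2 : WithTop ℕ∞) = 1 + 1 by norm_num,
    contDiffOn_succ_iff_deriv_of_isOpen isOpen_Ioi] at hu
  exact ((hu.2.2.differentiableOn (by norm_num)).differentiableAt (Ioi_mem_nhds hx)).hasDerivAt

/-! ### Scale and speed -/

section ScaleSpeed

variable {b σ r : ℝ → ℝ}

lemma CoefficientsRegular.continuousOn_b (hc : CoefficientsRegular b σ) :
    ContinuousOn b (Ioi 0) :=
  hc.b_lip.continuousOn.mono Ioi_subset_Ici_self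

lemma CoefficientsRegular.continuousOn_σ (hc : CoefficientsRegular b σ) :
    ContinuousOn σ (Ioi 0) :=
  hc.σ_lip.continuousOn.mono Ioi_subset_Ici_self

lemma CoefficientsRegular.continuousOn_ratio (hc : CoefficientsRegular b σ) :
    ContinuousOn (fun x => b x / σ x ^ 2) (Ioi 0) :=
  hc.continuousOn_b.div (hc.continuousOn_σ.pow 2) fun x hx => (pow_pos (hc.σ_pos x hx) 2).ne'

lemma scaleDensity_pos (x : ℝ) : 0 < scaleDensity b σ x := Real.exp_pos _

lemma hasDerivAt_scaleDensity (hc : CoefficientsRegular b σ) {x : ℝ} (hx : 0 < x) :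
    HasDerivAt (scaleDensity b σ) (-2 * (b x / σ x ^ 2) * scaleDensity b σ x) x := by
  have h := hasDerivAt_integral_of_continuousOn_Ioi hc.continuousOn_ratio hx
    (IntervalIntegrable.of_continuousOn_Ioi hc.continuousOn_ratio one_pos hx)
  have := (h.const_mul (-2)).exp
  rwa [mul_comm] at this

lemma continuousOn_scaleDensity (hc : CoefficientsRegular b σ) :
    ContinuousOn (scaleDensity b σ) (Ioi 0) :=
  fun _ hx => (hasDerivAt_scaleDensity hc hx).continuousAt.continuousWithinAt

lemma speedDensity_pos (hc : CoefficientsRegular b σ) {x : ℝ} (hx : 0 < x) :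
    0 < speedDensity b σ x :=
  div_pos two_pos (mul_pos (pow_pos (hc.σ_pos x hx) 2) (scaleDensity_pos x))

lemma continuousOn_speedDensity (hc : CoefficientsRegular b σ) :
    ContinuousOn (speedDensity b σ) (Ioi 0) :=
  continuousOn_const.div ((hc.continuousOn_σ.pow 2).mul (continuousOn_scaleDensity hc))
    fun x hx => (mul_pos (pow_pos (hc.σ_pos x hx) 2) (scaleDensity_pos x)).ne'

lemma DiscountRegular.continuousOn (hr : DiscountRegular r) : ContinuousOn r (Ioi 0) :=
  hr.cont.mono Ioi_subset_Ici_self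

/-- The derivative of `u` with respect to the scale function. -/
noncomputable def flux (b σ u : ℝ → ℝ) (x : ℝ) : ℝ := deriv u x / scaleDensity b σ x

lemma deriv_eq_flux (u : ℝ → ℝ) (x : ℝ) :
    deriv u x = scaleDensity b σ x * flux b σ u x := by
  rw [flux, mul_div_cancel₀ _ (scaleDensity_pos x).ne']

/-- Feller's divergence form of the generator, `d/dm d/dp`: the first-order term disappears, and `ℒ`
becomes a first-order system for `u` and its flux. -/
lemma hasDerivAt_flux (hc : CoefficientsRegular b σ) (r : ℝ → ℝ) {u : ℝ → ℝ}
    (hu : ContDiffOn ℝ 2 u (Ioi 0)) {x : ℝ} (hx : 0 < x) :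
    HasDerivAt (flux b σ u) (speedDensity b σ x * (opL b σ r u x + r x * u x)) x := by
  have h := (hasDerivAt_deriv_of_contDiffOn_two hu hx).div (hasDerivAt_scaleDensity hc hx)
    (scaleDensity_pos x).ne'
  refine h.congr_deriv ?_
  have h1 := (scaleDensity_pos (b := b) (σ := σ) x).ne'
  have h2 := (hc.σ_pos x hx).ne'
  simp only [speedDensity, opL]
  field_simp
  ring

/-- Converse of `hasDerivAt_flux`. It gives C² regularity and the equation for functions built from
integrals, without computing a second derivative. -/
lemma contDiffOn_of_hasDerivAt_flux (hc : CoefficientsRegular b σ) (r : ℝ → ℝ) {u v g : ℝ → ℝ}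
    (hu : ∀ x, 0 < x → HasDerivAt u (scaleDensity b σ x * v x) x)
    (hv : ∀ x, 0 < x → HasDerivAt v (speedDensity b σ x * g x) x)
    (hg : ContinuousOn g (Ioi 0)) :
    ContDiffOn ℝ 2 u (Ioi 0) ∧ (∀ x, 0 < x → flux b σ u x = v x) ∧
      ∀ x, 0 < x → opL b σ r u x = g x - r x * u x := by
  have hvc : ContinuousOn v (Ioi 0) := fun x hx => (hv x hx).continuousAt.continuousWithinAt
  obtain ⟨h1, h2⟩ := contDiffOn_two_of_hasDerivAt hu
    (fun x hx => (hasDerivAt_scaleDensity hc hx).mul (hv x hx))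
    (((continuousOn_const.mul hc.continuousOn_ratio).mul (continuousOn_scaleDensity hc)).mul hvc
      |>.add ((continuousOn_scaleDensity hc).mul ((continuousOn_speedDensity hc).mul hg)))
  have h3 : ∀ x, 0 < x → flux b σ u x = v x := fun x hx => by
    rw [flux, (hu x hx).deriv, mul_div_cancel_left₀ _ (scaleDensity_pos x).ne']
  refine ⟨h1, h3, fun x hx => ?_⟩
  have h4 := (hasDerivAt_flux hc r h1 hx).unique ((hv x hx).congr_of_eventuallyEq ?_)
  · have := mul_left_cancel₀ (speedDensity_pos hc hx).ne' h4
    linarith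
  · filter_upwards [Ioi_mem_nhds hx] with y hy using h3 y hy

/-- The Wronskian of `u` and `v` with respect to the scale function. -/
noncomputable def wronskian (b σ u v : ℝ → ℝ) (x : ℝ) : ℝ :=
  u x * flux b σ v x - v x * flux b σ u x

lemma wronskian_eq (hc : CoefficientsRegular b σ) (r : ℝ → ℝ) {u v : ℝ → ℝ}
    (hu : ContDiffOn ℝ 2 u (Ioi 0)) (hv : ContDiffOn ℝ 2 v (Ioi 0))
    (hLu : ∀ x, 0 < x → opL b σ r u x = 0) (hLv : ∀ x, 0 < x → opL b σ r v x = 0)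
    {x y : ℝ} (hx : 0 < x) (hy : 0 < y) : wronskian b σ u v x = wronskian b σ u v y := by
  refine eq_of_hasDerivAt_zero_Ioi (fun x hx =>
    ((hasDerivAt_of_contDiffOn_two hu hx).mul (hasDerivAt_flux hc r hv hx)).sub
    ((hasDerivAt_of_contDiffOn_two hv hx).mul (hasDerivAt_flux hc r hu hx))) (fun x hx => ?_) hx hy
  rw [hLu x hx, hLv x hx, deriv_eq_flux (b := b) (σ := σ) u, deriv_eq_flux (b := b) (σ := σ) v]
  ring

end ScaleSpeed

/-! ### Boundary behaviour of the fundamental solutions -/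

/-- Feller's tests are stated as infinite Lebesgue integrals. A uniform bound on truncated integrals
contradicts them through this lemma near `0` and the next one near `∞`. -/
lemma lintegral_Ioo_lt_top_of_bounded {f : ℝ → ℝ} (hf : ContinuousOn f (Ioi 0))
    (hf0 : ∀ x ∈ Ioo (0 : ℝ) 1, 0 ≤ f x) {B : ℝ}
    (hB : ∀ a ∈ Ioo (0 : ℝ) 1, ∫ x in a..1, f x ≤ B) :
    ∫⁻ x in Ioo (0 : ℝ) 1, ENNReal.ofReal (f x) < ∞ := by
  have hlim : Tendsto (fun n : ℕ => 1 / ((n : ℝ) + 2)) atTop (𝓝 0) := by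
    refine tendsto_const_nhds.div_atTop ?_
    exact tendsto_atTop_add_const_right _ _ tendsto_natCast_atTop_atTop
  have ha : ∀ n : ℕ, 1 / ((n : ℝ) + 2) ∈ Ioo (0 : ℝ) 1 := fun n => by
    have : (0 : ℝ) ≤ n := n.cast_nonneg
    refine ⟨by positivity, ?_⟩
    rw [div_lt_one (by positivity)]
    linarith
  have hint : IntegrableOn f (Ioc 0 1) := by
    refine integrableOn_Ioc_of_intervalIntegral_norm_bounded_left (I := B)
      (fun n => (IntervalIntegrable.of_continuousOn_Ioi hf (ha n).1 one_pos).1) hlim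
      (Eventually.of_forall fun n => ?_)
    refine le_trans (le_of_eq ?_) (hB _ (ha n))
    rw [intervalIntegral.integral_of_le (ha n).2.le, integral_Ioc_eq_integral_Ioo,
      integral_Ioc_eq_integral_Ioo]
    refine setIntegral_congr_fun measurableSet_Ioo fun x hx => ?_
    exact Real.norm_of_nonneg (hf0 x ⟨(ha n).1.trans hx.1, hx.2⟩)
  have := (hint.mono_set Ioo_subset_Ioc_self).lintegral_lt_top
  exact this

lemma lintegral_Ioi_lt_top_of_bounded {f : ℝ → ℝ} (hf : ContinuousOn f (Ioi 0))
    (hf0 : ∀ x, 1 < x → 0 ≤ f x) {B : ℝ}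
    (hB : ∀ a, 1 < a → ∫ x in (1 : ℝ)..a, f x ≤ B) :
    ∫⁻ x in Ioi (1 : ℝ), ENNReal.ofReal (f x) < ∞ := by
  have ha : ∀ n : ℕ, 1 < (n : ℝ) + 2 := fun n => by
    have : (0 : ℝ) ≤ n := n.cast_nonneg
    linarith
  have hint : IntegrableOn f (Ioi 1) := by
    refine integrableOn_Ioi_of_intervalIntegral_norm_bounded (b := fun n : ℕ => (n : ℝ) + 2)
      B 1 (fun n => (IntervalIntegrable.of_continuousOn_Ioi hf one_pos
        (one_pos.trans (ha n))).1)
      (tendsto_atTop_add_const_right _ _ tendsto_natCast_atTop_atTop)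
      (Eventually.of_forall fun n => ?_)
    refine le_trans (le_of_eq ?_) (hB _ (ha n))
    rw [intervalIntegral.integral_of_le (ha n).le, intervalIntegral.integral_of_le (ha n).le]
    refine setIntegral_congr_fun measurableSet_Ioc fun x hx => ?_
    exact Real.norm_of_nonneg (hf0 x hx.1)
  exact hint.lintegral_lt_top

lemma lintegral_ofReal_Ioo {f : ℝ → ℝ} (hf : ContinuousOn f (Ioi 0))
    (hf0 : ∀ x, 0 < x → 0 ≤ f x) {a c : ℝ} (ha : 0 < a) (hac : a ≤ c) :
    ∫⁻ x in Ioo a c, ENNReal.ofReal (f x) = ENNReal.ofReal (∫ x in a..c, f x) := by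
  rw [intervalIntegral.integral_of_le hac, integral_Ioc_eq_integral_Ioo,
    ofReal_integral_eq_lintegral_ofReal]
  · exact ((IntervalIntegrable.of_continuousOn_Ioi hf ha (ha.trans_le hac)).1).mono_set
      Ioo_subset_Ioc_self
  · filter_upwards [ae_restrict_mem measurableSet_Ioo] with x hx using hf0 x (ha.trans hx.1)

lemma hasDerivAt_integral_left_of_continuousOn_Ioi {f : ℝ → ℝ} (hf : ContinuousOn f (Ioi 0))
    {x c : ℝ} (hx : 0 < x) (hc : 0 < c) :
    HasDerivAt (fun y => ∫ s in y..c, f s) (-f x) x := by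
  have := (hasDerivAt_integral_of_continuousOn_Ioi hf hx
    (IntervalIntegrable.of_continuousOn_Ioi hf hc hx)).neg
  refine this.congr_of_eventuallyEq (Eventually.of_forall fun y => ?_)
  exact intervalIntegral.integral_symm _ _

lemma continuousOn_integral_Ioi {f : ℝ → ℝ} (hf : ContinuousOn f (Ioi 0)) {c : ℝ} (hc : 0 < c) :
    ContinuousOn (fun y => ∫ s in c..y, f s) (Ioi 0) := fun _ hx =>
  (hasDerivAt_integral_of_continuousOn_Ioi hf hx
    (IntervalIntegrable.of_continuousOn_Ioi hf hc hx)).continuousAt.continuousWithinAt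

lemma continuousOn_integral_left_Ioi {f : ℝ → ℝ} (hf : ContinuousOn f (Ioi 0)) {c : ℝ}
    (hc : 0 < c) : ContinuousOn (fun y => ∫ s in y..c, f s) (Ioi 0) := fun _ hx =>
  (hasDerivAt_integral_left_of_continuousOn_Ioi hf hx hc).continuousAt.continuousWithinAt

lemma integral_nonneg_of_pos_Ioi {f : ℝ → ℝ} (hf0 : ∀ x, 0 < x → 0 ≤ f x) {a c : ℝ}
    (ha : 0 < a) (hac : a ≤ c) : 0 ≤ ∫ s in a..c, f s :=
  intervalIntegral.integral_nonneg hac fun _ hx => hf0 _ (ha.trans_le hx.1)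

section Boundary

variable {b σ r φ ψ : ℝ → ℝ}

lemma DiscountRegular.pos_of_pos (hr : DiscountRegular r) {x : ℝ} (hx : 0 < x) : 0 < r x := by
  obtain ⟨r₀, h0, h⟩ := hr.pos
  exact h0.trans_le (h x hx.le)

namespace IsFundamentalPair

lemma hasDerivAt_φ (h : IsFundamentalPair b σ r φ ψ) {x : ℝ} (hx : 0 < x) :
    HasDerivAt φ (scaleDensity b σ x * flux b σ φ x) x := by
  rw [← deriv_eq_flux]
  exact hasDerivAt_of_contDiffOn_two h.φ_C2 hx

lemma hasDerivAt_ψ (h : IsFundamentalPair b σ r φ ψ) {x : ℝ} (hx : 0 < x) :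
    HasDerivAt ψ (scaleDensity b σ x * flux b σ ψ x) x := by
  rw [← deriv_eq_flux]
  exact hasDerivAt_of_contDiffOn_two h.ψ_C2 hx

lemma continuousOn_φ (h : IsFundamentalPair b σ r φ ψ) : ContinuousOn φ (Ioi 0) :=
  h.φ_C2.continuousOn

lemma continuousOn_ψ (h : IsFundamentalPair b σ r φ ψ) : ContinuousOn ψ (Ioi 0) :=
  h.ψ_C2.continuousOn

lemma hasDerivAt_flux_φ (h : IsFundamentalPair b σ r φ ψ) (hc : CoefficientsRegular b σ)
    {x : ℝ} (hx : 0 < x) :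
    HasDerivAt (flux b σ φ) (speedDensity b σ x * (r x * φ x)) x := by
  simpa [h.φ_ode x hx] using hasDerivAt_flux hc r h.φ_C2 hx

lemma hasDerivAt_flux_ψ (h : IsFundamentalPair b σ r φ ψ) (hc : CoefficientsRegular b σ)
    {x : ℝ} (hx : 0 < x) :
    HasDerivAt (flux b σ ψ) (speedDensity b σ x * (r x * ψ x)) x := by
  simpa [h.ψ_ode x hx] using hasDerivAt_flux hc r h.ψ_C2 hx

lemma flux_φ_neg (h : IsFundamentalPair b σ r φ ψ) {x : ℝ} (hx : 0 < x) : flux b σ φ x < 0 :=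
  div_neg_of_neg_of_pos (h.φ_deriv x hx) (scaleDensity_pos x)

lemma flux_ψ_pos (h : IsFundamentalPair b σ r φ ψ) {x : ℝ} (hx : 0 < x) : 0 < flux b σ ψ x :=
  div_pos (h.ψ_deriv x hx) (scaleDensity_pos x)

lemma strictMonoOn_ψ (h : IsFundamentalPair b σ r φ ψ) : StrictMonoOn ψ (Ioi 0) := by
  refine strictMonoOn_of_hasDerivAt_pos (convex_Ioi 0)
    (fun x hx => hasDerivAt_of_contDiffOn_two h.ψ_C2 hx) fun x hx => ?_
  rw [interior_Ioi] at hx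
  exact h.ψ_deriv x hx

lemma strictAntiOn_φ (h : IsFundamentalPair b σ r φ ψ) : StrictAntiOn φ (Ioi 0) := by
  refine strictAntiOn_of_hasDerivAt_neg (convex_Ioi 0)
    (fun x hx => hasDerivAt_of_contDiffOn_two h.φ_C2 hx) fun x hx => ?_
  rw [interior_Ioi] at hx
  exact h.φ_deriv x hx

variable (h : IsFundamentalPair b σ r φ ψ) (hc : CoefficientsRegular b σ)
  (hr : DiscountRegular r)

include h hc hr

lemma strictMonoOn_flux_ψ : StrictMonoOn (flux b σ ψ) (Ioi 0) := by
  refine strictMonoOn_of_hasDerivAt_pos (convex_Ioi 0)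
    (fun x hx => h.hasDerivAt_flux_ψ hc hx) fun x hx => ?_
  rw [interior_Ioi] at hx
  exact mul_pos (speedDensity_pos hc hx) (mul_pos (hr.pos_of_pos hx) (h.ψ_pos x hx))

lemma strictMonoOn_flux_φ : StrictMonoOn (flux b σ φ) (Ioi 0) := by
  refine strictMonoOn_of_hasDerivAt_pos (convex_Ioi 0)
    (fun x hx => h.hasDerivAt_flux_φ hc hx) fun x hx => ?_
  rw [interior_Ioi] at hx
  exact mul_pos (speedDensity_pos hc hx) (mul_pos (hr.pos_of_pos hx) (h.φ_pos x hx))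

/-- The flux of `ψ` is positive and increasing, so it suffices to find arbitrarily small values. If
it stayed above some `ε > 0`, the integral in the test for `0` would be finite. -/
lemma tendsto_flux_ψ_zero (hzero : ZeroInaccessible b σ) :
    Tendsto (flux b σ ψ) (𝓝[>] 0) (𝓝 0) := by
  have key : ∀ ε > 0, ∃ x, 0 < x ∧ flux b σ ψ x < ε := by
    by_contra! hcon
    obtain ⟨ε, hε, hε'⟩ := hcon
    obtain ⟨r₀, hr0, hrr⟩ := hr.pos
    have hm := continuousOn_speedDensity hc
    have hm0 : ∀ x, 0 < x → 0 ≤ speedDensity b σ x := fun x hx => (speedDensity_pos hc hx).le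
    have hN := continuousOn_integral_left_Ioi hm one_pos
    have hPN := (continuousOn_scaleDensity hc).mul hN
    have hN0 : ∀ x ∈ Ioo (0 : ℝ) 1, 0 ≤ ∫ s in x..1, speedDensity b σ s := fun x hx =>
      integral_nonneg_of_pos_Ioi hm0 hx.1 hx.2.le
    have hB : ∀ a ∈ Ioo (0 : ℝ) 1, ∫ x in a..1, (scaleDensity b σ x *
        ∫ s in x..1, speedDensity b σ s) ≤ (flux b σ ψ 1 / r₀) / ε := by
      intro a ha
      -- With `N(x) = m((x, 1))`, the derivative is at least `p'N(flux ψ - ε) ≥ 0`: the term `-ψm`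
      -- coming from `N'` is absorbed by `(flux ψ)'/r₀ = mrψ/r₀`. Comparing the values at `a` and
      -- `1` bounds `ε∫p'N`.
      have hQ : MonotoneOn (fun x => ε * (∫ y in x..1, (scaleDensity b σ y *
          ∫ s in y..1, speedDensity b σ s)) + ψ x * (∫ s in x..1, speedDensity b σ s)
          + flux b σ ψ x / r₀) (Icc a 1) := by
        have hd : ∀ x, 0 < x → HasDerivAt (fun x => ε * (∫ y in x..1, (scaleDensity b σ y *
          ∫ s in y..1, speedDensity b σ s)) + ψ x * (∫ s in x..1, speedDensity b σ s)
          + flux b σ ψ x / r₀) _ x := fun x hx =>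
          (((hasDerivAt_integral_left_of_continuousOn_Ioi hPN hx one_pos).const_mul ε).add
            ((h.hasDerivAt_ψ hx).mul
              (hasDerivAt_integral_left_of_continuousOn_Ioi hm hx one_pos))).add
            ((h.hasDerivAt_flux_ψ hc hx).div_const r₀)
        refine monotoneOn_of_deriv_nonneg (convex_Icc a 1)
          (fun x hx => (hd x (ha.1.trans_le hx.1)).continuousAt.continuousWithinAt)
          (fun x hx => (hd x ?_).differentiableAt.differentiableWithinAt) (fun x hx => ?_)
        · rw [interior_Icc] at hx
          exact ha.1.trans hx.1
        · rw [interior_Icc] at hx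
          have hx0 := ha.1.trans hx.1
          rw [(hd x hx0).deriv]
          have h1 := hN0 x ⟨hx0, hx.2⟩
          have h2 : 0 ≤ scaleDensity b σ x * (flux b σ ψ x - ε) *
              ∫ s in x..1, speedDensity b σ s :=
            mul_nonneg (mul_nonneg (scaleDensity_pos x).le (by linarith [hε' x hx0])) h1
          have h3 : speedDensity b σ x * ψ x ≤ speedDensity b σ x * (r x * ψ x) / r₀ := by
            rw [le_div_iff₀ hr0]
            have := mul_le_mul_of_nonneg_left (hrr x hx0.le)
              (mul_pos (speedDensity_pos hc hx0) (h.ψ_pos x hx0)).le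
            linarith
          simp only [Pi.mul_apply]
          linarith
      have h1 := hQ ⟨le_rfl, ha.2.le⟩ ⟨ha.2.le, le_rfl⟩ ha.2.le
      simp only [intervalIntegral.integral_same, mul_zero, zero_add] at h1
      rw [le_div_iff₀ hε]
      have h2 := mul_nonneg (h.ψ_pos a ha.1).le (hN0 a ha)
      have h3 := (div_pos (h.flux_ψ_pos ha.1) hr0).le
      linarith
    have := lintegral_Ioo_lt_top_of_bounded hPN
      (fun x hx => mul_nonneg (scaleDensity_pos x).le (hN0 x hx)) hB
    rw [ZeroInaccessible] at hzero
    refine this.ne (Eq.trans ?_ hzero)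
    refine setLIntegral_congr_fun measurableSet_Ioo fun x hx => ?_
    simp only [Pi.mul_apply]
    rw [ENNReal.ofReal_mul (scaleDensity_pos x).le, lintegral_ofReal_Ioo hm hm0 hx.1 hx.2.le]
  rw [Metric.tendsto_nhdsWithin_nhds]
  intro ε hε
  obtain ⟨x, hx, hxε⟩ := key ε hε
  refine ⟨x, hx, fun {y} hy hyx => ?_⟩
  rw [mem_Ioi] at hy
  rw [Real.dist_eq, sub_zero, abs_of_pos hy] at hyx
  rw [Real.dist_eq, sub_zero, abs_of_pos (h.flux_ψ_pos hy)]
  exact (h.strictMonoOn_flux_ψ hc hr hy hx hyx).trans hxε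

/-- Mirror image of `tendsto_flux_ψ_zero`. A flux bounded away from `0` would make `∫₁^∞ m((1, a))
p(da)` finite, against inaccessibility of `∞`. -/
lemma tendsto_flux_φ_atTop (hinfty : InftyNatural b σ) :
    Tendsto (flux b σ φ) atTop (𝓝 0) := by
  have key : ∀ ε > 0, ∃ x, 0 < x ∧ -ε < flux b σ φ x := by
    by_contra! hcon
    obtain ⟨ε, hε, hε'⟩ := hcon
    obtain ⟨r₀, hr0, hrr⟩ := hr.pos
    have hm := continuousOn_speedDensity hc
    have hm0 : ∀ x, 0 < x → 0 ≤ speedDensity b σ x := fun x hx => (speedDensity_pos hc hx).le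
    have hN := continuousOn_integral_Ioi hm one_pos
    have hPN := (continuousOn_scaleDensity hc).mul hN
    have hN0 : ∀ x, 1 < x → 0 ≤ ∫ s in (1 : ℝ)..x, speedDensity b σ s := fun x hx =>
      integral_nonneg_of_pos_Ioi hm0 one_pos hx.le
    have hB : ∀ a, 1 < a → ∫ x in (1 : ℝ)..a, (scaleDensity b σ x *
        ∫ s in (1 : ℝ)..x, speedDensity b σ s) ≤ (-flux b σ φ 1 / r₀) / ε := by
      intro a ha
      have hQ : AntitoneOn (fun x => ε * (∫ y in (1 : ℝ)..x, (scaleDensity b σ y *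
          ∫ s in (1 : ℝ)..y, speedDensity b σ s)) + φ x * (∫ s in (1 : ℝ)..x, speedDensity b σ s)
          - flux b σ φ x / r₀) (Icc 1 a) := by
        have hd : ∀ x, 0 < x → HasDerivAt (fun x => ε * (∫ y in (1 : ℝ)..x, (scaleDensity b σ y *
          ∫ s in (1 : ℝ)..y, speedDensity b σ s)) + φ x * (∫ s in (1 : ℝ)..x, speedDensity b σ s)
          - flux b σ φ x / r₀) _ x := fun x hx =>
          (((hasDerivAt_integral_of_continuousOn_Ioi hPN hx
              (IntervalIntegrable.of_continuousOn_Ioi hPN one_pos hx)).const_mul ε).add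
            ((h.hasDerivAt_φ hx).mul
              (hasDerivAt_integral_of_continuousOn_Ioi hm hx
              (IntervalIntegrable.of_continuousOn_Ioi hm one_pos hx)))).sub
            ((h.hasDerivAt_flux_φ hc hx).div_const r₀)
        refine antitoneOn_of_deriv_nonpos (convex_Icc 1 a)
          (fun x hx => (hd x (one_pos.trans_le hx.1)).continuousAt.continuousWithinAt)
          (fun x hx => (hd x ?_).differentiableAt.differentiableWithinAt) (fun x hx => ?_)
        · rw [interior_Icc] at hx
          exact one_pos.trans hx.1
        · rw [interior_Icc] at hx
          have hx0 := one_pos.trans hx.1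
          rw [(hd x hx0).deriv]
          have h1 := hN0 x hx.1
          have h2 : 0 ≤ scaleDensity b σ x * (-ε - flux b σ φ x) *
              ∫ s in (1 : ℝ)..x, speedDensity b σ s :=
            mul_nonneg (mul_nonneg (scaleDensity_pos x).le (by linarith [hε' x hx0])) h1
          have h3 : speedDensity b σ x * φ x ≤ speedDensity b σ x * (r x * φ x) / r₀ := by
            rw [le_div_iff₀ hr0]
            have := mul_le_mul_of_nonneg_left (hrr x hx0.le)
              (mul_pos (speedDensity_pos hc hx0) (h.φ_pos x hx0)).le
            linarith
          simp only [Pi.mul_apply]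
          linarith
      have h1 := hQ ⟨le_rfl, ha.le⟩ ⟨ha.le, le_rfl⟩ ha.le
      simp only [intervalIntegral.integral_same, mul_zero, zero_add] at h1
      have ha0 := one_pos.trans ha
      rw [le_div_iff₀ hε]
      have h2 := mul_nonneg (h.φ_pos a ha0).le (hN0 a ha)
      have h3 := (div_neg_of_neg_of_pos (h.flux_φ_neg ha0) hr0).le
      rw [neg_div]
      linarith
    have := lintegral_Ioi_lt_top_of_bounded hPN
      (fun x hx => mul_nonneg (scaleDensity_pos x).le (hN0 x hx)) hB
    refine this.ne (Eq.trans ?_ hinfty.1)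
    refine setLIntegral_congr_fun measurableSet_Ioi fun x hx => ?_
    simp only [Pi.mul_apply]
    rw [ENNReal.ofReal_mul (scaleDensity_pos x).le, lintegral_ofReal_Ioo hm hm0 one_pos hx.le]
  rw [Metric.tendsto_atTop]
  intro ε hε
  obtain ⟨x, hx, hxε⟩ := key ε hε
  refine ⟨x, fun y hyx => ?_⟩
  have hy : 0 < y := hx.trans_le hyx
  rw [Real.dist_eq, sub_zero, abs_of_neg (h.flux_φ_neg hy)]
  linarith [(h.strictMonoOn_flux_φ hc hr).monotoneOn hx hy hyx]

/-- This is where `∞` not being an entrance boundary is used. As the flux increases, `ψ` dominates a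
multiple of `p - p(1)`; hence `(flux ψ)' = mrψ` dominates a multiple of `(p - p(1))m`, whose
integral diverges. -/
lemma tendsto_flux_ψ_atTop (hinfty : InftyNatural b σ) :
    Tendsto (flux b σ ψ) atTop atTop := by
  have key : ∀ B, ∃ x, 0 < x ∧ B < flux b σ ψ x := by
    by_contra! hcon
    obtain ⟨B, hB'⟩ := hcon
    obtain ⟨r₀, hr0, hrr⟩ := hr.pos
    have hP := continuousOn_scaleDensity hc
    have hP0 : ∀ x, 0 < x → 0 ≤ scaleDensity b σ x := fun x hx => (scaleDensity_pos x).le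
    have hN := continuousOn_integral_Ioi hP one_pos
    have hPN := (continuousOn_speedDensity hc).mul hN
    have hN0 : ∀ x, 1 < x → 0 ≤ ∫ s in (1 : ℝ)..x, scaleDensity b σ s := fun x hx =>
      integral_nonneg_of_pos_Ioi hP0 one_pos hx.le
    have he := h.flux_ψ_pos one_pos
    have hψ : ∀ x, 1 ≤ x → flux b σ ψ 1 * (∫ s in (1 : ℝ)..x, scaleDensity b σ s) ≤ ψ x := by
      intro x hx
      have hd : ∀ x, 0 < x → HasDerivAt (fun x => ψ x -
          flux b σ ψ 1 * (∫ s in (1 : ℝ)..x, scaleDensity b σ s)) _ x := fun x hx =>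
        (h.hasDerivAt_ψ hx).sub ((hasDerivAt_integral_of_continuousOn_Ioi hP hx
              (IntervalIntegrable.of_continuousOn_Ioi hP one_pos hx)).const_mul _)
      have hQ : MonotoneOn (fun x => ψ x -
          flux b σ ψ 1 * (∫ s in (1 : ℝ)..x, scaleDensity b σ s)) (Icc 1 x) := by
        refine monotoneOn_of_deriv_nonneg (convex_Icc 1 x)
          (fun x hx => (hd x (one_pos.trans_le hx.1)).continuousAt.continuousWithinAt)
          (fun x hx => (hd x ?_).differentiableAt.differentiableWithinAt) (fun x hx => ?_)
        · rw [interior_Icc] at hx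
          exact one_pos.trans hx.1
        · rw [interior_Icc] at hx
          have hx0 := one_pos.trans hx.1
          rw [(hd x hx0).deriv]
          have := mul_le_mul_of_nonneg_left
            (h.strictMonoOn_flux_ψ hc hr (mem_Ioi.2 one_pos) hx0 hx.1).le
            (scaleDensity_pos (b := b) (σ := σ) x).le
          linarith
      have h1 := hQ ⟨le_rfl, hx⟩ ⟨hx, le_rfl⟩ hx
      simp only [intervalIntegral.integral_same, mul_zero, sub_zero] at h1
      linarith [h.ψ_pos 1 one_pos]
    have hB : ∀ a, 1 < a → ∫ x in (1 : ℝ)..a, (speedDensity b σ x *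
        ∫ s in (1 : ℝ)..x, scaleDensity b σ s) ≤ (B / r₀) / flux b σ ψ 1 := by
      intro a ha
      have hd : ∀ x, 0 < x → HasDerivAt (fun x => flux b σ ψ x / r₀ -
          flux b σ ψ 1 * ∫ y in (1 : ℝ)..x, (speedDensity b σ y *
          ∫ s in (1 : ℝ)..y, scaleDensity b σ s)) _ x := fun x hx =>
        ((h.hasDerivAt_flux_ψ hc hx).div_const r₀).sub
          ((hasDerivAt_integral_of_continuousOn_Ioi hPN hx
              (IntervalIntegrable.of_continuousOn_Ioi hPN one_pos hx)).const_mul _)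
      have hQ : MonotoneOn (fun x => flux b σ ψ x / r₀ -
          flux b σ ψ 1 * ∫ y in (1 : ℝ)..x, (speedDensity b σ y *
          ∫ s in (1 : ℝ)..y, scaleDensity b σ s)) (Icc 1 a) := by
        refine monotoneOn_of_deriv_nonneg (convex_Icc 1 a)
          (fun x hx => (hd x (one_pos.trans_le hx.1)).continuousAt.continuousWithinAt)
          (fun x hx => (hd x ?_).differentiableAt.differentiableWithinAt) (fun x hx => ?_)
        · rw [interior_Icc] at hx
          exact one_pos.trans hx.1
        · rw [interior_Icc] at hx
          have hx0 := one_pos.trans hx.1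
          rw [(hd x hx0).deriv]
          have h3 : speedDensity b σ x * ψ x ≤ speedDensity b σ x * (r x * ψ x) / r₀ := by
            rw [le_div_iff₀ hr0]
            have := mul_le_mul_of_nonneg_left (hrr x hx0.le)
              (mul_pos (speedDensity_pos hc hx0) (h.ψ_pos x hx0)).le
            linarith
          have h4 := mul_le_mul_of_nonneg_left (hψ x hx.1.le) (speedDensity_pos hc hx0).le
          simp only [Pi.mul_apply]
          linarith
      have h1 := hQ ⟨le_rfl, ha.le⟩ ⟨ha.le, le_rfl⟩ ha.le
      simp only [intervalIntegral.integral_same, mul_zero, sub_zero] at h1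
      have ha0 := one_pos.trans ha
      rw [le_div_iff₀ he]
      have h2 := div_le_div_of_nonneg_right (hB' a ha0) hr0.le
      have h3 := div_pos he hr0
      linarith
    have := lintegral_Ioi_lt_top_of_bounded hPN
      (fun x hx => mul_nonneg (speedDensity_pos hc (one_pos.trans hx)).le (hN0 x hx)) hB
    refine this.ne (Eq.trans ?_ hinfty.2)
    refine setLIntegral_congr_fun measurableSet_Ioi fun x hx => ?_
    simp only [Pi.mul_apply]
    rw [ENNReal.ofReal_mul (speedDensity_pos hc (one_pos.trans hx)).le,
      lintegral_ofReal_Ioo hP hP0 one_pos hx.le]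
  rw [tendsto_atTop]
  intro B
  obtain ⟨x, hx, hxB⟩ := key B
  filter_upwards [eventually_ge_atTop x] with y hy
  exact hxB.le.trans ((h.strictMonoOn_flux_ψ hc hr).monotoneOn hx (hx.trans_le hy) hy)

end IsFundamentalPair

end Boundary

/-! ### Paths of the diffusion and the discount factor -/

lemma measurable_indicator_Ioi {g : ℝ → ℝ} (hg : ContinuousOn g (Ioi 0)) :
    Measurable ((Ioi (0 : ℝ)).indicator g) := by
  have h : Measurable (Set.piecewise (Ioi (0 : ℝ)) g 0) :=
    hg.measurable_piecewise continuousOn_const measurableSet_Ioi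
  rwa [Set.piecewise_eq_indicator] at h

lemma measurable_intervalIntegral_of_continuous {α : Type*} {m : MeasurableSpace α}
    {Y : ℝ → α → ℝ} (hc : ∀ ω, Continuous fun s => Y s ω) (hY : ∀ s, Measurable (Y s)) (t : ℝ) :
    Measurable fun ω => ∫ s in (0 : ℝ)..t, Y s ω := by
  have h : StronglyMeasurable (Function.uncurry Y) :=
    (measurable_uncurry_of_continuous_of_measurable hc hY).stronglyMeasurable
  simp only [intervalIntegral]
  exact (h.integral_prod_left.sub h.integral_prod_left).measurable

lemma discount_pos {Ω : Type*} {r : ℝ → ℝ} {X : ℝ≥0 → Ω → ℝ} {t : ℝ} {ω : Ω} :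
    0 < discount r X t ω := Real.exp_pos _

namespace IsDiffusion

variable {Ω : Type*} {mΩ : MeasurableSpace Ω} {P : Measure Ω} {ℱ : Filtration ℝ≥0 mΩ}
  {b σ r g : ℝ → ℝ} {x : ℝ} {X : ℝ≥0 → Ω → ℝ}

lemma continuous_comp (hX : IsDiffusion b σ ℱ P x X) (hg : ContinuousOn g (Ioi 0)) (ω : Ω) :
    Continuous fun s : ℝ => g (X s.toNNReal ω) :=
  hg.comp_continuous ((hX.cont ω).comp continuous_real_toNNReal) fun _ => hX.pos _ _

lemma measurable_comp_adapted (hX : IsDiffusion b σ ℱ P x X) (hg : ContinuousOn g (Ioi 0))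
    (t : ℝ≥0) : Measurable[ℱ t] fun ω => g (X t ω) := by
  have h := (measurable_indicator_Ioi hg).comp (hX.adapted t)
  convert h using 2 with ω
  exact (indicator_of_mem (hX.pos t ω) g).symm

lemma measurable_comp (hX : IsDiffusion b σ ℱ P x X) (hg : ContinuousOn g (Ioi 0))
    (t : ℝ≥0) : Measurable fun ω => g (X t ω) :=
  (hX.measurable_comp_adapted hg t).mono (ℱ.le t) le_rfl

lemma measurable_integral_adapted (hX : IsDiffusion b σ ℱ P x X) (hg : ContinuousOn g (Ioi 0))
    (t : ℝ≥0) : Measurable[ℱ t] fun ω => ∫ s in (0 : ℝ)..t, g (X s.toNNReal ω) := by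
  -- Freezing the time at `t` makes the integrand `ℱ t`-measurable for every real `s` and does not
  -- change it on `[0, t]`.
  have h := measurable_intervalIntegral_of_continuous (m := ℱ t)
    (Y := fun s ω => g (X (min s t).toNNReal ω))
    (fun ω => (hX.continuous_comp hg ω).comp (continuous_id.min continuous_const))
    (fun s => (hX.measurable_comp_adapted hg _).mono
      (ℱ.mono (Real.toNNReal_le_iff_le_coe.2 (min_le_right _ _))) le_rfl) t
  convert h using 2 with ω
  refine intervalIntegral.integral_congr fun s hs => ?_
  rw [uIcc_of_le t.coe_nonneg] at hs
  simp only [min_eq_left hs.2]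

lemma measurable_integral (hX : IsDiffusion b σ ℱ P x X) (hg : ContinuousOn g (Ioi 0))
    (t : ℝ) : Measurable fun ω => ∫ s in (0 : ℝ)..t, g (X s.toNNReal ω) :=
  measurable_intervalIntegral_of_continuous (fun ω => hX.continuous_comp hg ω)
    (fun _ => hX.measurable_comp hg _) t

lemma measurable_uncurry_comp (hX : IsDiffusion b σ ℱ P x X) (hg : ContinuousOn g (Ioi 0)) :
    Measurable fun p : Ω × ℝ => g (X p.2.toNNReal p.1) :=
  (measurable_uncurry_of_continuous_of_measurable (u := fun (s : ℝ) ω => g (X s.toNNReal ω))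
    (fun ω => hX.continuous_comp hg ω) (fun _ => hX.measurable_comp hg _)).comp measurable_swap

lemma measurable_uncurry (hX : IsDiffusion b σ ℱ P x X) :
    Measurable fun p : Ω × ℝ => X p.2.toNNReal p.1 :=
  hX.measurable_uncurry_comp continuousOn_id

lemma hasDerivAt_integral (hX : IsDiffusion b σ ℱ P x X) (hg : ContinuousOn g (Ioi 0)) (ω : Ω)
    (t : ℝ) : HasDerivAt (fun u : ℝ => ∫ s in (0 : ℝ)..u, g (X s.toNNReal ω))
      (g (X t.toNNReal ω)) t :=
  (hX.continuous_comp hg ω).integral_hasStrictDerivAt 0 t |>.hasDerivAt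

lemma hasDerivAt_discount (hX : IsDiffusion b σ ℱ P x X) (hr : DiscountRegular r) (ω : Ω)
    (t : ℝ) : HasDerivAt (fun u => discount r X u ω)
      (-(discount r X t ω * r (X t.toNNReal ω))) t :=
  ((hX.hasDerivAt_integral hr.continuousOn ω t).neg.exp).congr_deriv (by
    simp only [discount, Pi.neg_apply]
    ring)

lemma continuous_discount (hX : IsDiffusion b σ ℱ P x X) (hr : DiscountRegular r) (ω : Ω) :
    Continuous fun u => discount r X u ω :=
  continuous_iff_continuousAt.2 fun t => (hX.hasDerivAt_discount hr ω t).continuousAt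

lemma measurable_discount_adapted (hX : IsDiffusion b σ ℱ P x X) (hr : DiscountRegular r)
    (t : ℝ≥0) : Measurable[ℱ t] (discount r X t) :=
  (hX.measurable_integral_adapted hr.continuousOn t).neg.exp

lemma measurable_discount (hX : IsDiffusion b σ ℱ P x X) (hr : DiscountRegular r)
    (t : ℝ) : Measurable (discount r X t) :=
  (hX.measurable_integral hr.continuousOn t).neg.exp

lemma measurable_uncurry_discount (hX : IsDiffusion b σ ℱ P x X) (hr : DiscountRegular r) :
    Measurable fun p : Ω × ℝ => discount r X p.2 p.1 :=
  (measurable_uncurry_of_continuous_of_measurable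
    (hX.continuous_discount hr) (hX.measurable_discount hr)).comp measurable_swap

lemma discount_le_one (hX : IsDiffusion b σ ℱ P x X) (hr : DiscountRegular r) {t : ℝ}
    (ht : 0 ≤ t) (ω : Ω) : discount r X t ω ≤ 1 := by
  rw [discount, Real.exp_le_one_iff, neg_nonpos]
  exact intervalIntegral.integral_nonneg ht fun s _ => (hr.pos_of_pos (hX.pos _ ω)).le

lemma tendsto_discount (hX : IsDiffusion b σ ℱ P x X) (hr : DiscountRegular r) (ω : Ω) :
    Tendsto (fun t => discount r X t ω) atTop (𝓝 0) := by
  obtain ⟨r₀, hr0, hrr⟩ := hr.pos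
  refine Real.tendsto_exp_neg_atTop_nhds_zero.comp ?_
  refine tendsto_atTop_mono' _ ?_ (tendsto_id.const_mul_atTop hr0)
  filter_upwards [eventually_ge_atTop 0] with t ht
  have h := intervalIntegral.integral_mono_on (μ := volume) (f := fun _ => r₀)
    (g := fun s : ℝ => r (X s.toNNReal ω)) ht
    intervalIntegrable_const ((hX.continuous_comp hr.continuousOn ω).intervalIntegrable 0 t)
    (fun s _ => hrr _ (hX.pos _ ω).le)
  simpa [mul_comm] using h

/-- The integrand is minus the derivative of the discount factor, which falls from `1` to `0`
because `r ≥ r₀ > 0`. It serves as pathwise dominating function and as normalisation of the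
occupation measure. -/
lemma integrableOn_discount_mul (hX : IsDiffusion b σ ℱ P x X) (hr : DiscountRegular r) (ω : Ω) :
    IntegrableOn (fun t : ℝ => discount r X t ω * r (X t.toNNReal ω)) (Ioi 0) ∧
      ∫ t in Ioi (0 : ℝ), discount r X t ω * r (X t.toNNReal ω) = 1 := by
  have hd : ∀ t ∈ Ici (0 : ℝ), HasDerivAt (fun u => -discount r X u ω)
      (discount r X t ω * r (X t.toNNReal ω)) t := fun t _ =>
    (hX.hasDerivAt_discount hr ω t).neg.congr_deriv (neg_neg _)
  have hpos : ∀ t ∈ Ioi (0 : ℝ), 0 ≤ discount r X t ω * r (X t.toNNReal ω) := fun t _ =>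
    mul_nonneg discount_pos.le (hr.pos_of_pos (hX.pos _ ω)).le
  have hlim := (hX.tendsto_discount hr ω).neg
  refine ⟨integrableOn_Ioi_deriv_of_nonneg' hd hpos hlim, ?_⟩
  rw [integral_Ioi_of_hasDerivAt_of_nonneg' hd hpos hlim]
  simp [discount]

/-! ### The occupation measure -/

end IsDiffusion

/-- The expected discounted occupation measure of the process `X`. -/
noncomputable def occupation {Ω : Type*} [MeasurableSpace Ω] (r : ℝ → ℝ) (P : Measure Ω)
    (X : ℝ≥0 → Ω → ℝ) : Measure ℝ :=
  ((P.prod (volume.restrict (Ioi (0 : ℝ)))).withDensity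
    fun p => ENNReal.ofReal (discount r X p.2 p.1)).map fun p => X p.2.toNNReal p.1

namespace IsDiffusion

variable {Ω : Type*} {mΩ : MeasurableSpace Ω} {P : Measure Ω} [IsProbabilityMeasure P]
  {ℱ : Filtration ℝ≥0 mΩ} {b σ r g : ℝ → ℝ} {x : ℝ} {X : ℝ≥0 → Ω → ℝ}

omit [IsProbabilityMeasure P] in
lemma lintegral_occupation (hX : IsDiffusion b σ ℱ P x X) (hr : DiscountRegular r)
    {f : ℝ → ℝ≥0∞} (hf : Measurable f) :
    ∫⁻ y, f y ∂(occupation r P X) = ∫⁻ ω, (∫⁻ t in Ioi (0 : ℝ),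
      ENNReal.ofReal (discount r X t ω) * f (X t.toNNReal ω)) ∂P := by
  have hm := (hX.measurable_uncurry_discount hr).ennreal_ofReal
  have hf' : Measurable fun p : Ω × ℝ => f (X p.2.toNNReal p.1) := hf.comp hX.measurable_uncurry
  rw [occupation, lintegral_map hf hX.measurable_uncurry,
    lintegral_withDensity_eq_lintegral_mul _ hm hf',
    lintegral_prod _ (hm.mul hf').aemeasurable]
  rfl

lemma occupation_compl (hX : IsDiffusion b σ ℱ P x X) (hr : DiscountRegular r) :
    occupation r P X (Ioi 0)ᶜ = 0 := by
  rw [← lintegral_indicator_one measurableSet_Ioi.compl, hX.lintegral_occupation hr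
    (measurable_one.indicator measurableSet_Ioi.compl)]
  simp [hX.pos]

lemma ae_occupation_pos (hX : IsDiffusion b σ ℱ P x X) (hr : DiscountRegular r) :
    ∀ᵐ y ∂(occupation r P X), y ∈ Ioi (0 : ℝ) :=
  hX.occupation_compl hr

lemma aemeasurable_occupation (hX : IsDiffusion b σ ℱ P x X) (hr : DiscountRegular r)
    (hg : ContinuousOn g (Ioi 0)) : AEMeasurable g (occupation r P X) :=
  ⟨_, measurable_indicator_Ioi hg, by
    filter_upwards [hX.ae_occupation_pos hr] with y hy using (indicator_of_mem hy g).symm⟩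

lemma lintegral_ofReal_occupation (hX : IsDiffusion b σ ℱ P x X) (hr : DiscountRegular r)
    (hg : ContinuousOn g (Ioi 0)) :
    ∫⁻ y, ENNReal.ofReal (g y) ∂(occupation r P X) = ∫⁻ ω, (∫⁻ t in Ioi (0 : ℝ),
      ENNReal.ofReal (discount r X t ω * g (X t.toNNReal ω))) ∂P := by
  have h : ∫⁻ y, ENNReal.ofReal (g y) ∂(occupation r P X) =
      ∫⁻ y, ENNReal.ofReal ((Ioi (0 : ℝ)).indicator g y) ∂(occupation r P X) := by
    refine lintegral_congr_ae ?_
    filter_upwards [hX.ae_occupation_pos hr] with y hy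
    rw [indicator_of_mem hy]
  rw [h, hX.lintegral_occupation hr (measurable_indicator_Ioi hg).ennreal_ofReal]
  refine lintegral_congr fun ω => lintegral_congr fun t => ?_
  rw [indicator_of_mem (show X t.toNNReal ω ∈ Ioi 0 from hX.pos _ _),
    ENNReal.ofReal_mul discount_pos.le]

lemma lintegral_discountRate_occupation (hX : IsDiffusion b σ ℱ P x X) (hr : DiscountRegular r) :
    ∫⁻ y, ENNReal.ofReal (r y) ∂(occupation r P X) = 1 := by
  rw [hX.lintegral_ofReal_occupation hr hr.continuousOn]
  have h : ∀ ω, ∫⁻ t in Ioi (0 : ℝ),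
      ENNReal.ofReal (discount r X t ω * r (X t.toNNReal ω)) = 1 := fun ω => by
    obtain ⟨h1, h2⟩ := hX.integrableOn_discount_mul hr ω
    rw [← ofReal_integral_eq_lintegral_ofReal h1, h2, ENNReal.ofReal_one]
    filter_upwards with t
    exact mul_nonneg discount_pos.le (hr.pos_of_pos (hX.pos _ ω)).le
  simp [h]

lemma isFiniteMeasure_occupation (hX : IsDiffusion b σ ℱ P x X) (hr : DiscountRegular r) :
    IsFiniteMeasure (occupation r P X) := by
  obtain ⟨r₀, hr0, hrr⟩ := hr.pos
  constructor
  have h : ENNReal.ofReal r₀ * occupation r P X univ ≤ 1 := by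
    rw [← hX.lintegral_discountRate_occupation hr, ← setLIntegral_univ, ← setLIntegral_const]
    refine lintegral_mono_ae ?_
    rw [Measure.restrict_univ]
    filter_upwards [hX.ae_occupation_pos hr] with y hy
    exact ENNReal.ofReal_le_ofReal (hrr y (le_of_lt hy))
  by_contra hcon
  rw [not_lt_top_iff] at hcon
  rw [hcon, ENNReal.mul_top (by simpa using hr0)] at h
  simp at h

lemma integrable_prod_of_occupation (hX : IsDiffusion b σ ℱ P x X) (hr : DiscountRegular r)
    (hg : ContinuousOn g (Ioi 0)) (hgi : Integrable g (occupation r P X)) :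
    Integrable (fun p : Ω × ℝ => discount r X p.2 p.1 * g (X p.2.toNNReal p.1))
      (P.prod (volume.restrict (Ioi (0 : ℝ)))) := by
  refine ⟨((hX.measurable_uncurry_discount hr).mul
    (hX.measurable_uncurry_comp hg)).aestronglyMeasurable, ?_⟩
  rw [hasFiniteIntegral_iff_norm, lintegral_prod]
  swap
  · exact ((hX.measurable_uncurry_discount hr).mul
      (hX.measurable_uncurry_comp hg)).norm.ennreal_ofReal.aemeasurable
  have h := hgi.norm.lintegral_lt_top
  simp only [Real.norm_eq_abs] at h
  rw [hX.lintegral_ofReal_occupation hr hg.abs] at h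
  refine lt_of_eq_of_lt (lintegral_congr fun ω => lintegral_congr fun t => ?_) h
  rw [Real.norm_eq_abs, abs_mul, abs_of_pos discount_pos]

lemma integral_occupation (hX : IsDiffusion b σ ℱ P x X) (hr : DiscountRegular r)
    (hg : ContinuousOn g (Ioi 0)) (hgi : Integrable g (occupation r P X)) :
    ∫ y, g y ∂(occupation r P X) =
      ∫ ω, (∫ t in Ioi (0 : ℝ), discount r X t ω * g (X t.toNNReal ω)) ∂P := by
  have h : ∫ y, g y ∂(occupation r P X) =
      ∫ y, (Ioi (0 : ℝ)).indicator g y ∂(occupation r P X) := by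
    refine integral_congr_ae ?_
    filter_upwards [hX.ae_occupation_pos hr] with y hy
    rw [indicator_of_mem hy]
  have hm := (hX.measurable_uncurry_discount hr).ennreal_ofReal
  rw [h, occupation, integral_map hX.measurable_uncurry.aemeasurable
    (measurable_indicator_Ioi hg).aestronglyMeasurable,
    integral_withDensity_eq_integral_toReal_smul hm
      (Eventually.of_forall fun _ => ENNReal.ofReal_lt_top),
    ← integral_prod (fun p : Ω × ℝ => discount r X p.2 p.1 * g (X p.2.toNNReal p.1))
      (hX.integrable_prod_of_occupation hr hg hgi)]
  refine integral_congr_ae (Eventually.of_forall fun p => ?_)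
  simp only [smul_eq_mul]
  rw [indicator_of_mem (show X p.2.toNNReal p.1 ∈ Ioi 0 from hX.pos _ _),
    ENNReal.toReal_ofReal discount_pos.le]

lemma integrable_occupation (hX : IsDiffusion b σ ℱ P x X) (hr : DiscountRegular r)
    (hg : ContinuousOn g (Ioi 0))
    (h : (∫⁻ ω, (∫⁻ t in Ioi (0 : ℝ),
      ENNReal.ofReal (discount r X t ω * |g (X t.toNNReal ω)|)) ∂P) < ∞) :
    Integrable g (occupation r P X) := by
  refine ⟨(hX.aemeasurable_occupation hr hg).aestronglyMeasurable, ?_⟩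
  rw [hasFiniteIntegral_iff_norm]
  simp only [Real.norm_eq_abs]
  rwa [hX.lintegral_ofReal_occupation hr hg.abs]

end IsDiffusion

/-! ### The occupation measure inverts the operator `ℒ` -/

lemma martingale_integral_mul {Ω : Type*} {mΩ : MeasurableSpace Ω} {P : Measure Ω}
    [IsProbabilityMeasure P] {ℱ : Filtration ℝ≥0 mΩ} {M : ℝ≥0 → Ω → ℝ} (hM : Martingale M ℱ P)
    {s t : ℝ≥0} (hst : s ≤ t) {d : Ω → ℝ} (hd : Measurable[ℱ s] d) {B : ℝ} (hB : ∀ ω, |d ω| ≤ B) :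
    ∫ ω, M t ω * d ω ∂P = ∫ ω, M s ω * d ω ∂P := by
  have hdm := (hd.mono (ℱ.le s) le_rfl).aestronglyMeasurable (μ := P)
  have hint : Integrable (M t * d) P := by
    have := (hM.integrable t).bdd_mul (c := B) hdm
      (Eventually.of_forall fun ω => by simpa using hB ω)
    convert this using 1
    ext ω
    simp [mul_comm]
  have h1 := condExp_mul_of_stronglyMeasurable_right hd.stronglyMeasurable hint (hM.integrable t)
  rw [← integral_condExp (ℱ.le s) (f := fun ω => M t ω * d ω)]
  refine integral_congr_ae ?_
  filter_upwards [h1, hM.condExp_ae_eq hst] with ω h2 h3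
  rw [← h3]
  exact h2

/-- The expectation of an integration by parts, without stochastic integrals: by Fubini it reduces
to `E[M_t d_s] = E[M_s d_s]` for each `s ≤ t`. -/
lemma martingale_integral_mul_integral {Ω : Type*} {mΩ : MeasurableSpace Ω} {P : Measure Ω}
    [IsProbabilityMeasure P] {ℱ : Filtration ℝ≥0 mΩ} {M d : ℝ≥0 → Ω → ℝ}
    (hM : Martingale M ℱ P) (hMc : ∀ ω, Continuous fun s => M s ω)
    (hd : ∀ s, Measurable[ℱ s] (d s)) (hdc : ∀ ω, Continuous fun s => d s ω)
    {t : ℝ≥0} {B B' : ℝ} (hMB : ∀ s ≤ t, ∀ ω, |M s ω| ≤ B) (hdB : ∀ s ω, |d s ω| ≤ B') :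
    ∫ ω, M t ω * (∫ s in (0 : ℝ)..t, d s.toNNReal ω) ∂P =
      ∫ ω, (∫ s in (0 : ℝ)..t, M s.toNNReal ω * d s.toNNReal ω) ∂P := by
  have hMm : ∀ s, Measurable (M s) := fun s =>
    ((hM.stronglyMeasurable s).mono (ℱ.le s)).measurable
  have hdm : ∀ s, Measurable (d s) := fun s => (hd s).mono (ℱ.le s) le_rfl
  have hMu : Measurable fun p : Ω × ℝ => M p.2.toNNReal p.1 :=
    (measurable_uncurry_of_continuous_of_measurable (u := fun (s : ℝ) ω => M s.toNNReal ω)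
      (fun ω => (hMc ω).comp continuous_real_toNNReal) fun s => hMm _).comp measurable_swap
  have hdu : Measurable fun p : Ω × ℝ => d p.2.toNNReal p.1 :=
    (measurable_uncurry_of_continuous_of_measurable (u := fun (s : ℝ) ω => d s.toNNReal ω)
      (fun ω => (hdc ω).comp continuous_real_toNNReal) fun s => hdm _).comp measurable_swap
  have hBB : ∀ s ≤ t, ∀ u ω, |M s ω * d u ω| ≤ B * B' := fun s hs u ω => by
    rw [abs_mul]
    exact mul_le_mul (hMB s hs ω) (hdB u ω) (abs_nonneg _) ((abs_nonneg _).trans (hMB s hs ω))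
  have h1 : Integrable (Function.uncurry fun (ω : Ω) (s : ℝ) => M t ω * d s.toNNReal ω)
      (P.prod (volume.restrict (Ioc (0 : ℝ) t))) :=
    Integrable.of_bound (((hMm t).comp measurable_fst).mul hdu).aestronglyMeasurable (B * B')
      (Eventually.of_forall fun p => hBB t le_rfl _ _)
  have h2 : Integrable (Function.uncurry fun (ω : Ω) (s : ℝ) => M s.toNNReal ω * d s.toNNReal ω)
      (P.prod (volume.restrict (Ioc (0 : ℝ) t))) := by
    refine Integrable.of_bound (hMu.mul hdu).aestronglyMeasurable (B * B') ?_
    have h3 : ∀ᵐ p : Ω × ℝ ∂(P.prod (volume.restrict (Ioc (0 : ℝ) t))), p.2 ∈ Ioc (0 : ℝ) t :=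
      Measure.quasiMeasurePreserving_snd.ae (ae_restrict_mem measurableSet_Ioc)
    filter_upwards [h3] with p hp
    exact hBB _ (Real.toNNReal_le_iff_le_coe.2 hp.2) _ _
  simp only [intervalIntegral.integral_of_le t.coe_nonneg, ← integral_const_mul]
  rw [integral_integral_swap h1, integral_integral_swap h2]
  refine setIntegral_congr_fun measurableSet_Ioc fun s hs => ?_
  exact martingale_integral_mul hM (Real.toNNReal_le_iff_le_coe.2 hs.2) (hd _)
    (fun ω => hdB _ ω)

/-- Continuous functions with compact support in `(0, ∞)`. -/
def testFunctions : Submodule ℝ (ℝ → ℝ) where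
  carrier := {g | Continuous g ∧ HasCompactSupport g ∧ tsupport g ⊆ Ioi 0}
  add_mem' := fun {f g} hf hg => ⟨hf.1.add hg.1, hf.2.1.add hg.2.1,
    (tsupport_add f g).trans (union_subset hf.2.2 hg.2.2)⟩
  zero_mem' := ⟨continuous_zero, HasCompactSupport.zero, by simp [tsupport]⟩
  smul_mem' := fun a g hg => ⟨hg.1.const_smul a, hg.2.1.smul_left,
    (closure_mono (Function.support_const_smul_subset a g)).trans hg.2.2⟩

/-- The coefficients are controlled on `(0, ∞)` only. A function vanishing off a compact subset of
`(0, ∞)` is nevertheless continuous on the whole line. -/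
lemma mem_testFunctions_of_support {f g : ℝ → ℝ} (hf : HasCompactSupport f)
    (hf0 : tsupport f ⊆ Ioi 0) (hg : ContinuousOn g (Ioi 0)) (hgf : ∀ x ∉ tsupport f, g x = 0) :
    g ∈ testFunctions := by
  have hs : tsupport g ⊆ tsupport f :=
    closure_minimal (fun x hx => by_contra fun h => hx (hgf x h)) (isClosed_tsupport f)
  refine ⟨?_, hf.of_isClosed_subset (isClosed_tsupport g) hs, hs.trans hf0⟩
  rw [continuous_iff_continuousAt]
  intro x
  by_cases hx : x ∈ tsupport f
  · exact hg.continuousAt (Ioi_mem_nhds (hf0 hx))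
  · have : g =ᶠ[𝓝 x] fun _ => 0 := by
      filter_upwards [(isClosed_tsupport f).isOpen_compl.mem_nhds hx] with y hy using hgf y hy
    exact continuousAt_const.congr this.symm

lemma continuousOn_generator {b σ f : ℝ → ℝ} (hc : CoefficientsRegular b σ)
    (hf : ContDiff ℝ 2 f) : ContinuousOn (generator b σ f) (Ioi 0) := by
  have h1 : ContDiff ℝ 1 (deriv f) := by
    rw [show (2 : WithTop ℕ∞) = 1 + 1 by norm_num, contDiff_succ_iff_deriv] at hf
    exact hf.2.2
  exact ((continuousOn_const.mul (hc.continuousOn_σ.pow 2)).mul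
    (h1.continuous_deriv le_rfl).continuousOn).add
    (hc.continuousOn_b.mul h1.continuous.continuousOn)

lemma generator_mem_testFunctions {b σ f : ℝ → ℝ} (hc : CoefficientsRegular b σ)
    (hf : ContDiff ℝ 2 f) (hfc : HasCompactSupport f) (hf0 : tsupport f ⊆ Ioi 0) :
    generator b σ f ∈ testFunctions := by
  refine mem_testFunctions_of_support hfc hf0 (continuousOn_generator hc hf) fun x hx => ?_
  have h1 : f =ᶠ[𝓝 x] fun _ => 0 := notMem_tsupport_iff_eventuallyEq.1 hx
  have h2 : deriv f =ᶠ[𝓝 x] fun _ => 0 := h1.deriv.trans (by simp)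
  simp [generator, h2.deriv_eq, h2.eq_of_nhds]

lemma exists_bound_of_mem_testFunctions {g : ℝ → ℝ} (hg : g ∈ testFunctions) :
    ∃ B, ∀ x, |g x| ≤ B :=
  hg.2.1.exists_bound_of_continuous hg.1

namespace IsDiffusion

variable {Ω : Type*} {mΩ : MeasurableSpace Ω} {P : Measure Ω} [IsProbabilityMeasure P]
  {ℱ : Filtration ℝ≥0 mΩ} {b σ r g : ℝ → ℝ} {x : ℝ} {X : ℝ≥0 → Ω → ℝ}

/-- Dynkin's formula with killing at rate `r`, obtained from the undiscounted martingale `M = f(X) -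
A`, where `A` is the integrated generator, and the discount factor `D`, which has finite variation.
-/
lemma integral_discount_mul (hX : IsDiffusion b σ ℱ P x X) (hc : CoefficientsRegular b σ)
    (hr : DiscountRegular r) {f : ℝ → ℝ} (hf : ContDiff ℝ 2 f) (hfc : HasCompactSupport f)
    (hf0 : tsupport f ⊆ Ioi 0) (t : ℝ≥0) :
    ∫ ω, f (X t ω) * discount r X t ω ∂P =
      f x + ∫ ω, (∫ s in (0 : ℝ)..t, discount r X s ω * opL b σ r f (X s.toNNReal ω)) ∂P := by
  have hAt := generator_mem_testFunctions hc hf hfc hf0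
  have hAc : ContinuousOn (generator b σ f) (Ioi 0) := hAt.1.continuousOn
  have hfC : ContinuousOn f (Ioi 0) := hf.continuous.continuousOn
  obtain ⟨BA, hBA⟩ := exists_bound_of_mem_testFunctions hAt
  obtain ⟨Bf, hBf⟩ := exists_bound_of_mem_testFunctions
    (show f ∈ testFunctions from ⟨hf.continuous, hfc, hf0⟩)
  obtain ⟨Br, hBr⟩ := hr.bdd
  have hM := hX.martingale f hf hfc hf0
  set A : ℝ → Ω → ℝ := fun t ω => ∫ s in (0 : ℝ)..t, generator b σ f (X s.toNNReal ω) with hA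
  set M : ℝ≥0 → Ω → ℝ := fun t ω => f (X t ω) - A t ω with hMdef
  have hAcont : ∀ ω, Continuous fun s => A s ω := fun ω =>
    continuous_iff_continuousAt.2 fun s => (hX.hasDerivAt_integral hAc ω s).continuousAt
  have hMc : ∀ ω, Continuous fun s => M s ω := fun ω =>
    (hf.continuous.comp (hX.cont ω)).sub ((hAcont ω).comp NNReal.continuous_coe)
  have hAB : ∀ s : ℝ, 0 ≤ s → ∀ ω, |A s ω| ≤ BA * s := fun s hs ω => by
    have := intervalIntegral.norm_integral_le_of_norm_le_const (a := 0) (b := s) (C := BA)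
      (f := fun s : ℝ => generator b σ f (X s.toNNReal ω)) fun u _ => hBA _
    simpa [abs_of_nonneg hs] using this
  have hBA0 : 0 ≤ BA := (abs_nonneg _).trans (hBA 0)
  have hMB : ∀ s ≤ t, ∀ ω, |M s ω| ≤ Bf + BA * t := fun s hs ω => by
    refine (abs_sub _ _).trans (add_le_add (hBf _) ((hAB s s.coe_nonneg ω).trans ?_))
    exact mul_le_mul_of_nonneg_left (NNReal.coe_le_coe.2 hs) hBA0
  set d : ℝ≥0 → Ω → ℝ := fun s ω => -(discount r X s ω * r (X s ω)) with hd
  have hdm : ∀ s, Measurable[ℱ s] (d s) := fun s =>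
    ((hX.measurable_discount_adapted hr s).mul
      (hX.measurable_comp_adapted hr.continuousOn s)).neg
  have hdc : ∀ ω, Continuous fun s => d s ω := fun ω =>
    (((hX.continuous_discount hr ω).comp NNReal.continuous_coe).mul
      (hr.continuousOn.comp_continuous (hX.cont ω) fun s => hX.pos s ω)).neg
  have hdB : ∀ s ω, |d s ω| ≤ Br := fun s ω => by
    rw [hd, abs_neg, abs_mul, abs_of_pos discount_pos]
    have h1 := hX.discount_le_one hr s.coe_nonneg ω
    have h2 := hBr _ (hX.pos s ω).le
    calc discount r X s ω * |r (X s ω)| ≤ 1 * |r (X s ω)| := by gcongr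
      _ ≤ Br := by rwa [one_mul]
  have key := martingale_integral_mul_integral hM hMc hdm hdc hMB hdB
  have hdint : ∀ ω, ∫ s in (0 : ℝ)..t, d s.toNNReal ω = discount r X t ω - 1 := fun ω => by
    have h1 : ∀ s ∈ uIcc (0 : ℝ) t, HasDerivAt (fun u => discount r X u ω) (d s.toNNReal ω) s := by
      intro s hs
      rw [uIcc_of_le t.coe_nonneg] at hs
      refine (hX.hasDerivAt_discount hr ω s).congr_deriv ?_
      rw [hd]
      simp only [Real.coe_toNNReal s hs.1]
    rw [intervalIntegral.integral_eq_sub_of_hasDerivAt h1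
      (((hdc ω).comp continuous_real_toNNReal).intervalIntegrable 0 t)]
    simp [discount]
  have hparts : ∀ ω, discount r X t ω * A t ω = ∫ s in (0 : ℝ)..t,
      (d s.toNNReal ω * A s ω + discount r X s ω * generator b σ f (X s.toNNReal ω)) := fun ω => by
    have h1 : ∀ s ∈ uIcc (0 : ℝ) t, HasDerivAt (fun u => discount r X u ω * A u ω)
        (d s.toNNReal ω * A s ω + discount r X s ω * generator b σ f (X s.toNNReal ω)) s := by
      intro s hs
      rw [uIcc_of_le t.coe_nonneg] at hs
      refine ((hX.hasDerivAt_discount hr ω s).mul (hX.hasDerivAt_integral hAc ω s)).congr_deriv ?_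
      rw [hd]
      simp only [Real.coe_toNNReal s hs.1, hA]
    rw [intervalIntegral.integral_eq_sub_of_hasDerivAt h1]
    · simp [hA]
    · exact ((((hdc ω).comp continuous_real_toNNReal).mul (hAcont ω)).add
        ((hX.continuous_discount hr ω).mul (hX.continuous_comp hAc ω))).intervalIntegrable 0 t
  have hM0 : ∫ ω, M t ω ∂P = f x := by
    have h1 := hM.setIntegral_eq (zero_le : 0 ≤ t) MeasurableSet.univ
    rw [setIntegral_univ, setIntegral_univ] at h1
    rw [← h1]
    simp [hMdef, hA, hX.init]
  have hMt := hM.integrable t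
  have hDm := hX.measurable_discount hr t
  have hMD : Integrable (fun ω => M t ω * (discount r X t ω - 1)) P := by
    have := hMt.bdd_mul (c := 1) (hDm.sub_const 1).aestronglyMeasurable
      (Eventually.of_forall fun ω => by
        rw [Real.norm_eq_abs, abs_le]
        constructor <;> linarith [discount_pos (r := r) (X := X) (t := t) (ω := ω),
          hX.discount_le_one hr t.coe_nonneg ω])
    simpa only [mul_comm] using this
  have hAD : Integrable (fun ω => discount r X t ω * A t ω) P := by
    refine Integrable.of_bound (hDm.mul (hX.measurable_integral hAc t)).aestronglyMeasurable
      (BA * t) (Eventually.of_forall fun ω => ?_)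
    rw [Real.norm_eq_abs, abs_mul, abs_of_pos discount_pos]
    calc discount r X t ω * |A t ω| ≤ 1 * |A t ω| := by
          gcongr
          exact hX.discount_le_one hr t.coe_nonneg ω
      _ ≤ BA * t := by
          rw [one_mul]
          exact hAB t t.coe_nonneg ω
  simp only [hdint] at key
  -- Each summand is computable in expectation: `M` by the martingale property, `M(D - 1)` by `key`
  -- as `D - 1` is the integral of `d = D'`, and `DA` by pathwise parts.
  have hsum : ∀ ω, f (X t ω) * discount r X t ω =
      M t ω + M t ω * (discount r X t ω - 1) + discount r X t ω * A t ω := fun ω => by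
    simp only [hMdef]
    ring
  have hI1 : Integrable (fun ω => ∫ s in (0 : ℝ)..t, M s.toNNReal ω * d s.toNNReal ω) P := by
    have hm : Measurable fun ω => ∫ s in (0 : ℝ)..t, M s.toNNReal ω * d s.toNNReal ω :=
      measurable_intervalIntegral_of_continuous
        (fun ω => ((hMc ω).comp continuous_real_toNNReal).mul
          ((hdc ω).comp continuous_real_toNNReal))
        (fun s => (((hM.stronglyMeasurable _).mono (ℱ.le _)).measurable).mul
          ((hdm _).mono (ℱ.le _) le_rfl)) t
    refine Integrable.of_bound hm.aestronglyMeasurable ((Bf + BA * t) * Br * |(t : ℝ) - 0|)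
      (Eventually.of_forall fun ω => ?_)
    refine intervalIntegral.norm_integral_le_of_norm_le_const fun s hs => ?_
    rw [uIoc_of_le t.coe_nonneg] at hs
    rw [norm_mul]
    have h1 := hMB s.toNNReal (Real.toNNReal_le_iff_le_coe.2 hs.2) ω
    exact mul_le_mul h1 (hdB _ _) (norm_nonneg _) ((abs_nonneg _).trans h1)
  simp only [hsum]
  rw [integral_add (f := fun ω => M t ω + M t ω * (discount r X t ω - 1)) (hMt.add hMD) hAD,
    integral_add hMt hMD, hM0, key, add_assoc, ← integral_add hI1 hAD]
  congr 1
  refine integral_congr_ae (Eventually.of_forall fun ω => ?_)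
  simp only [hparts ω]
  rw [← intervalIntegral.integral_add]
  -- Here `M d + d A = f(X) d = -D r f(X)`, which supplies the zeroth-order term of `ℒ`.
  · refine intervalIntegral.integral_congr fun s hs => ?_
    rw [uIcc_of_le t.coe_nonneg] at hs
    simp only [hMdef, hd, Real.coe_toNNReal s hs.1, opL, generator]
    ring
  · exact ((((hMc ω).comp continuous_real_toNNReal).mul
      ((hdc ω).comp continuous_real_toNNReal))).intervalIntegrable 0 t
  · exact ((((hdc ω).comp continuous_real_toNNReal).mul (hAcont ω)).add
        ((hX.continuous_discount hr ω).mul (hX.continuous_comp hAc ω))).intervalIntegrable 0 t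

lemma opL_mem_testFunctions (hc : CoefficientsRegular b σ) (hr : DiscountRegular r) {f : ℝ → ℝ}
    (hf : ContDiff ℝ 2 f) (hfc : HasCompactSupport f) (hf0 : tsupport f ⊆ Ioi 0) :
    opL b σ r f ∈ testFunctions := by
  have h1 := generator_mem_testFunctions hc hf hfc hf0
  have h2 : (fun x => r x * f x) ∈ testFunctions :=
    mem_testFunctions_of_support hfc hf0 (hr.continuousOn.mul hf.continuous.continuousOn)
      fun x hx => by rw [image_eq_zero_of_notMem_tsupport hx, mul_zero]
  exact testFunctions.sub_mem h1 h2

/-- Let `t → ∞` in Dynkin's formula along the integers: `f` is bounded and the discount tends to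
`0`, so the boundary term disappears. -/
lemma integral_opL_occupation (hX : IsDiffusion b σ ℱ P x X) (hc : CoefficientsRegular b σ)
    (hr : DiscountRegular r) {f : ℝ → ℝ} (hf : ContDiff ℝ 2 f) (hfc : HasCompactSupport f)
    (hf0 : tsupport f ⊆ Ioi 0) : ∫ y, opL b σ r f y ∂(occupation r P X) = -f x := by
  have hL := opL_mem_testFunctions hc hr hf hfc hf0
  have hLc : ContinuousOn (opL b σ r f) (Ioi 0) := hL.1.continuousOn
  obtain ⟨B, hB⟩ := exists_bound_of_mem_testFunctions hL
  obtain ⟨Bf, hBf⟩ := exists_bound_of_mem_testFunctions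
    (show f ∈ testFunctions from ⟨hf.continuous, hfc, hf0⟩)
  obtain ⟨r₀, hr0, hrr⟩ := hr.pos
  have hB0 : 0 ≤ B := (abs_nonneg _).trans (hB 0)
  have := hX.isFiniteMeasure_occupation hr
  have hint : Integrable (opL b σ r f) (occupation r P X) :=
    Integrable.of_bound (hX.aemeasurable_occupation hr hLc).aestronglyMeasurable B
      (Eventually.of_forall hB)
  rw [hX.integral_occupation hr hLc hint]
  -- Since `r ≥ r₀`, the path integrand is dominated by a function of `t` whose integral is `B / r₀`
  -- for every `ω`; a single constant then dominates in `ω`.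
  have hdom : ∀ ω (t : ℝ), |discount r X t ω * opL b σ r f (X t.toNNReal ω)| ≤
      B / r₀ * (discount r X t ω * r (X t.toNNReal ω)) := fun ω t => by
    rw [abs_mul, abs_of_pos discount_pos, mul_left_comm]
    refine mul_le_mul_of_nonneg_left ?_ discount_pos.le
    calc _ ≤ B := hB _
      _ = B / r₀ * r₀ := by field_simp
      _ ≤ _ := by
        gcongr
        exact hrr _ (hX.pos _ ω).le
  have hmeas : ∀ ω, Continuous fun t : ℝ => discount r X t ω * opL b σ r f (X t.toNNReal ω) :=
    fun ω => (hX.continuous_discount hr ω).mul (hX.continuous_comp hLc ω)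
  have hpath : ∀ ω, IntegrableOn
      (fun t : ℝ => discount r X t ω * opL b σ r f (X t.toNNReal ω)) (Ioi 0) := fun ω =>
    ((hX.integrableOn_discount_mul hr ω).1.const_mul (B / r₀)).mono'
      (hmeas ω).aestronglyMeasurable (Eventually.of_forall fun t => hdom ω t)
  have hlim1 : Tendsto (fun n : ℕ => ∫ ω, (∫ s in (0 : ℝ)..((n : ℝ≥0) : ℝ),
      discount r X s ω * opL b σ r f (X s.toNNReal ω)) ∂P) atTop
      (𝓝 (∫ ω, (∫ t in Ioi (0 : ℝ), discount r X t ω * opL b σ r f (X t.toNNReal ω)) ∂P)) := by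
    refine tendsto_integral_of_dominated_convergence (fun _ => B / r₀) (fun n => ?_)
      (integrable_const _) (fun n => Eventually.of_forall fun ω => ?_)
      (Eventually.of_forall fun ω => ?_)
    · exact (measurable_intervalIntegral_of_continuous hmeas (fun s =>
        (hX.measurable_discount hr s).mul (hX.measurable_comp hLc _)) _).aestronglyMeasurable
    · rw [intervalIntegral.integral_of_le (NNReal.coe_nonneg _)]
      calc _ ≤ ∫ s in Ioc (0 : ℝ) ((n : ℝ≥0) : ℝ),
            B / r₀ * (discount r X s ω * r (X s.toNNReal ω)) := by
            refine norm_integral_le_of_norm_le ?_ (Eventually.of_forall fun s => hdom ω s)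
            exact ((hX.integrableOn_discount_mul hr ω).1.mono_set
              Ioc_subset_Ioi_self).const_mul (B / r₀)
        _ ≤ ∫ s in Ioi (0 : ℝ), B / r₀ * (discount r X s ω * r (X s.toNNReal ω)) := by
            refine setIntegral_mono_set
              ((hX.integrableOn_discount_mul hr ω).1.const_mul (B / r₀)) ?_
              Ioc_subset_Ioi_self.eventuallyLE
            exact Eventually.of_forall fun s => mul_nonneg (div_nonneg hB0 hr0.le)
              (mul_nonneg discount_pos.le (hr.pos_of_pos (hX.pos _ _)).le)
        _ = B / r₀ := by
            rw [integral_const_mul, (hX.integrableOn_discount_mul hr ω).2, mul_one]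
    · refine intervalIntegral_tendsto_integral_Ioi 0 (hpath ω) ?_
      simpa using tendsto_natCast_atTop_atTop
  have hlim2 : Tendsto (fun n : ℕ => ∫ ω, f (X (n : ℝ≥0) ω) *
      discount r X ((n : ℝ≥0) : ℝ) ω ∂P) atTop (𝓝 (∫ _ω, (0 : ℝ) ∂P)) := by
    refine tendsto_integral_of_dominated_convergence (fun _ => Bf) (fun n => ?_)
      (integrable_const _) (fun n => Eventually.of_forall fun ω => ?_)
      (Eventually.of_forall fun ω => ?_)
    · exact ((hX.measurable_comp hf.continuous.continuousOn _).mul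
        (hX.measurable_discount hr _)).aestronglyMeasurable
    · rw [norm_mul, Real.norm_eq_abs, Real.norm_eq_abs, abs_of_pos discount_pos]
      calc _ ≤ |f (X (n : ℝ≥0) ω)| * 1 := by
            gcongr
            exact hX.discount_le_one hr (NNReal.coe_nonneg _) ω
        _ ≤ Bf := by
            rw [mul_one]
            exact hBf _
    · have h1 : Tendsto (fun n : ℕ => discount r X ((n : ℝ≥0) : ℝ) ω) atTop (𝓝 0) :=
        (hX.tendsto_discount hr ω).comp (by simpa using tendsto_natCast_atTop_atTop)
      refine squeeze_zero_norm (a := fun n : ℕ => Bf * discount r X ((n : ℝ≥0) : ℝ) ω)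
        (fun n => ?_) (by simpa using h1.const_mul Bf)
      rw [norm_mul, Real.norm_eq_abs, Real.norm_eq_abs, abs_of_pos discount_pos]
      exact mul_le_mul_of_nonneg_right (hBf _) discount_pos.le
  have h3 := tendsto_nhds_unique hlim2 (by
    simpa only [hX.integral_discount_mul hc hr hf hfc hf0] using hlim1.const_add (f x))
  simp only [integral_zero] at h3
  linarith

end IsDiffusion

/-! ### Test functions and cutoffs -/

lemma exists_bounds_of_mem_testFunctions {g : ℝ → ℝ} (hg : g ∈ testFunctions) :
    ∃ a c, 0 < a ∧ a < c ∧ ∀ x, x ∉ Ioo a c → g x = 0 := by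
  obtain ⟨B, hB⟩ := hg.2.1.isCompact.bddAbove
  have hmin : ∃ a, 0 < a ∧ ∀ x ∈ tsupport g, a < x := by
    rcases (tsupport g).eq_empty_or_nonempty with he | hne
    · exact ⟨1, one_pos, by simp [he]⟩
    · obtain ⟨y, hy, hy'⟩ := hg.2.1.isCompact.exists_isLeast hne
      have hy0 : 0 < y := hg.2.2 hy
      exact ⟨y / 2, half_pos hy0, fun x hx => (half_lt_self hy0).trans_le (hy' hx)⟩
  obtain ⟨a, ha, ha'⟩ := hmin
  refine ⟨a, max (a + 1) (B + 1), ha, (lt_add_one a).trans_le (le_max_left _ _), fun x hx => ?_⟩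
  by_contra hgx
  have hxs := subset_tsupport g hgx
  exact hx ⟨ha' x hxs, ((hB hxs).trans_lt (lt_add_one B)).trans_le (le_max_right _ _)⟩

lemma mul_mem_testFunctions {g w : ℝ → ℝ} (hg : g ∈ testFunctions)
    (hw : ContinuousOn w (Ioi 0)) : (fun x => g x * w x) ∈ testFunctions :=
  mem_testFunctions_of_support hg.2.1 hg.2.2 (hg.1.continuousOn.mul hw)
    fun x hx => by rw [image_eq_zero_of_notMem_tsupport hx, zero_mul]

lemma integrable_of_mem_testFunctions {g : ℝ → ℝ} (hg : g ∈ testFunctions) (μ : Measure ℝ)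
    [IsFiniteMeasureOnCompacts μ] : Integrable g μ :=
  hg.1.integrable_of_hasCompactSupport hg.2.1

/-- A sequence of test functions increasing to the indicator function of `(0, ∞)`. -/
noncomputable def cutoff (n : ℕ) (x : ℝ) : ℝ := max 0 (min 1 (min (n * x - 1) (n + 2 - x)))

lemma cutoff_nonneg (n : ℕ) (x : ℝ) : 0 ≤ cutoff n x := le_max_left _ _

lemma continuous_cutoff (n : ℕ) : Continuous (cutoff n) := by
  unfold cutoff
  fun_prop

lemma cutoff_of_nonpos (n : ℕ) {x : ℝ} (hx : x ≤ 0) : cutoff n x = 0 := by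
  refine max_eq_left ((min_le_right _ _).trans ((min_le_left _ _).trans ?_))
  have : (n : ℝ) * x ≤ 0 := mul_nonpos_of_nonneg_of_nonpos n.cast_nonneg hx
  linarith

lemma monotone_cutoff (x : ℝ) : Monotone fun n => cutoff n x := by
  intro n n' hn
  rcases le_total x 0 with hx | hx
  · simp [cutoff_of_nonpos _ hx]
  · have hn' : (n : ℝ) ≤ n' := Nat.cast_le.2 hn
    simp only [cutoff]
    gcongr

lemma eventually_cutoff_eq_one {x : ℝ} (hx : 0 < x) : ∀ᶠ n in atTop, cutoff n x = 1 := by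
  obtain ⟨N, hN⟩ := exists_nat_ge (max (2 / x) x)
  filter_upwards [eventually_ge_atTop N] with n hn
  have hn' : (N : ℝ) ≤ n := Nat.cast_le.2 hn
  have h1 : 2 / x ≤ n := (le_max_left _ _).trans (hN.trans hn')
  have h2 : x ≤ n := (le_max_right _ _).trans (hN.trans hn')
  rw [div_le_iff₀ hx] at h1
  rw [cutoff, min_eq_left (le_min (by linarith) (by linarith)), max_eq_right zero_le_one]

lemma cutoff_mem_testFunctions (n : ℕ) : cutoff n ∈ testFunctions := by
  rcases n.eq_zero_or_pos with rfl | hn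
  · have : cutoff 0 = 0 := by
      ext x
      refine max_eq_left ((min_le_right _ _).trans ((min_le_left _ _).trans ?_))
      simp
    rw [this]
    exact testFunctions.zero_mem
  · have hn' : (0 : ℝ) < n := Nat.cast_pos.2 hn
    have hs : tsupport (cutoff n) ⊆ Icc (1 / (n : ℝ)) (n + 2) := by
      refine closure_minimal (fun x hx => ?_) isClosed_Icc
      by_contra hcon
      refine hx (max_eq_left ((min_le_right _ _).trans ?_))
      rw [mem_Icc, not_and_or, not_le, not_le] at hcon
      rcases hcon with h | h
      · rw [lt_div_iff₀ hn'] at h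
        exact (min_le_left _ _).trans (by linarith)
      · exact (min_le_right _ _).trans (by linarith)
    refine ⟨continuous_cutoff n, isCompact_Icc.of_isClosed_subset (isClosed_tsupport _) hs,
      fun x hx => ?_⟩
    exact (one_div_pos.2 hn').trans_le (hs hx).1

/-! ### Measures determined by test functions -/

/-- Test against a cutoff times the negative part of `w`: the left side is nonnegative, while the
right side is negative if `w` is negative at `y`. -/
lemma nonneg_of_integral_testFunctions {μ : Measure ℝ} {w : ℝ → ℝ}
    (hw : ContinuousOn w (Ioi 0))
    (h : ∀ g ∈ testFunctions, ∫ y, g y ∂μ = ∫ y, g y * w y) {y : ℝ} (hy : 0 < y) : 0 ≤ w y := by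
  by_contra! hneg
  obtain ⟨n, hn⟩ := (eventually_cutoff_eq_one hy).exists
  have hwm : ContinuousOn (fun y => max (-w y) 0) (Ioi 0) :=
    fun y hy => (hw.neg y hy).max continuousWithinAt_const
  have hg := mul_mem_testFunctions (cutoff_mem_testFunctions n) hwm
  have h1 := h _ hg
  have h2 : 0 ≤ ∫ y, cutoff n y * max (-w y) 0 ∂μ :=
    integral_nonneg fun y => mul_nonneg (cutoff_nonneg n y) (le_max_right _ _)
  have hg' := mul_mem_testFunctions hg hwm
  have h3 : ∫ y, cutoff n y * max (-w y) 0 * w y = -∫ y, cutoff n y * max (-w y) 0 *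
      max (-w y) 0 := by
    rw [← integral_neg]
    refine integral_congr_ae (Eventually.of_forall fun z => ?_)
    rcases le_total (w z) 0 with hz | hz
    · simp only [max_eq_left (neg_nonneg.2 hz)]
      ring
    · simp only [max_eq_right (neg_nonpos.2 hz)]
      ring
  have h4 : 0 < ∫ y, cutoff n y * max (-w y) 0 * max (-w y) 0 := by
    refine hg'.1.integral_pos_of_hasCompactSupport_nonneg_nonzero hg'.2.1 (fun z => ?_)
      (x := y) ?_
    · exact mul_nonneg (mul_nonneg (cutoff_nonneg n z) (le_max_right _ _)) (le_max_right _ _)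
    · rw [hn, max_eq_left (by linarith)]
      nlinarith
  linarith

/-- Monotone convergence along the cutoffs removes the compact support condition. -/
lemma lintegral_eq_of_integral_testFunctions {μ : Measure ℝ} [IsFiniteMeasure μ]
    (hμ : ∀ᵐ y ∂μ, y ∈ Ioi (0 : ℝ)) {w : ℝ → ℝ} (hw : ContinuousOn w (Ioi 0))
    (h : ∀ g ∈ testFunctions, ∫ y, g y ∂μ = ∫ y, g y * w y) {f : ℝ → ℝ}
    (hf : ContinuousOn f (Ioi 0)) (hf0 : ∀ y, 0 < y → 0 ≤ f y) :
    ∫⁻ y, ENNReal.ofReal (f y) ∂μ = ∫⁻ y in Ioi (0 : ℝ), ENNReal.ofReal (f y * w y) := by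
  have hw0 : ∀ y, 0 < y → 0 ≤ w y := fun y hy => nonneg_of_integral_testFunctions hw h hy
  have hg : ∀ n, (fun y => cutoff n y * f y) ∈ testFunctions := fun n =>
    mul_mem_testFunctions (cutoff_mem_testFunctions n) hf
  have hgw : ∀ n, (fun y => cutoff n y * f y * w y) ∈ testFunctions := fun n =>
    mul_mem_testFunctions (hg n) hw
  have hn : ∀ n, ∫⁻ y, ENNReal.ofReal (cutoff n y * f y) ∂μ =
      ∫⁻ y in Ioi (0 : ℝ), ENNReal.ofReal (cutoff n y * f y * w y) := fun n => by
    rw [← ofReal_integral_eq_lintegral_ofReal (integrable_of_mem_testFunctions (hg n) μ),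
      ← ofReal_integral_eq_lintegral_ofReal
        (integrable_of_mem_testFunctions (hgw n) volume).integrableOn, h _ (hg n)]
    · congr 1
      rw [setIntegral_eq_integral_of_forall_compl_eq_zero]
      intro y hy
      rw [cutoff_of_nonpos n (not_lt.1 hy)]
      ring
    · filter_upwards [ae_restrict_mem measurableSet_Ioi] with y hy
      exact mul_nonneg (mul_nonneg (cutoff_nonneg n y) (hf0 y hy)) (hw0 y hy)
    · filter_upwards [hμ] with y hy
      exact mul_nonneg (cutoff_nonneg n y) (hf0 y hy)
  have h1 : Tendsto (fun n => ∫⁻ y, ENNReal.ofReal (cutoff n y * f y) ∂μ) atTop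
      (𝓝 (∫⁻ y, ENNReal.ofReal (f y) ∂μ)) := by
    refine lintegral_tendsto_of_tendsto_of_monotone
      (fun n => (hg n).1.measurable.ennreal_ofReal.aemeasurable) ?_ ?_
    · filter_upwards [hμ] with y hy n n' hnn
      exact ENNReal.ofReal_le_ofReal
        (mul_le_mul_of_nonneg_right (monotone_cutoff y hnn) (hf0 y hy))
    · filter_upwards [hμ] with y hy
      refine tendsto_const_nhds.congr' ?_
      filter_upwards [eventually_cutoff_eq_one hy] with n hn
      rw [hn, one_mul]
  have h2 : Tendsto (fun n => ∫⁻ y in Ioi (0 : ℝ), ENNReal.ofReal (cutoff n y * f y * w y)) atTop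
      (𝓝 (∫⁻ y in Ioi (0 : ℝ), ENNReal.ofReal (f y * w y))) := by
    refine lintegral_tendsto_of_tendsto_of_monotone
      (fun n => (hgw n).1.measurable.ennreal_ofReal.aemeasurable) ?_ ?_
    · filter_upwards [ae_restrict_mem measurableSet_Ioi] with y hy n n' hnn
      refine ENNReal.ofReal_le_ofReal ?_
      rw [mul_assoc, mul_assoc]
      exact mul_le_mul_of_nonneg_right (monotone_cutoff y hnn) (mul_nonneg (hf0 y hy) (hw0 y hy))
    · filter_upwards [ae_restrict_mem measurableSet_Ioi] with y hy
      refine tendsto_const_nhds.congr' ?_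
      filter_upwards [eventually_cutoff_eq_one hy] with n hn
      rw [hn, one_mul]
  simp only [hn] at h1
  exact tendsto_nhds_unique h1 h2

/-! ### The Green function -/

/-- The density of the Green kernel with respect to Lebesgue measure. -/
noncomputable def greenDensity (b σ φ ψ : ℝ → ℝ) (x y : ℝ) : ℝ :=
  ψ (min y x) * φ (max y x) * speedDensity b σ y / wronskian b σ φ ψ 1

section Green

variable {b σ r φ ψ : ℝ → ℝ}

lemma greenDensity_of_le {x y : ℝ} (hyx : y ≤ x) : greenDensity b σ φ ψ x y =
    φ x / wronskian b σ φ ψ 1 * (ψ y * speedDensity b σ y) := by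
  rw [greenDensity, min_eq_left hyx, max_eq_right hyx]
  ring

lemma greenDensity_of_ge {x y : ℝ} (hyx : x ≤ y) : greenDensity b σ φ ψ x y =
    ψ x / wronskian b σ φ ψ 1 * (φ y * speedDensity b σ y) := by
  rw [greenDensity, min_eq_right hyx, max_eq_left hyx]
  ring

lemma integral_greenDensity {f : ℝ → ℝ} {x : ℝ} (hx : 0 < x)
    (hf : IntegrableOn (fun y => f y * greenDensity b σ φ ψ x y) (Ioi 0)) :
    ∫ y in Ioi (0 : ℝ), f y * greenDensity b σ φ ψ x y =
      (φ x * (∫ y in (0 : ℝ)..x, ψ y * f y * speedDensity b σ y) +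
        ψ x * ∫ y in Ioi x, φ y * f y * speedDensity b σ y) / wronskian b σ φ ψ 1 := by
  rw [← Ioc_union_Ioi_eq_Ioi hx.le, integrableOn_union] at hf
  rw [← Ioc_union_Ioi_eq_Ioi hx.le, setIntegral_union (Ioc_disjoint_Ioi le_rfl) measurableSet_Ioi
    hf.1 hf.2, intervalIntegral.integral_of_le hx.le, add_div, mul_div_right_comm,
    mul_div_right_comm, ← integral_const_mul, ← integral_const_mul]
  congr 1
  · refine setIntegral_congr_fun measurableSet_Ioc fun y hy => ?_
    simp only [greenDensity_of_le hy.2]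
    ring
  · refine setIntegral_congr_fun measurableSet_Ioi fun y hy => ?_
    simp only [greenDensity_of_ge (le_of_lt hy)]
    ring

namespace IsFundamentalPair

variable (h : IsFundamentalPair b σ r φ ψ)

include h

lemma wronskian_pos {x : ℝ} (hx : 0 < x) : 0 < wronskian b σ φ ψ x := by
  have h1 := mul_pos (h.φ_pos x hx) (h.flux_ψ_pos hx)
  have h2 := mul_pos (h.ψ_pos x hx) (neg_pos.2 (h.flux_φ_neg hx))
  rw [wronskian]
  linarith

lemma wronskian_const (hc : CoefficientsRegular b σ) {x : ℝ} (hx : 0 < x) :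
    φ x * flux b σ ψ x - ψ x * flux b σ φ x = wronskian b σ φ ψ 1 :=
  wronskian_eq hc r h.φ_C2 h.ψ_C2 h.φ_ode h.ψ_ode hx one_pos

lemma continuousOn_greenDensity (hc : CoefficientsRegular b σ) {x : ℝ} (hx : 0 < x) :
    ContinuousOn (greenDensity b σ φ ψ x) (Ioi 0) := by
  refine ContinuousOn.div_const (ContinuousOn.mul (ContinuousOn.mul ?_ ?_)
    (continuousOn_speedDensity hc)) _
  · exact h.continuousOn_ψ.comp (by fun_prop) fun y hy => lt_min hy hx
  · exact h.continuousOn_φ.comp (by fun_prop) fun y hy => lt_max_of_lt_right hx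

lemma greenDensity_pos (hc : CoefficientsRegular b σ) {x y : ℝ} (hx : 0 < x) (hy : 0 < y) :
    0 < greenDensity b σ φ ψ x y :=
  div_pos (mul_pos (mul_pos (h.ψ_pos _ (lt_min hy hx)) (h.φ_pos _ (lt_max_of_lt_right hx)))
    (speedDensity_pos hc hy)) (h.wronskian_pos one_pos)

lemma integrableOn_greenDensity_iff {f : ℝ → ℝ} {x : ℝ} (hx : 0 < x) :
    IntegrableOn (fun y => f y * greenDensity b σ φ ψ x y) (Ioi 0) ↔
      IntegrableOn (fun y => ψ y * f y * speedDensity b σ y) (Ioc 0 x) ∧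
      IntegrableOn (fun y => φ y * f y * speedDensity b σ y) (Ioi x) := by
  have hC := h.wronskian_pos one_pos
  rw [← Ioc_union_Ioi_eq_Ioi hx.le, integrableOn_union]
  refine and_congr ?_ ?_
  · rw [integrableOn_congr_fun (g := fun y => φ x / wronskian b σ φ ψ 1 *
      (ψ y * f y * speedDensity b σ y)) _ measurableSet_Ioc]
    · exact integrable_const_mul_iff (div_pos (h.φ_pos x hx) hC).ne'.isUnit _
    · intro y hy
      simp only [greenDensity_of_le hy.2]
      ring
  · rw [integrableOn_congr_fun (g := fun y => ψ x / wronskian b σ φ ψ 1 *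
      (φ y * f y * speedDensity b σ y)) _ measurableSet_Ioi]
    · exact integrable_const_mul_iff (div_pos (h.ψ_pos x hx) hC).ne'.isUnit _
    · intro y hy
      simp only [greenDensity_of_ge (le_of_lt hy)]
      ring

/-- Solution of `ℒ f = g` with compact support, for `g` orthogonal to `φ` and `ψ`. -/
lemma exists_opL_eq (hc : CoefficientsRegular b σ) (hr : DiscountRegular r) {g : ℝ → ℝ}
    (hg : g ∈ testFunctions) (hgφ : ∫ y, g y * (φ y * speedDensity b σ y) = 0)
    (hgψ : ∫ y, g y * (ψ y * speedDensity b σ y) = 0) :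
    ∃ f : ℝ → ℝ, ContDiff ℝ 2 f ∧ HasCompactSupport f ∧ tsupport f ⊆ Ioi 0 ∧
      (∀ x, 0 < x → opL b σ r f x = g x) ∧
      ∀ x, 0 < x → f x = -∫ y, g y * ((φ x * ψ (min y x) - ψ x * φ (min y x)) *
        speedDensity b σ y / wronskian b σ φ ψ 1) := by
  set C := wronskian b σ φ ψ 1 with hCdef
  have hC : 0 < C := h.wronskian_pos one_pos
  obtain ⟨a, c, ha, hac, hg0⟩ := exists_bounds_of_mem_testFunctions hg
  have hm := continuousOn_speedDensity hc
  have hkφ : (fun x => g x * (φ x * speedDensity b σ x)) ∈ testFunctions :=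
    mul_mem_testFunctions hg (h.continuousOn_φ.mul hm)
  have hkψ : (fun x => g x * (ψ x * speedDensity b σ x)) ∈ testFunctions :=
    mul_mem_testFunctions hg (h.continuousOn_ψ.mul hm)
  set A : ℝ → ℝ := fun x => ∫ y in a..x, g y * (φ y * speedDensity b σ y) with hA
  set B : ℝ → ℝ := fun x => ∫ y in a..x, g y * (ψ y * speedDensity b σ y) with hB
  have hAd : ∀ x, HasDerivAt A (g x * (φ x * speedDensity b σ x)) x := fun x =>
    (hkφ.1.integral_hasStrictDerivAt a x).hasDerivAt
  have hBd : ∀ x, HasDerivAt B (g x * (ψ x * speedDensity b σ x)) x := fun x =>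
    (hkψ.1.integral_hasStrictDerivAt a x).hasDerivAt
  have hleft : ∀ w : ℝ → ℝ, ∀ x ≤ a, ∫ y in a..x, g y * w y = 0 := fun w x hx => by
    rw [intervalIntegral.integral_symm, neg_eq_zero]
    refine intervalIntegral.integral_zero_ae (Eventually.of_forall fun y hy => ?_)
    rw [uIoc_of_le hx] at hy
    rw [hg0 y fun hy' => absurd hy.2 (not_le.2 hy'.1), zero_mul]
  have hright : ∀ w : ℝ → ℝ, ∀ x, c ≤ x → ∫ y in a..x, g y * w y = ∫ y, g y * w y :=
    fun w x hx => by
      rw [intervalIntegral.integral_of_le (hac.le.trans hx)]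
      refine setIntegral_eq_integral_of_forall_compl_eq_zero fun y hy => ?_
      rw [hg0 y fun hy' => hy ⟨hy'.1, hy'.2.le.trans hx⟩, zero_mul]
  -- Variation of constants started at `a`. To the left of `a` both integrals vanish because `g`
  -- does; to the right of `c` they are the full integrals, which vanish by orthogonality.
  set f : ℝ → ℝ := fun x => (ψ x * A x - φ x * B x) / C with hf
  have hfl : ∀ x ≤ a, f x = 0 := fun x hx => by
    simp only [hf, hA, hB, hleft _ x hx]
    simp
  have hfr : ∀ x, c ≤ x → f x = 0 := fun x hx => by
    simp only [hf, hA, hB, hright _ x hx, hgφ, hgψ]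
    simp
  have hsupp : tsupport f ⊆ Icc a c := by
    refine closure_minimal (fun x hx => ?_) isClosed_Icc
    by_contra hcon
    rw [mem_Icc, not_and_or, not_le, not_le] at hcon
    rcases hcon with h1 | h1
    · exact hx (hfl x h1.le)
    · exact hx (hfr x h1.le)
  have hfd : ∀ x, 0 < x → HasDerivAt f (scaleDensity b σ x *
      ((flux b σ ψ x * A x - flux b σ φ x * B x) / C)) x := fun x hx =>
    ((((h.hasDerivAt_ψ hx).mul (hAd x)).sub ((h.hasDerivAt_φ hx).mul (hBd x))).div_const
      C).congr_deriv (by ring)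
  have hfd' : ∀ x, 0 < x → HasDerivAt (fun x => (flux b σ ψ x * A x - flux b σ φ x * B x) / C)
      (speedDensity b σ x * (r x * f x + g x)) x := fun x hx =>
    ((((h.hasDerivAt_flux_ψ hc hx).mul (hAd x)).sub
      ((h.hasDerivAt_flux_φ hc hx).mul (hBd x))).div_const C).congr_deriv (by
        have h1 := h.wronskian_const hc hx
        rw [← hCdef] at h1
        simp only [hf]
        field_simp
        rw [← h1]
        ring)
  obtain ⟨hf1, -, hf3⟩ := contDiffOn_of_hasDerivAt_flux hc r hfd hfd'
    ((hr.continuousOn.mul fun x hx => (hfd x hx).continuousAt.continuousWithinAt).add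
      hg.1.continuousOn)
  refine ⟨f, ?_, isCompact_Icc.of_isClosed_subset (isClosed_tsupport f) hsupp,
    fun x hx => ha.trans_le (hsupp hx).1, fun x hx => ?_, fun x hx => ?_⟩
  · rw [contDiff_iff_contDiffAt]
    intro x
    rcases lt_or_ge 0 x with hx | hx
    · exact hf1.contDiffAt (Ioi_mem_nhds hx)
    · refine contDiffAt_const (c := 0) |>.congr_of_eventuallyEq ?_
      filter_upwards [Iio_mem_nhds (hx.trans_lt ha)] with y hy using hfl y (le_of_lt hy)
  · rw [hf3 x hx]
    ring
  -- The minimum truncates the kernel: for `y ≥ x` it is `φ(x)ψ(x) - ψ(x)φ(x) = 0`, so integrating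
  -- over the whole line amounts to integrating up to `x`.
  · rcases le_or_gt x a with hxa | hxa
    · rw [hfl x hxa, eq_comm, neg_eq_zero]
      refine integral_eq_zero_of_ae (Eventually.of_forall fun y => ?_)
      rcases le_or_gt y a with hya | hya
      · simp [hg0 y fun hy' => absurd hya (not_le.2 hy'.1)]
      · simp [min_eq_right (hxa.trans hya.le), mul_comm]
    · have h1 : ∫ y, g y * ((φ x * ψ (min y x) - ψ x * φ (min y x)) * speedDensity b σ y / C) =
          ∫ y in a..x, (φ x / C * (g y * (ψ y * speedDensity b σ y)) -
            ψ x / C * (g y * (φ y * speedDensity b σ y))) := by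
        rw [intervalIntegral.integral_of_le hxa.le]
        rw [← setIntegral_eq_integral_of_forall_compl_eq_zero (s := Ioc a x)]
        · refine setIntegral_congr_fun measurableSet_Ioc fun y hy => ?_
          simp only [min_eq_left hy.2]
          ring
        · intro y hy
          rw [mem_Ioc, not_and_or, not_lt, not_le] at hy
          rcases hy with hy | hy
          · simp [hg0 y fun hy' => absurd hy (not_le.2 hy'.1)]
          · simp [min_eq_right hy.le, mul_comm]
      rw [h1, intervalIntegral.integral_sub
        ((hkψ.1.intervalIntegrable a x).const_mul _) ((hkφ.1.intervalIntegrable a x).const_mul _),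
        intervalIntegral.integral_const_mul, intervalIntegral.integral_const_mul]
      simp only [hf, hA, hB]
      ring

variable (hc : CoefficientsRegular b σ) (hr : DiscountRegular r)

include hc hr

/-- Integrate `(flux ψ)' = mrψ` from `0`; the boundary term at `0` vanishes because `0` is
inaccessible. -/
lemma integral_ψ_mul_discount (hzero : ZeroInaccessible b σ) {x : ℝ} (hx : 0 < x) :
    IntegrableOn (fun y => ψ y * r y * speedDensity b σ y) (Ioc 0 x) ∧
      ∫ y in (0 : ℝ)..x, ψ y * r y * speedDensity b σ y = flux b σ ψ x := by
  have hd : ∀ y, 0 < y → HasDerivAt (flux b σ ψ) (ψ y * r y * speedDensity b σ y) y :=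
    fun y hy => (h.hasDerivAt_flux_ψ hc hy).congr_deriv (by ring)
  have hpos : ∀ y, 0 < y → 0 ≤ ψ y * r y * speedDensity b σ y := fun y hy =>
    mul_nonneg (mul_nonneg (h.ψ_pos y hy).le (hr.pos_of_pos hy).le) (speedDensity_pos hc hy).le
  have hint : IntegrableOn (fun y => ψ y * r y * speedDensity b σ y) (Ioc 0 x) := by
    -- The value of the flux at `0` is arbitrary, so it is reset to the limit `0` to obtain
    -- continuity on the closed interval.
    refine intervalIntegral.integrableOn_deriv_of_nonneg
      (g := Function.update (flux b σ ψ) 0 0) ?_ (fun y hy => ?_) fun y hy => hpos y hy.1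
    · intro y hy
      rcases hy.1.eq_or_lt with rfl | hy0
      · rw [continuousWithinAt_update_same]
        exact (h.tendsto_flux_ψ_zero hc hr hzero).mono_left
          (nhdsWithin_mono _ fun z hz => lt_of_le_of_ne hz.1.1 (Ne.symm hz.2))
      · exact (continuousAt_update_of_ne hy0.ne').2 (hd y hy0).continuousAt |>.continuousWithinAt
    · refine (hd y hy.1).congr_of_eventuallyEq ?_
      filter_upwards [Ioi_mem_nhds hy.1] with z hz using Function.update_of_ne (ne_of_gt hz) _ _
  refine ⟨hint, ?_⟩
  have := intervalIntegral.integral_eq_sub_of_hasDerivAt_of_tendsto hx (fun y hy => hd y hy.1)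
    ((intervalIntegrable_iff_integrableOn_Ioc_of_le hx.le).2 hint)
    (h.tendsto_flux_ψ_zero hc hr hzero) (hd x hx).continuousAt.continuousWithinAt
  rw [this, sub_zero]

lemma integral_φ_mul_discount (hinfty : InftyNatural b σ) {x : ℝ} (hx : 0 < x) :
    IntegrableOn (fun y => φ y * r y * speedDensity b σ y) (Ioi x) ∧
      ∫ y in Ioi x, φ y * r y * speedDensity b σ y = -flux b σ φ x := by
  have hd : ∀ y ∈ Ici x, HasDerivAt (flux b σ φ) (φ y * r y * speedDensity b σ y) y :=
    fun y hy => (h.hasDerivAt_flux_φ hc (hx.trans_le hy)).congr_deriv (by ring)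
  have hpos : ∀ y ∈ Ioi x, 0 ≤ φ y * r y * speedDensity b σ y := fun y hy =>
    have hy0 := hx.trans hy
    mul_nonneg (mul_nonneg (h.φ_pos y hy0).le (hr.pos_of_pos hy0).le) (speedDensity_pos hc hy0).le
  have hlim := h.tendsto_flux_φ_atTop hc hr hinfty
  refine ⟨integrableOn_Ioi_deriv_of_nonneg' hd hpos hlim, ?_⟩
  rw [integral_Ioi_of_hasDerivAt_of_nonneg' hd hpos hlim, zero_sub]

/-- Splitting at the diagonal, the two halves add up to the Wronskian divided by itself. This
matches the normalisation of the occupation measure. -/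
lemma lintegral_greenDensity (hzero : ZeroInaccessible b σ) (hinfty : InftyNatural b σ) {x : ℝ}
    (hx : 0 < x) :
    ∫⁻ y in Ioi (0 : ℝ), ENNReal.ofReal (r y * greenDensity b σ φ ψ x y) = 1 := by
  obtain ⟨h1, h2⟩ := h.integral_ψ_mul_discount hc hr hzero hx
  obtain ⟨h3, h4⟩ := h.integral_φ_mul_discount hc hr hinfty hx
  have hint := (h.integrableOn_greenDensity_iff hx).2 ⟨h1, h3⟩
  rw [← ofReal_integral_eq_lintegral_ofReal hint, integral_greenDensity hx hint, h2, h4,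
    mul_neg, ← sub_eq_add_neg, h.wronskian_const hc hx, div_self (h.wronskian_pos one_pos).ne',
    ENNReal.ofReal_one]
  filter_upwards [ae_restrict_mem measurableSet_Ioi] with y hy
  exact mul_nonneg (hr.pos_of_pos hy).le (h.greenDensity_pos hc hx hy).le

end IsFundamentalPair

end Green

/-! ### The Green representation of the resolvent -/

/-- The functional `g ↦ ∫ g w` on the space of test functions. -/
noncomputable def testIntegral {w : ℝ → ℝ} (hw : ContinuousOn w (Ioi 0)) :
    testFunctions →ₗ[ℝ] ℝ where
  toFun g := ∫ y, (g : ℝ → ℝ) y * w y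
  map_add' g g' := by
    rw [← integral_add (integrable_of_mem_testFunctions (mul_mem_testFunctions g.2 hw) _)
      (integrable_of_mem_testFunctions (mul_mem_testFunctions g'.2 hw) _)]
    simp only [Submodule.coe_add, Pi.add_apply, add_mul]
  map_smul' a g := by
    simp only [Submodule.coe_smul, Pi.smul_apply, smul_eq_mul, mul_assoc, integral_const_mul,
      RingHom.id_apply]

/-- The functional `g ↦ ∫ g dμ` on the space of test functions. -/
noncomputable def testMeasure (μ : Measure ℝ) [IsFiniteMeasureOnCompacts μ] :
    testFunctions →ₗ[ℝ] ℝ where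
  toFun g := ∫ y, (g : ℝ → ℝ) y ∂μ
  map_add' g g' := by
    rw [← integral_add (integrable_of_mem_testFunctions g.2 _)
      (integrable_of_mem_testFunctions g'.2 _)]
    simp only [Submodule.coe_add, Pi.add_apply]
  map_smul' a g := by
    simp only [Submodule.coe_smul, Pi.smul_apply, smul_eq_mul, integral_const_mul,
      RingHom.id_apply]

/-- `R` is the integral of `f` against the Green kernel. -/
structure IsGreenPotential (b σ φ ψ f R : ℝ → ℝ) : Prop where
  integrableOn : ∀ x, 0 < x → IntegrableOn (fun y => f y * greenDensity b σ φ ψ x y) (Ioi 0)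
  eq_integral : ∀ x, 0 < x → R x = ∫ y in Ioi (0 : ℝ), f y * greenDensity b σ φ ψ x y

section Representation

variable {Ω : Type*} {mΩ : MeasurableSpace Ω} {P : Measure Ω} [IsProbabilityMeasure P]
  {ℱ : Filtration ℝ≥0 mΩ} {b σ r φ ψ : ℝ → ℝ}

/-- On test functions, the occupation measure is the Green kernel up to solutions of the
homogeneous equation. -/
lemma IsDiffusion.exists_integral_occupation_eq {x : ℝ} {X : ℝ≥0 → Ω → ℝ}
    (hX : IsDiffusion b σ ℱ P x X) (hc : CoefficientsRegular b σ) (hr : DiscountRegular r)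
    (h : IsFundamentalPair b σ r φ ψ) (hx : 0 < x) :
    ∃ α β : ℝ, ∀ g ∈ testFunctions, ∫ y, g y ∂(occupation r P X) =
      ∫ y, g y * (greenDensity b σ φ ψ x y + (α * φ y + β * ψ y) * speedDensity b σ y) := by
  have := hX.isFiniteMeasure_occupation hr
  set C := wronskian b σ φ ψ 1 with hC
  have hC0 : 0 < C := h.wronskian_pos one_pos
  have hm := continuousOn_speedDensity hc
  have hwφ : ContinuousOn (fun y => φ y * speedDensity b σ y) (Ioi 0) := h.continuousOn_φ.mul hm
  have hwψ : ContinuousOn (fun y => ψ y * speedDensity b σ y) (Ioi 0) := h.continuousOn_ψ.mul hm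
  have hw0 : ContinuousOn (fun y => (φ x * ψ (min y x) - ψ x * φ (min y x)) *
      speedDensity b σ y / C) (Ioi 0) := by
    have hmin : ContinuousOn (fun y => min y x) (Ioi 0) := by fun_prop
    have hmaps : MapsTo (fun y => min y x) (Ioi 0) (Ioi 0) := fun y hy => lt_min hy hx
    exact ((((h.continuousOn_ψ.comp hmin hmaps).const_mul _).sub
      ((h.continuousOn_φ.comp hmin hmaps).const_mul _)).mul hm).div_const C
  let L : Fin 2 → testFunctions →ₗ[ℝ] ℝ := ![testIntegral hwφ, testIntegral hwψ]
  have hspan : testMeasure (occupation r P X) - testIntegral hw0 ∈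
      Submodule.span ℝ (range L) := by
    -- A linear functional vanishing on the common kernel of finitely many others is a combination
    -- of them. For `g` in that kernel, `exists_opL_eq` writes `g = ℒf` with `f` compactly
    -- supported, and both functionals give `-f(x)`.
    refine mem_span_of_iInf_ker_le_ker fun g hg => ?_
    simp only [Submodule.mem_iInf, Fin.forall_fin_two, LinearMap.mem_ker] at hg
    obtain ⟨f, hf1, hf2, hf3, hf4, hf5⟩ := h.exists_opL_eq hc hr g.2 hg.1 hg.2
    have h1 := hX.integral_opL_occupation hc hr hf1 hf2 hf3
    rw [hf5 x hx, neg_neg] at h1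
    rw [LinearMap.mem_ker, LinearMap.sub_apply, sub_eq_zero]
    refine Eq.trans ?_ h1
    refine integral_congr_ae ?_
    filter_upwards [hX.ae_occupation_pos hr] with y hy using (hf4 y hy).symm
  obtain ⟨a, ha⟩ := (Submodule.mem_span_range_iff_exists_fun ℝ).1 hspan
  -- The Green density exceeds the truncated kernel by `ψ(x)φ(y)m(y)/C` on both sides of the
  -- diagonal, whence the shift in the coefficient of `φ`.
  refine ⟨a 0 - ψ x / C, a 1, fun g hg => ?_⟩
  have h2 := LinearMap.congr_fun ha ⟨g, hg⟩
  simp only [Fin.sum_univ_two, LinearMap.add_apply, LinearMap.smul_apply, LinearMap.sub_apply,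
    smul_eq_mul] at h2
  change a 0 * (∫ y, g y * (φ y * speedDensity b σ y)) +
    a 1 * (∫ y, g y * (ψ y * speedDensity b σ y)) = (∫ y, g y ∂(occupation r P X)) -
      ∫ y, g y * ((φ x * ψ (min y x) - ψ x * φ (min y x)) * speedDensity b σ y / C) at h2
  rw [eq_sub_iff_add_eq] at h2
  have hi : ∀ {w : ℝ → ℝ}, ContinuousOn w (Ioi 0) → Integrable (fun y => g y * w y) := fun hw =>
    integrable_of_mem_testFunctions (mul_mem_testFunctions hg hw) volume
  rw [← h2, ← integral_const_mul, ← integral_const_mul, ← integral_add ((hi hwφ).const_mul _)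
    ((hi hwψ).const_mul _), ← integral_add _ (hi hw0)]
  · refine integral_congr_ae (Eventually.of_forall fun y => ?_)
    rcases le_total y x with hy | hy
    · simp only [greenDensity_of_le hy, min_eq_left hy, ← hC]
      ring
    · simp only [greenDensity_of_ge hy, min_eq_right hy, ← hC]
      ring
  · exact ((hi hwφ).const_mul _).add ((hi hwψ).const_mul _)

/-- Near `0` the term `αφ` dominates, since `φ → ∞` while `ψ` stays bounded; near `∞` the roles are
exchanged. Nonnegativity of the density therefore fixes both signs. -/
lemma IsFundamentalPair.coeff_nonneg (h : IsFundamentalPair b σ r φ ψ)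
    (hc : CoefficientsRegular b σ) {x α β : ℝ} (hx : 0 < x)
    (hw : ∀ y, 0 < y → 0 ≤ greenDensity b σ φ ψ x y +
      (α * φ y + β * ψ y) * speedDensity b σ y) : 0 ≤ α ∧ 0 ≤ β := by
  have hC0 : 0 < wronskian b σ φ ψ 1 := h.wronskian_pos one_pos
  constructor
  · by_contra! hα
    have h1 : Tendsto (fun y => α * φ y) (𝓝[>] 0) atBot :=
      h.φ_zero.const_mul_atTop_of_neg hα
    obtain ⟨y, hy1, hy2⟩ := ((h1.eventually_lt_atBot
      (-((φ x / wronskian b σ φ ψ 1 + |β|) * ψ x))).and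
      (Ioo_mem_nhdsGT hx)).exists
    have h2 := hw y hy2.1
    rw [greenDensity_of_le hy2.2.le] at h2
    have hm := speedDensity_pos hc hy2.1
    have h3 : 0 ≤ (φ x / wronskian b σ φ ψ 1 + β) * ψ y + α * φ y := by
      refine nonneg_of_mul_nonneg_left (b := speedDensity b σ y) ?_ hm
      linarith
    have h4 : ψ y ≤ ψ x := (h.strictMonoOn_ψ.monotoneOn hy2.1 hx hy2.2.le)
    have h5 : (φ x / wronskian b σ φ ψ 1 + β) * ψ y ≤
        (φ x / wronskian b σ φ ψ 1 + |β|) * ψ x := by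
      have := (div_pos (h.φ_pos x hx) hC0).le
      have := (h.ψ_pos y hy2.1).le
      gcongr
      exact le_abs_self β
    linarith
  · by_contra! hβ
    have h1 : Tendsto (fun y => β * ψ y) atTop atBot :=
      h.ψ_infty.const_mul_atTop_of_neg hβ
    obtain ⟨y, hy1, hy2⟩ := ((h1.eventually_lt_atBot
      (-((ψ x / wronskian b σ φ ψ 1 + |α|) * φ x))).and
      (eventually_gt_atTop x)).exists
    have hy0 : 0 < y := hx.trans hy2
    have h2 := hw y hy0
    rw [greenDensity_of_ge hy2.le] at h2
    have hm := speedDensity_pos hc hy0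
    have h3 : 0 ≤ (ψ x / wronskian b σ φ ψ 1 + α) * φ y + β * ψ y := by
      refine nonneg_of_mul_nonneg_left (b := speedDensity b σ y) ?_ hm
      linarith
    have h4 : φ y ≤ φ x := (h.strictAntiOn_φ.antitoneOn hx hy0 hy2.le)
    have h5 : (ψ x / wronskian b σ φ ψ 1 + α) * φ y ≤
        (ψ x / wronskian b σ φ ψ 1 + |α|) * φ x := by
      have := (div_pos (h.ψ_pos x hx) hC0).le
      have := (h.φ_pos y hy0).le
      gcongr
      exact le_abs_self α
    linarith

/-- Both the occupation measure and the Green kernel give `r` total integral `1`. The surplus `(αφ +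
βψ)m` is nonnegative and has `r`-integral zero, so `α = β = 0`. -/
lemma IsDiffusion.integral_occupation_testFunction {x : ℝ} {X : ℝ≥0 → Ω → ℝ}
    (hX : IsDiffusion b σ ℱ P x X) (hc : CoefficientsRegular b σ) (hr : DiscountRegular r)
    (h : IsFundamentalPair b σ r φ ψ) (hzero : ZeroInaccessible b σ) (hinfty : InftyNatural b σ)
    (hx : 0 < x) {g : ℝ → ℝ} (hg : g ∈ testFunctions) :
    ∫ y, g y ∂(occupation r P X) = ∫ y, g y * greenDensity b σ φ ψ x y := by
  have := hX.isFiniteMeasure_occupation hr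
  obtain ⟨α, β, hαβ⟩ := hX.exists_integral_occupation_eq hc hr h hx
  have hm := continuousOn_speedDensity hc
  have hG := h.continuousOn_greenDensity hc hx
  have hE : ContinuousOn (fun y => (α * φ y + β * ψ y) * speedDensity b σ y) (Ioi 0) :=
    ((h.continuousOn_φ.const_mul _).add (h.continuousOn_ψ.const_mul _)).mul hm
  have hw : ContinuousOn (fun y => greenDensity b σ φ ψ x y +
    (α * φ y + β * ψ y) * speedDensity b σ y) (Ioi 0) := hG.add hE
  obtain ⟨hα, hβ⟩ := h.coeff_nonneg hc hx fun y hy => nonneg_of_integral_testFunctions hw hαβ hy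
  have hE0 : ∀ y, 0 < y → 0 ≤ (α * φ y + β * ψ y) * speedDensity b σ y := fun y hy =>
    mul_nonneg (add_nonneg (mul_nonneg hα (h.φ_pos y hy).le) (mul_nonneg hβ (h.ψ_pos y hy).le))
      (speedDensity_pos hc hy).le
  have h1 := lintegral_eq_of_integral_testFunctions (hX.ae_occupation_pos hr) hw hαβ
    hr.continuousOn fun y hy => (hr.pos_of_pos hy).le
  rw [hX.lintegral_discountRate_occupation hr] at h1
  have hmeas : ∀ {f : ℝ → ℝ}, ContinuousOn f (Ioi 0) → AEMeasurable (fun y => ENNReal.ofReal (f y))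
      (volume.restrict (Ioi (0 : ℝ))) := fun hf =>
    (hf.aemeasurable measurableSet_Ioi).ennreal_ofReal
  have h2 : ∫⁻ y in Ioi (0 : ℝ), ENNReal.ofReal (r y * (greenDensity b σ φ ψ x y +
      (α * φ y + β * ψ y) * speedDensity b σ y)) =
      (∫⁻ y in Ioi (0 : ℝ), ENNReal.ofReal (r y * greenDensity b σ φ ψ x y)) +
      ∫⁻ y in Ioi (0 : ℝ), ENNReal.ofReal (r y * ((α * φ y + β * ψ y) * speedDensity b σ y)) := by
    rw [← lintegral_add_left' (hmeas (f := fun y => r y * greenDensity b σ φ ψ x y)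
      (hr.continuousOn.mul hG))]
    refine setLIntegral_congr_fun measurableSet_Ioi fun y hy => ?_
    rw [mul_add, ENNReal.ofReal_add (mul_nonneg (hr.pos_of_pos hy).le
      (h.greenDensity_pos hc hx hy).le) (mul_nonneg (hr.pos_of_pos hy).le (hE0 y hy))]
  rw [h2, h.lintegral_greenDensity hc hr hzero hinfty hx, eq_comm] at h1
  have h3 : ∫⁻ y in Ioi (0 : ℝ), ENNReal.ofReal (r y * ((α * φ y + β * ψ y) *
      speedDensity b σ y)) = 0 := by
    have : (1 : ℝ≥0∞) + _ = 1 + 0 := h1.trans (add_zero 1).symm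
    exact (ENNReal.add_right_inj ENNReal.one_ne_top).1 this
  rw [lintegral_eq_zero_iff' (hmeas (f := fun y => r y * ((α * φ y + β * ψ y) *
    speedDensity b σ y)) (hr.continuousOn.mul hE))] at h3
  have hne : (ae (volume.restrict (Ioi (0 : ℝ)))).NeBot := by
    rw [ae_neBot, Ne, Measure.restrict_eq_zero]
    simp
  obtain ⟨y, hy1, hy2⟩ := (h3.and (ae_restrict_mem measurableSet_Ioi)).exists
  have hy0 : 0 < y := hy2
  have hy3 : r y * ((α * φ y + β * ψ y) * speedDensity b σ y) ≤ 0 := by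
    simpa using hy1
  have hy4 : α * φ y + β * ψ y ≤ 0 := by
    by_contra! hcon
    exact absurd (mul_pos (hr.pos_of_pos hy0) (mul_pos hcon (speedDensity_pos hc hy0)))
      (not_lt.2 hy3)
  have hα' := mul_nonneg hα (h.φ_pos y hy0).le
  have hβ' := mul_nonneg hβ (h.ψ_pos y hy0).le
  have hα0 : α = 0 := (mul_eq_zero.1 (by linarith : α * φ y = 0)).resolve_right (h.φ_pos y hy0).ne'
  have hβ0 : β = 0 := (mul_eq_zero.1 (by linarith : β * ψ y = 0)).resolve_right (h.ψ_pos y hy0).ne'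
  rw [hαβ g hg]
  simp [hα0, hβ0]

/-- The resolvent is the integral operator with the Green kernel. -/
theorem isGreenPotential_resolvent {X : ℝ → ℝ≥0 → Ω → ℝ}
    (hX : ∀ x, 0 < x → IsDiffusion b σ ℱ P x (X x)) (hc : CoefficientsRegular b σ)
    (hr : DiscountRegular r) (h : IsFundamentalPair b σ r φ ψ) (hzero : ZeroInaccessible b σ)
    (hinfty : InftyNatural b σ) {f : ℝ → ℝ} (hf : ContinuousOn f (Ioi 0))
    (hfi : DiscountedIntegrable r P X f) :
    IsGreenPotential b σ φ ψ f (resolvent r P X f) := by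
  have main : ∀ x, 0 < x → IntegrableOn (fun y => f y * greenDensity b σ φ ψ x y) (Ioi 0) ∧
      resolvent r P X f x = ∫ y in Ioi (0 : ℝ), f y * greenDensity b σ φ ψ x y := by
    intro x hx
    have hXx := hX x hx
    have := hXx.isFiniteMeasure_occupation hr
    have hG := h.continuousOn_greenDensity hc hx
    have hG0 : ∀ y, 0 < y → 0 ≤ greenDensity b σ φ ψ x y := fun y hy =>
      (h.greenDensity_pos hc hx hy).le
    -- Allowing signed `u` here, by passing to its positive part, lets the same identity treat
    -- `|f|`, `f` and `-f` below.
    have key : ∀ {u : ℝ → ℝ}, ContinuousOn u (Ioi 0) →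
        ∫⁻ y, ENNReal.ofReal (u y) ∂(occupation r P (X x)) =
        ∫⁻ y in Ioi (0 : ℝ), ENNReal.ofReal (u y * greenDensity b σ φ ψ x y) := fun {u} hu => by
      have h1 := lintegral_eq_of_integral_testFunctions (hXx.ae_occupation_pos hr) hG
        (fun g hg => hXx.integral_occupation_testFunction hc hr h hzero hinfty hx hg)
        (f := fun y => max (u y) 0) (fun y hy => (hu y hy).max continuousWithinAt_const)
        fun y _ => le_max_right _ _
      simp only [ENNReal.ofReal_max, ENNReal.ofReal_zero, max_eq_left zero_le] at h1
      rw [h1]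
      refine setLIntegral_congr_fun measurableSet_Ioi fun y hy => ?_
      rcases le_total (u y) 0 with hu0 | hu0
      · simp only [max_eq_right hu0, zero_mul]
        rw [ENNReal.ofReal_zero, ENNReal.ofReal_of_nonpos
          (mul_nonpos_of_nonpos_of_nonneg hu0 (hG0 y hy))]
      · simp only [max_eq_left hu0]
    have hint := hXx.integrable_occupation hr hf (hfi x hx)
    have hint' : IntegrableOn (fun y => f y * greenDensity b σ φ ψ x y) (Ioi 0) := by
      refine ⟨(hf.mul hG).aestronglyMeasurable measurableSet_Ioi, ?_⟩
      have h2 := hint.abs.lintegral_lt_top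
      rw [key hf.abs] at h2
      rw [hasFiniteIntegral_iff_norm]
      refine lt_of_eq_of_lt (setLIntegral_congr_fun measurableSet_Ioi fun y hy => ?_) h2
      simp only [norm_mul, Real.norm_eq_abs, abs_of_nonneg (hG0 y hy)]
    refine ⟨hint', ?_⟩
    rw [resolvent, ← hXx.integral_occupation hr hf hint,
      integral_eq_lintegral_pos_part_sub_lintegral_neg_part hint,
      integral_eq_lintegral_pos_part_sub_lintegral_neg_part hint', key hf, key (u := fun y => -f y) hf.neg]
    simp only [neg_mul]
  exact ⟨fun x hx => (main x hx).1, fun x hx => (main x hx).2⟩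

end Representation

/-! ### Green potentials -/

section Potential

variable {b σ r φ ψ f f₁ f₂ R R₁ R₂ : ℝ → ℝ}

namespace IsGreenPotential

lemma add_eq (h₁ : IsGreenPotential b σ φ ψ f₁ R₁) (h₂ : IsGreenPotential b σ φ ψ f₂ R₂)
    (hR : IsGreenPotential b σ φ ψ f R) (hf : ∀ x, 0 < x → f x = f₁ x + f₂ x) {x : ℝ}
    (hx : 0 < x) : R x = R₁ x + R₂ x := by
  rw [hR.eq_integral x hx, h₁.eq_integral x hx, h₂.eq_integral x hx,
    ← integral_add (h₁.integrableOn x hx) (h₂.integrableOn x hx)]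
  refine setIntegral_congr_fun measurableSet_Ioi fun y hy => ?_
  simp only [hf y hy, add_mul]

variable (hR : IsGreenPotential b σ φ ψ f R) (h : IsFundamentalPair b σ r φ ψ)
  (hc : CoefficientsRegular b σ) (hf : ContinuousOn f (Ioi 0))

include hR h

lemma intervalIntegrable_ψ {x : ℝ} (hx : 0 < x) :
    IntervalIntegrable (fun y => ψ y * f y * speedDensity b σ y) volume 0 x :=
  (intervalIntegrable_iff_integrableOn_Ioc_of_le hx.le).2
    ((h.integrableOn_greenDensity_iff hx).1 (hR.integrableOn x hx)).1

lemma integrableOn_φ {x : ℝ} (hx : 0 < x) :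
    IntegrableOn (fun y => φ y * f y * speedDensity b σ y) (Ioi x) :=
  ((h.integrableOn_greenDensity_iff hx).1 (hR.integrableOn x hx)).2

omit h in
lemma eq_split {x : ℝ} (hx : 0 < x) :
    R x = (φ x * (∫ y in (0 : ℝ)..x, ψ y * f y * speedDensity b σ y) +
      ψ x * ∫ y in Ioi x, φ y * f y * speedDensity b σ y) / wronskian b σ φ ψ 1 := by
  rw [hR.eq_integral x hx, integral_greenDensity hx (hR.integrableOn x hx)]

include hc hf

lemma hasDerivAt_left {x : ℝ} (hx : 0 < x) :
    HasDerivAt (fun x => ∫ y in (0 : ℝ)..x, ψ y * f y * speedDensity b σ y)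
      (ψ x * f x * speedDensity b σ x) x :=
  hasDerivAt_integral_of_continuousOn_Ioi
    ((h.continuousOn_ψ.mul hf).mul (continuousOn_speedDensity hc)) hx
    (hR.intervalIntegrable_ψ h hx)

lemma hasDerivAt_right {x : ℝ} (hx : 0 < x) :
    HasDerivAt (fun x => ∫ y in Ioi x, φ y * f y * speedDensity b σ y)
      (-(φ x * f x * speedDensity b σ x)) x := by
  have hcont := (h.continuousOn_φ.mul hf).mul (continuousOn_speedDensity hc)
  have h1 := (hasDerivAt_integral_of_continuousOn_Ioi hcont hx
    (IntervalIntegrable.of_continuousOn_Ioi hcont one_pos hx)).const_sub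
      (∫ y in Ioi (1 : ℝ), φ y * f y * speedDensity b σ y)
  refine h1.congr_of_eventuallyEq ?_
  filter_upwards [Ioi_mem_nhds hx] with z hz
  have := intervalIntegral.integral_Ioi_sub_Ioi' (hR.integrableOn_φ h one_pos)
    (hR.integrableOn_φ h hz)
  simp only [Pi.mul_apply]
  rw [← this]
  ring

/-- Differentiating the split form, the derivatives of the two integrals cancel in `R'`; in the
derivative of the flux they combine to the Wronskian times `-f m`. -/
lemma regularity (hr : ContinuousOn r (Ioi 0)) :
    ContDiffOn ℝ 2 R (Ioi 0) ∧
    (∀ x, 0 < x → flux b σ R x =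
      (flux b σ φ x * (∫ y in (0 : ℝ)..x, ψ y * f y * speedDensity b σ y) +
      flux b σ ψ x * ∫ y in Ioi x, φ y * f y * speedDensity b σ y) / wronskian b σ φ ψ 1) ∧
    ∀ x, 0 < x → opL b σ r R x = -f x := by
  have hC := (h.wronskian_pos one_pos).ne'
  set I : ℝ → ℝ := fun x => ∫ y in (0 : ℝ)..x, ψ y * f y * speedDensity b σ y with hI
  set J : ℝ → ℝ := fun x => ∫ y in Ioi x, φ y * f y * speedDensity b σ y with hJ
  have hId : ∀ x, 0 < x → HasDerivAt I (ψ x * f x * speedDensity b σ x) x := fun x hx =>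
    hR.hasDerivAt_left h hc hf hx
  have hJd : ∀ x, 0 < x → HasDerivAt J (-(φ x * f x * speedDensity b σ x)) x := fun x hx =>
    hR.hasDerivAt_right h hc hf hx
  have hRe : ∀ x, 0 < x → R x = (φ x * I x + ψ x * J x) / wronskian b σ φ ψ 1 := fun x hx =>
    hR.eq_split hx
  have h1 : ∀ x, 0 < x → HasDerivAt R (scaleDensity b σ x *
      ((flux b σ φ x * I x + flux b σ ψ x * J x) / wronskian b σ φ ψ 1)) x := fun x hx => by
    have := (((h.hasDerivAt_φ hx).mul (hId x hx)).add
      ((h.hasDerivAt_ψ hx).mul (hJd x hx))).div_const (wronskian b σ φ ψ 1)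
    refine (this.congr_deriv (by ring)).congr_of_eventuallyEq ?_
    filter_upwards [Ioi_mem_nhds hx] with z hz using hRe z hz
  have h2 : ∀ x, 0 < x → HasDerivAt (fun x => (flux b σ φ x * I x + flux b σ ψ x * J x) /
      wronskian b σ φ ψ 1) (speedDensity b σ x * (r x * R x - f x)) x := fun x hx => by
    have := (((h.hasDerivAt_flux_φ hc hx).mul (hId x hx)).add
      ((h.hasDerivAt_flux_ψ hc hx).mul (hJd x hx))).div_const (wronskian b σ φ ψ 1)
    refine this.congr_deriv ?_
    rw [hRe x hx]
    have hW := h.wronskian_const hc hx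
    field_simp
    rw [← hW]
    ring
  obtain ⟨h3, h4, h5⟩ := contDiffOn_of_hasDerivAt_flux hc r h1 h2
    ((hr.mul fun x hx => (h1 x hx).continuousAt.continuousWithinAt).sub hf)
  refine ⟨h3, h4, fun x hx => ?_⟩
  rw [h5 x hx]
  ring

omit hf in
-- Dominated convergence: the Green density divided by `ψ(x)` is at most its value at `x = 1` when
-- `x ≥ 1`, and it tends to `0` pointwise because `ψ → ∞`.
lemma tendsto_div_ψ : Tendsto (fun x => R x / ψ x) atTop (𝓝 0) := by
  have hC := h.wronskian_pos one_pos
  have hlim : Tendsto (fun x => ∫ y in Ioi (0 : ℝ), f y * greenDensity b σ φ ψ x y / ψ x) atTop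
      (𝓝 (∫ _y in Ioi (0 : ℝ), (0 : ℝ))) := by
    refine tendsto_integral_filter_of_dominated_convergence
      (fun y => ‖f y * greenDensity b σ φ ψ 1 y‖ / ψ 1) ?_ ?_
      ((hR.integrableOn 1 one_pos).norm.div_const _) ?_
    · filter_upwards [eventually_gt_atTop 0] with x hx
      exact (Integrable.div_const (hR.integrableOn x hx) _).aestronglyMeasurable
    · filter_upwards [eventually_ge_atTop 1] with x hx
      have hx0 : 0 < x := one_pos.trans_le hx
      filter_upwards [ae_restrict_mem measurableSet_Ioi] with y hy
      rw [norm_div, norm_mul, norm_mul, Real.norm_of_nonneg (h.ψ_pos x hx0).le, mul_div_assoc,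
        mul_div_assoc, Real.norm_of_nonneg (h.greenDensity_pos hc hx0 hy).le,
        Real.norm_of_nonneg (h.greenDensity_pos hc one_pos hy).le]
      refine mul_le_mul_of_nonneg_left ?_ (norm_nonneg _)
      have hy0 : 0 < y := hy
      have hm := (speedDensity_pos hc hy0).le
      have hψx := h.ψ_pos x hx0
      have hψ1 := h.ψ_pos 1 one_pos
      have hψ1x := h.strictMonoOn_ψ.monotoneOn (mem_Ioi.2 one_pos) hx0 hx
      rw [div_le_div_iff₀ hψx hψ1]
      simp only [greenDensity]
      rw [div_mul_eq_mul_div, div_mul_eq_mul_div]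
      refine div_le_div_of_nonneg_right ?_ hC.le
      suffices hs : ψ (min y x) * φ (max y x) * ψ 1 ≤ ψ (min y 1) * φ (max y 1) * ψ x by
        have := mul_le_mul_of_nonneg_right hs hm
        linarith
      rcases le_total y 1 with hy1 | hy1
      · rw [min_eq_left (hy1.trans hx), max_eq_right (hy1.trans hx), min_eq_left hy1,
          max_eq_right hy1]
        have := h.strictAntiOn_φ.antitoneOn (mem_Ioi.2 one_pos) hx0 hx
        have := (h.φ_pos x hx0).le
        have := (h.ψ_pos y hy0).le
        have := (h.φ_pos 1 one_pos).le
        gcongr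
      · rw [min_eq_right hy1, max_eq_left hy1]
        have h1 : φ (max y x) ≤ φ y := h.strictAntiOn_φ.antitoneOn hy0
          (lt_max_of_lt_left hy0) (le_max_left _ _)
        have h2 : ψ (min y x) ≤ ψ x := h.strictMonoOn_ψ.monotoneOn
          (lt_min hy0 hx0) hx0 (min_le_right _ _)
        have h3 := (h.φ_pos (max y x) (lt_max_of_lt_left hy0)).le
        calc ψ (min y x) * φ (max y x) * ψ 1 ≤ ψ x * φ y * ψ 1 := by gcongr
          _ = _ := by ring
    · filter_upwards [ae_restrict_mem measurableSet_Ioi] with y hy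
      have hy0 : 0 < y := hy
      have h1 : Tendsto (fun x => f y * (φ y / wronskian b σ φ ψ 1 *
          (ψ y * speedDensity b σ y)) / ψ x) atTop (𝓝 0) := tendsto_const_nhds.div_atTop h.ψ_infty
      refine squeeze_zero_norm' ?_ (by simpa only [norm_zero] using h1.norm)
      filter_upwards [eventually_ge_atTop y] with x hyx
      have hx0 := hy0.trans_le hyx
      rw [greenDensity_of_le hyx, norm_div, norm_div, norm_mul (f y), norm_mul (f y)]
      gcongr _ * ?_ / _
      have := mul_pos (h.ψ_pos y hy0) (speedDensity_pos hc hy0)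
      rw [Real.norm_of_nonneg (mul_pos (div_pos (h.φ_pos x hx0) hC) this).le,
        Real.norm_of_nonneg (mul_pos (div_pos (h.φ_pos y hy0) hC) this).le]
      gcongr
      exact h.strictAntiOn_φ.antitoneOn hy0 hx0 hyx
  rw [integral_zero] at hlim
  refine hlim.congr' ?_
  filter_upwards [eventually_gt_atTop 0] with x hx
  rw [hR.eq_integral x hx, integral_div]

omit hf in
lemma tendsto_div_φ : Tendsto (fun x => R x / φ x) (𝓝[>] 0) (𝓝 0) := by
  have hC := h.wronskian_pos one_pos
  have hlim : Tendsto (fun x => ∫ y in Ioi (0 : ℝ), f y * greenDensity b σ φ ψ x y / φ x) (𝓝[>] 0)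
      (𝓝 (∫ _y in Ioi (0 : ℝ), (0 : ℝ))) := by
    refine tendsto_integral_filter_of_dominated_convergence
      (fun y => ‖f y * greenDensity b σ φ ψ 1 y‖ / φ 1) ?_ ?_
      ((hR.integrableOn 1 one_pos).norm.div_const _) ?_
    · filter_upwards [self_mem_nhdsWithin] with x hx
      exact (Integrable.div_const (hR.integrableOn x hx) _).aestronglyMeasurable
    · filter_upwards [Ioo_mem_nhdsGT (one_pos (α := ℝ))] with x hx
      have hx0 : 0 < x := hx.1
      filter_upwards [ae_restrict_mem measurableSet_Ioi] with y hy
      rw [norm_div, norm_mul, norm_mul, Real.norm_of_nonneg (h.φ_pos x hx0).le, mul_div_assoc,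
        mul_div_assoc, Real.norm_of_nonneg (h.greenDensity_pos hc hx0 hy).le,
        Real.norm_of_nonneg (h.greenDensity_pos hc one_pos hy).le]
      refine mul_le_mul_of_nonneg_left ?_ (norm_nonneg _)
      have hy0 : 0 < y := hy
      have hm := (speedDensity_pos hc hy0).le
      have hφx := h.φ_pos x hx0
      have hφ1 := h.φ_pos 1 one_pos
      rw [div_le_div_iff₀ hφx hφ1]
      simp only [greenDensity]
      rw [div_mul_eq_mul_div, div_mul_eq_mul_div]
      refine div_le_div_of_nonneg_right ?_ hC.le
      suffices hs : ψ (min y x) * φ (max y x) * φ 1 ≤ ψ (min y 1) * φ (max y 1) * φ x by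
        have := mul_le_mul_of_nonneg_right hs hm
        linarith
      rcases le_total 1 y with hy1 | hy1
      · rw [min_eq_right (hx.2.le.trans hy1), max_eq_left (hx.2.le.trans hy1), min_eq_right hy1,
          max_eq_left hy1]
        have := h.strictMonoOn_ψ.monotoneOn hx0 (mem_Ioi.2 one_pos) hx.2.le
        have := h.strictAntiOn_φ.antitoneOn hx0 (mem_Ioi.2 one_pos) hx.2.le
        have := (h.φ_pos y hy0).le
        have := (h.ψ_pos 1 one_pos).le
        gcongr
      · rw [min_eq_left hy1, max_eq_right hy1]
        have h1 : ψ (min y x) ≤ ψ y := h.strictMonoOn_ψ.monotoneOn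
          (lt_min hy0 hx0) hy0 (min_le_left _ _)
        have h2 : φ (max y x) ≤ φ x := h.strictAntiOn_φ.antitoneOn hx0
          (lt_max_of_lt_left hy0) (le_max_right _ _)
        have h3 := (h.ψ_pos y hy0).le
        have h4 := (h.φ_pos (max y x) (lt_max_of_lt_left hy0)).le
        calc ψ (min y x) * φ (max y x) * φ 1 ≤ ψ y * φ x * φ 1 := by gcongr
          _ = _ := by ring
    · filter_upwards [ae_restrict_mem measurableSet_Ioi] with y hy
      have hy0 : 0 < y := hy
      have h1 : Tendsto (fun x => f y * (ψ y / wronskian b σ φ ψ 1 *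
          (φ y * speedDensity b σ y)) / φ x) (𝓝[>] 0) (𝓝 0) :=
        tendsto_const_nhds.div_atTop h.φ_zero
      refine squeeze_zero_norm' ?_ (by simpa only [norm_zero] using h1.norm)
      filter_upwards [Ioo_mem_nhdsGT hy0] with x hx
      have hx0 : 0 < x := hx.1
      rw [greenDensity_of_ge hx.2.le, norm_div, norm_div, norm_mul (f y), norm_mul (f y)]
      gcongr _ * ?_ / _
      have := mul_pos (h.φ_pos y hy0) (speedDensity_pos hc hy0)
      rw [Real.norm_of_nonneg (mul_pos (div_pos (h.ψ_pos x hx0) hC) this).le,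
        Real.norm_of_nonneg (mul_pos (div_pos (h.ψ_pos y hy0) hC) this).le]
      gcongr
      exact h.strictMonoOn_ψ.monotoneOn hx0 hy0 hx.2.le
  rw [integral_zero] at hlim
  refine hlim.congr' ?_
  filter_upwards [self_mem_nhdsWithin] with x hx
  rw [hR.eq_integral x hx, integral_div]

omit hf in
-- The potential of `r` is the constant `1`, and `f ≥ -(|l|/r₀) r`.
lemma bddBelow (hr : DiscountRegular r) (hzero : ZeroInaccessible b σ)
    (hinfty : InftyNatural b σ) {l : ℝ} (hl : ∀ x, 0 < x → l ≤ f x) :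
    ∃ l', ∀ x, 0 < x → l' ≤ R x := by
  obtain ⟨r₀, hr0, hrr⟩ := hr.pos
  refine ⟨-(|l| / r₀), fun x hx => ?_⟩
  obtain ⟨h1, h2⟩ := h.integral_ψ_mul_discount hc hr hzero hx
  obtain ⟨h3, h4⟩ := h.integral_φ_mul_discount hc hr hinfty hx
  have hint := (h.integrableOn_greenDensity_iff hx).2 ⟨h1, h3⟩
  have hone : ∫ y in Ioi (0 : ℝ), r y * greenDensity b σ φ ψ x y = 1 := by
    rw [integral_greenDensity hx hint, h2, h4, mul_neg, ← sub_eq_add_neg, h.wronskian_const hc hx,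
      div_self (h.wronskian_pos one_pos).ne']
  rw [hR.eq_integral x hx]
  have h5 : ∫ y in Ioi (0 : ℝ), -(|l| / r₀) * (r y * greenDensity b σ φ ψ x y) =
      -(|l| / r₀) := by
    rw [integral_const_mul, hone, mul_one]
  rw [← h5]
  refine setIntegral_mono_on (hint.const_mul _) (hR.integrableOn x hx) measurableSet_Ioi
    fun y hy => ?_
  rw [← mul_assoc]
  refine mul_le_mul_of_nonneg_right ?_ (h.greenDensity_pos hc hx hy).le
  have hy0 : 0 < y := hy
  have h6 : |l| ≤ |l| / r₀ * r y := by
    rw [div_mul_eq_mul_div, le_div_iff₀ hr0]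
    exact mul_le_mul_of_nonneg_left (hrr y hy0.le) (abs_nonneg l)
  have := neg_abs_le l
  have := hl y hy0
  linarith

/-- The factor in front is positive, so the monotonicity of `ρ` is governed by the sign of `G -
f/r`. -/
lemma hasDerivAt_slopeRatio (hr : DiscountRegular r) {x : ℝ} (hx : 0 < x) :
    HasDerivAt (slopeRatio R ψ)
      (speedDensity b σ x * r x / flux b σ ψ x * (G R ψ x - f x / r x)) x := by
  obtain ⟨h1, -, h3⟩ := hR.regularity h hc hf hr.continuousOn
  have hψ := (h.flux_ψ_pos hx).ne'
  have hd := (hasDerivAt_flux hc r h1 hx).div (h.hasDerivAt_flux_ψ hc hx) hψ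
  have he : ∀ z, slopeRatio R ψ z = flux b σ R z / flux b σ ψ z := fun z => by
    rw [slopeRatio, flux, flux, div_div_div_cancel_right₀ (scaleDensity_pos z).ne']
  have hrx := (hr.pos_of_pos hx).ne'
  refine (hd.congr_of_eventuallyEq (Eventually.of_forall he)).congr_deriv ?_
  rw [h3 x hx, G, he]
  field_simp
  ring

/-- Up to the factor `flux ψ`, `G` is the Wronskian of `R` with `ψ`, so the `ψ`-component of `R`
drops out and only the integral over `(0, x)` survives. Since `flux ψ` is the integral of `ψ r m`
over `(0, x)`, `G` is a weighted average of `f/r`. -/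
lemma G_mul_flux (hr : ContinuousOn r (Ioi 0)) {x : ℝ} (hx : 0 < x) :
    G R ψ x * flux b σ ψ x = ∫ y in (0 : ℝ)..x, ψ y * f y * speedDensity b σ y := by
  obtain ⟨-, h2, -⟩ := hR.regularity h hc hf hr
  have hψ := (h.flux_ψ_pos hx).ne'
  have hC := (h.wronskian_pos one_pos).ne'
  have he : slopeRatio R ψ x = flux b σ R x / flux b σ ψ x := by
    rw [slopeRatio, flux, flux, div_div_div_cancel_right₀ (scaleDensity_pos x).ne']
  have hW := h.wronskian_const hc hx
  rw [G, he, h2 x hx, hR.eq_split hx]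
  field_simp
  rw [← hW]
  ring

end IsGreenPotential

end Potential

/-! ### Upper limits in the extended reals -/

lemma limsup_coe_eq_bot {f : ℝ → ℝ} (hf : Tendsto f atTop atBot) :
    limsup (fun x => (f x : EReal)) atTop = ⊥ := by
  refine (EReal.eq_bot_iff_forall_lt _).2 fun B => ?_
  have h1 : limsup (fun x => (f x : EReal)) atTop ≤ ((B - 1 : ℝ) : EReal) := by
    refine limsup_le_of_le (by isBoundedDefault) ?_
    filter_upwards [hf.eventually_le_atBot (B - 1)] with x hx
    exact EReal.coe_le_coe_iff.2 hx
  exact h1.trans_lt (EReal.coe_lt_coe_iff.2 (sub_one_lt B))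

lemma coe_le_limsup {α : Type*} {l : Filter α} [l.NeBot] {f : α → ℝ} {B : ℝ}
    (hf : ∀ᶠ x in l, B ≤ f x) : (B : EReal) ≤ limsup (fun x => (f x : EReal)) l := by
  refine le_limsup_of_frequently_le (Eventually.frequently ?_) (by isBoundedDefault)
  filter_upwards [hf] with x hx using EReal.coe_le_coe_iff.2 hx

lemma neg_le_of_neg_limsup_le {f : ℝ → ℝ} {A c : ℝ}
    (hf : ∀ δ > 0, ∀ᶠ x in atTop, f x ≤ A + δ)
    (hc : -limsup (fun x => (f x : EReal)) atTop ≤ (c : EReal)) : -c ≤ A := by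
  refine le_of_forall_pos_le_add fun δ hδ => ?_
  have h1 : limsup (fun x => (f x : EReal)) atTop ≤ ((A + δ : ℝ) : EReal) := by
    refine limsup_le_of_le (by isBoundedDefault) ?_
    filter_upwards [hf δ hδ] with x hx using EReal.coe_le_coe_iff.2 hx
  have h2 : ((-c : ℝ) : EReal) ≤ limsup (fun x => (f x : EReal)) atTop := by
    rw [EReal.coe_neg]
    exact EReal.neg_le.1 hc
  exact EReal.coe_le_coe_iff.1 (h2.trans h1)

lemma comap_coe_nhdsLT_top : comap (fun β : ℝ => (β : EReal)) (𝓝[<] ⊤) = atTop := by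
  have : (𝓝[<] (⊤ : EReal)) = 𝓝[≠] ⊤ := by
    congr 1
    ext x
    simp [lt_top_iff_ne_top]
  rw [this, EReal.nhdsWithin_top]
  exact comap_map EReal.coe_injective

lemma neg_lt_top_iff_ne_bot {x : EReal} : -x < ⊤ ↔ x ≠ ⊥ := by
  rw [lt_top_iff_ne_top, Ne, EReal.neg_eq_top_iff]

/-! ### Analysis of the slope ratio -/

section Slope

variable {R ψ : ℝ → ℝ}

lemma cStar_eq (hxu : xUpper R ψ = ⊤) :
    cStar R ψ = -limsup (fun β : ℝ => (F R ψ (Gam R ψ β) β : EReal)) atTop := by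
  rw [cStar, hxu, comap_coe_nhdsLT_top]

/-- Data on a function `R` and an increasing function `ψ` with `R = o(ψ)` at infinity. -/
structure IsSlopePair (R ψ : ℝ → ℝ) : Prop where
  hasDerivAt_R : ∀ x, 0 < x → HasDerivAt R (slopeRatio R ψ x * deriv ψ x) x
  hasDerivAt_ψ : ∀ x, 0 < x → HasDerivAt ψ (deriv ψ x) x
  ψ_deriv : ∀ x, 0 < x → 0 < deriv ψ x
  ψ_pos : ∀ x, 0 < x → 0 < ψ x
  ψ_infty : Tendsto ψ atTop atTop
  differentiable : ∀ x, 0 < x → DifferentiableAt ℝ (slopeRatio R ψ) x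
  tendsto_div : Tendsto (fun x => R x / ψ x) atTop (𝓝 0)

namespace IsSlopePair

variable (h : IsSlopePair R ψ)

include h

/-- The tilted function `R - λψ` rises or falls according to whether `ρ` lies above or below `λ`.
Every estimate on the critical costs comes from this. -/
lemma hasDerivAt_sub (lam : ℝ) {x : ℝ} (hx : 0 < x) :
    HasDerivAt (fun x => R x - lam * ψ x) ((slopeRatio R ψ x - lam) * deriv ψ x) x :=
  ((h.hasDerivAt_R x hx).sub ((h.hasDerivAt_ψ x hx).const_mul lam)).congr_deriv (by ring)

lemma monotoneOn_sub {lam : ℝ} {D : Set ℝ} (hD : Convex ℝ D) (hD0 : D ⊆ Ioi 0)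
    (hle : ∀ x ∈ D, lam ≤ slopeRatio R ψ x) : MonotoneOn (fun x => R x - lam * ψ x) D := by
  refine monotoneOn_of_deriv_nonneg hD
    (fun x hx => (h.hasDerivAt_sub lam (hD0 hx)).continuousAt.continuousWithinAt)
    (fun x hx => (h.hasDerivAt_sub lam
      (hD0 (interior_subset hx))).differentiableAt.differentiableWithinAt) fun x hx => ?_
  have hx' := interior_subset hx
  rw [(h.hasDerivAt_sub lam (hD0 hx')).deriv]
  exact mul_nonneg (sub_nonneg.2 (hle x hx')) (h.ψ_deriv x (hD0 hx')).le

lemma antitoneOn_sub {lam : ℝ} {D : Set ℝ} (hD : Convex ℝ D) (hD0 : D ⊆ Ioi 0)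
    (hle : ∀ x ∈ D, slopeRatio R ψ x ≤ lam) : AntitoneOn (fun x => R x - lam * ψ x) D := by
  refine antitoneOn_of_deriv_nonpos hD
    (fun x hx => (h.hasDerivAt_sub lam (hD0 hx)).continuousAt.continuousWithinAt)
    (fun x hx => (h.hasDerivAt_sub lam
      (hD0 (interior_subset hx))).differentiableAt.differentiableWithinAt) fun x hx => ?_
  have hx' := interior_subset hx
  rw [(h.hasDerivAt_sub lam (hD0 hx')).deriv]
  exact mul_nonpos_of_nonpos_of_nonneg (sub_nonpos.2 (hle x hx')) (h.ψ_deriv x (hD0 hx')).le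

/-- Otherwise `R + εψ` would be nonincreasing beyond `N`, so `R/ψ` would eventually fall below
`-ε/2`, against `R = o(ψ)`. -/
lemma exists_slopeRatio_gt {ε N : ℝ} (hε : 0 < ε) (hN : 0 < N) :
    ∃ x, N ≤ x ∧ -ε < slopeRatio R ψ x := by
  by_contra! hcon
  have h1 := h.antitoneOn_sub (convex_Ici N) (fun x hx => hN.trans_le hx) hcon
  have h2 : ∀ᶠ x in atTop, -(ε / 2) < R x / ψ x :=
    h.tendsto_div.eventually (lt_mem_nhds (by linarith))
  obtain ⟨x, hx1, hx2, hx3⟩ := (h2.and ((eventually_ge_atTop N).and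
    (h.ψ_infty.eventually_gt_atTop (2 / ε * (R N + ε * ψ N))))).exists
  have hx0 := h.ψ_pos x (hN.trans_le hx2)
  have h3 := h1 (mem_Ici.2 le_rfl) hx2 hx2
  simp only at h3
  rw [lt_div_iff₀ hx0] at hx1
  have h4 : R N + ε * ψ N < ε / 2 * ψ x := by
    have := mul_lt_mul_of_pos_left hx3 (half_pos hε)
    calc _ = ε / 2 * (2 / ε * (R N + ε * ψ N)) := by field_simp
      _ < _ := this
  linarith

lemma exists_slopeRatio_lt {ε N : ℝ} (hε : 0 < ε) (hN : 0 < N) :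
    ∃ x, N ≤ x ∧ slopeRatio R ψ x < ε := by
  by_contra! hcon
  have h1 := h.monotoneOn_sub (convex_Ici N) (fun x hx => hN.trans_le hx) hcon
  have h2 : ∀ᶠ x in atTop, R x / ψ x < ε / 2 :=
    h.tendsto_div.eventually (gt_mem_nhds (by linarith))
  obtain ⟨x, hx1, hx2, hx3⟩ := (h2.and ((eventually_ge_atTop N).and
    (h.ψ_infty.eventually_gt_atTop (2 / ε * (ε * ψ N - R N))))).exists
  have hx0 := h.ψ_pos x (hN.trans_le hx2)
  have h3 := h1 (mem_Ici.2 le_rfl) hx2 hx2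
  simp only at h3
  rw [div_lt_iff₀ hx0] at hx1
  have h4 : ε * ψ N - R N < ε / 2 * ψ x := by
    have := mul_lt_mul_of_pos_left hx3 (half_pos hε)
    calc _ = ε / 2 * (2 / ε * (ε * ψ N - R N)) := by field_simp
      _ < _ := this
  linarith

/-- A decreasing `ρ` with a negative value would stay below that value, which `exists_slopeRatio_gt`
excludes. -/
lemma monotoneOn_of_strictAntiOn (hρ : StrictAntiOn (slopeRatio R ψ) (Ioi 0)) :
    MonotoneOn R (Ioi 0) := by
  have h1 : ∀ x ∈ Ioi (0 : ℝ), 0 ≤ slopeRatio R ψ x := by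
    intro x hx
    by_contra! hneg
    obtain ⟨y, hy1, hy2⟩ := h.exists_slopeRatio_gt (neg_pos.2 hneg) hx
    rw [neg_neg] at hy2
    exact absurd (hρ.antitoneOn hx (lt_of_lt_of_le hx hy1) hy1) (not_le.2 hy2)
  simpa using h.monotoneOn_sub (lam := 0) (convex_Ioi 0) subset_rfl h1

variable {x₀ : ℝ} (hx₀ : 0 < x₀) (hanti : StrictAntiOn (slopeRatio R ψ) (Ioc 0 x₀))
  (hmono : StrictMonoOn (slopeRatio R ψ) (Ici x₀))

include hx₀ hmono

/-- An increasing `ρ` reaching `0` would stay above a positive constant, against `R = o(ψ)`. With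
the next lemma, `ρ` tends to `0` from below. -/
lemma slopeRatio_neg {x : ℝ} (hx : x₀ ≤ x) : slopeRatio R ψ x < 0 := by
  by_contra! hcon
  have hx1 : x < x + 1 := lt_add_one x
  have h1 : 0 < slopeRatio R ψ (x + 1) := hcon.trans_lt (hmono hx (hx.trans hx1.le) hx1)
  obtain ⟨y, hy1, hy2⟩ := h.exists_slopeRatio_lt h1 ((hx₀.trans_le hx).trans hx1)
  exact absurd (hmono.monotoneOn (hx.trans hx1.le) (hx.trans (hx1.le.trans hy1)) hy1)
    (not_le.2 hy2)

lemma eventually_slopeRatio_gt {ε : ℝ} (hε : 0 < ε) : ∀ᶠ x in atTop, -ε < slopeRatio R ψ x := by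
  obtain ⟨y, hy1, hy2⟩ := h.exists_slopeRatio_gt hε hx₀
  filter_upwards [eventually_ge_atTop y] with x hx
  exact hy2.trans_le (hmono.monotoneOn hy1 (hy1.trans hx) hx)

lemma eventually_mul_le {A δ : ℝ} (hδ : 0 < δ) :
    ∀ᶠ x in atTop, -slopeRatio R ψ x * A ≤ δ := by
  have hA : 0 < |A| + 1 := by positivity
  filter_upwards [h.eventually_slopeRatio_gt hx₀ hmono (div_pos hδ hA), eventually_ge_atTop x₀]
    with x hx1 hx2
  have h1 := h.slopeRatio_neg hx₀ hmono hx2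
  have h2 : -slopeRatio R ψ x * (|A| + 1) ≤ δ := by
    rw [← le_div_iff₀ hA]
    linarith
  have h3 : -slopeRatio R ψ x * A ≤ -slopeRatio R ψ x * (|A| + 1) :=
    mul_le_mul_of_nonneg_left ((le_abs_self A).trans (by linarith)) (by linarith)
  linarith

include hanti

omit hx₀ hmono in
-- For `λ = ρ(v)`, the increment of `G` from `u` to `v` is that of `R - λψ` plus `(ρ(u) -
-- ρ(v))ψ(u)`, and both are nonnegative where `ρ` decreases.
lemma monotoneOn_G : MonotoneOn (G R ψ) (Ioc 0 x₀) := by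
  intro u hu v hv huv
  have hle : ∀ x ∈ Icc u v, slopeRatio R ψ v ≤ slopeRatio R ψ x := fun x hx =>
    hanti.antitoneOn ⟨hu.1.trans_le hx.1, hx.2.trans hv.2⟩ hv hx.2
  have h1 := h.monotoneOn_sub (convex_Icc u v) (fun x hx => hu.1.trans_le hx.1) hle
    ⟨le_rfl, huv⟩ ⟨huv, le_rfl⟩ huv
  have h2 := mul_le_mul_of_nonneg_right (hle u ⟨le_rfl, huv⟩) (h.ψ_pos u hu.1).le
  simp only at h1
  simp only [G]
  linarith

omit h in
-- Either every level of `ρ` to the right of `x₀` is also attained near `0`, so that `Γ` is defined,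
-- or `ρ` eventually exceeds all its earlier values and `0` takes the place of `Γ(β)`.
lemma eq_or_lt_of_xUpper : (xUpper R ψ = ⊤ ∧
      ∀ β, x₀ < β → (slopeRatio R ψ β : EReal) < slopeRatioZero R ψ) ∨
    (xUpper R ψ < ⊤ ∧ ∃ s, x₀ < s ∧ ∀ β, s ≤ β → ∀ x, 0 < x → x < β →
      slopeRatio R ψ x ≤ slopeRatio R ψ β) := by
  by_cases hex : ∃ s, 0 < s ∧ slopeRatioZero R ψ < (slopeRatio R ψ s : EReal)
  · right
    obtain ⟨s, hs0, hs⟩ := hex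
    have hz : ∀ x ∈ Ioc 0 x₀, (slopeRatio R ψ x : EReal) ≤ slopeRatioZero R ψ := fun x hx => by
      refine coe_le_limsup ?_
      filter_upwards [Ioo_mem_nhdsGT hx.1] with y hy
      exact hanti.antitoneOn ⟨hy.1, hy.2.le.trans hx.2⟩ hx hy.2.le
    have hxs : x₀ < s := by
      by_contra! hcon
      exact absurd (hz s ⟨hs0, hcon⟩) (not_le.2 hs)
    refine ⟨?_, s, hxs, fun β hβ x hx hxβ => ?_⟩
    · refine lt_of_le_of_lt (b := (s : EReal)) (sInf_le ?_) (EReal.coe_lt_top s)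
      exact ⟨s, ⟨hs0, hs⟩, rfl⟩
    · rcases le_total x x₀ with hxx | hxx
      · have h1 : slopeRatio R ψ x < slopeRatio R ψ s :=
          EReal.coe_lt_coe_iff.1 ((hz x ⟨hx, hxx⟩).trans_lt hs)
        exact h1.le.trans (hmono.monotoneOn hxs.le (hxs.le.trans hβ) hβ)
      · exact hmono.monotoneOn hxx (hxx.trans hxβ.le) hxβ.le
  · left
    push Not at hex
    refine ⟨?_, fun β hβ => ?_⟩
    · rw [xUpper, sInf_eq_top]
      rintro _ ⟨s, ⟨hs0, hs⟩, rfl⟩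
      exact absurd (hex s hs0) (not_le.2 hs)
    -- The definition of `x̄ = ∞` gives only `≤`; passing through `β + 1`, where `ρ` is strictly
    -- larger, makes the inequality strict.
    · have hβ1 : β < β + 1 := lt_add_one β
      refine lt_of_lt_of_le ?_ (hex (β + 1) ((hx₀.trans hβ).trans hβ1))
      exact EReal.coe_lt_coe_iff.2 (hmono hβ.le (hβ.le.trans hβ1.le) hβ1)

lemma Gam_spec {β : ℝ} (hβ : x₀ < β) (hz : (slopeRatio R ψ β : EReal) < slopeRatioZero R ψ) :
    0 < Gam R ψ β ∧ Gam R ψ β < x₀ ∧ slopeRatio R ψ (Gam R ψ β) = slopeRatio R ψ β := by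
  obtain ⟨y, hy1, hy2⟩ := ((frequently_lt_of_lt_limsup (by isBoundedDefault) hz).and_eventually
    (Ioo_mem_nhdsGT hx₀)).exists
  rw [EReal.coe_lt_coe_iff] at hy1
  have hcont : ContinuousOn (slopeRatio R ψ) (Icc y x₀) := fun z hz =>
    (h.differentiable z (hy2.1.trans_le hz.1)).continuousAt.continuousWithinAt
  have hβ' : slopeRatio R ψ x₀ < slopeRatio R ψ β := hmono (mem_Ici.2 le_rfl) hβ.le hβ
  obtain ⟨γ, hγ1, hγ2⟩ := intermediate_value_Icc' hy2.2.le hcont ⟨hβ'.le, hy1.le⟩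
  have hγ0 : 0 < γ := hy2.1.trans_le hγ1.1
  have hγx : γ < x₀ := lt_of_le_of_ne hγ1.2 fun he => by
    rw [he] at hγ2
    exact hβ'.ne hγ2
  have hset : {γ : ℝ | 0 < γ ∧ γ < β ∧ slopeRatio R ψ γ = slopeRatio R ψ β} = {γ} := by
    ext z
    simp only [mem_ofPred_eq, mem_singleton_iff]
    constructor
    · rintro ⟨hz0, hzβ, hze⟩
      rcases le_total z x₀ with hzx | hzx
      · exact hanti.injOn ⟨hz0, hzx⟩ ⟨hγ0, hγx.le⟩ (hze.trans hγ2.symm)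
      · exact absurd hze (hmono hzx hβ.le hzβ).ne
    · rintro rfl
      exact ⟨hγ0, hγx.trans hβ, hγ2⟩
  have : Gam R ψ β = γ := by rw [Gam, hset, csInf_singleton]
  rw [this]
  exact ⟨hγ0, hγx, hγ2⟩

/-- With `λ = ρ(β) = ρ(γ)`, `F(γ, β)` is the increment of `R - λψ` from its maximum on `(0, β]`, at
`γ`, to `β`. Since `R - λψ` rises before `γ` and falls after it, no increment between `u < v < β` is
smaller. -/
lemma F_le {β : ℝ} (hβ : x₀ < β) (hz : (slopeRatio R ψ β : EReal) < slopeRatioZero R ψ)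
    {u v : ℝ} (hu : 0 < u) (huv : u < v) (hvβ : v < β) :
    F R ψ (Gam R ψ β) β ≤ R v - R u + -slopeRatio R ψ β * (ψ v - ψ u) := by
  obtain ⟨hγ0, hγx, hγ⟩ := h.Gam_spec hx₀ hanti hmono hβ hz
  set γ := Gam R ψ β
  have hγβ : γ < β := hγx.trans hβ
  have hup := h.monotoneOn_sub (lam := slopeRatio R ψ β) (convex_Ioc 0 γ) (fun x hx => hx.1)
    fun x hx => by
      rw [← hγ]
      exact hanti.antitoneOn ⟨hx.1, hx.2.trans hγx.le⟩ ⟨hγ0, hγx.le⟩ hx.2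
  have hdown := h.antitoneOn_sub (lam := slopeRatio R ψ β) (convex_Icc γ β)
    (fun x hx => hγ0.trans_le hx.1) fun x hx => by
      rcases le_total x x₀ with hxx | hxx
      · rw [← hγ]
        exact hanti.antitoneOn ⟨hγ0, hγx.le⟩ ⟨hγ0.trans_le hx.1, hxx⟩ hx.1
      · exact hmono.monotoneOn hxx hβ.le hx.2
  have hF : F R ψ γ β = (R β - slopeRatio R ψ β * ψ β) - (R γ - slopeRatio R ψ β * ψ γ) := by
    rw [F, G, G, hγ]
  rw [hF]
  rcases le_total v γ with hvγ | hvγ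
  · have h1 := hup ⟨hu, huv.le.trans hvγ⟩ ⟨hu.trans huv, hvγ⟩ huv.le
    have h2 := hdown ⟨le_rfl, hγβ.le⟩ ⟨hγβ.le, le_rfl⟩ hγβ.le
    simp only at h1 h2
    linarith
  · have h1 := hdown ⟨hvγ, hvβ.le⟩ ⟨hγβ.le, le_rfl⟩ hvβ.le
    have h2 : R u - slopeRatio R ψ β * ψ u ≤ R γ - slopeRatio R ψ β * ψ γ := by
      rcases le_total u γ with huγ | huγ
      · exact hup ⟨hu, huγ⟩ ⟨hγ0, le_rfl⟩ huγ
      · exact hdown ⟨le_rfl, hγβ.le⟩ ⟨huγ, (huv.trans hvβ).le⟩ huγ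
    simp only at h1
    linarith

/-- The critical cost bounds the loss of `R` if `x̄ = ∞`. -/
lemma le_of_cStar_le (hxu : xUpper R ψ = ⊤)
    (hz : ∀ β, x₀ < β → (slopeRatio R ψ β : EReal) < slopeRatioZero R ψ) {c : ℝ}
    (hc : cStar R ψ ≤ (c : EReal)) {u v : ℝ} (hu : 0 < u) (huv : u < v) :
    R u - R v ≤ c := by
  rw [cStar_eq hxu] at hc
  have := neg_le_of_neg_limsup_le (A := R v - R u) (fun δ hδ => ?_) hc
  · linarith
  · filter_upwards [h.eventually_mul_le hx₀ hmono (A := ψ v - ψ u) hδ, eventually_gt_atTop x₀,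
      eventually_gt_atTop v] with β hβ1 hβ2 hβ3
    have := h.F_le hx₀ hanti hmono hβ2 (hz β hβ2) hu huv hβ3
    linarith

lemma cStar_lt_top (hxu : xUpper R ψ = ⊤)
    (hz : ∀ β, x₀ < β → (slopeRatio R ψ β : EReal) < slopeRatioZero R ψ) {B : ℝ}
    (hG : ∀ᶠ x in atTop, B ≤ G R ψ x) : cStar R ψ < ⊤ := by
  rw [cStar_eq hxu, neg_lt_top_iff_ne_bot]
  refine ne_of_gt (lt_of_lt_of_le (EReal.bot_lt_coe (B - G R ψ x₀)) (coe_le_limsup ?_))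
  filter_upwards [hG, eventually_gt_atTop x₀] with β hβ1 hβ2
  obtain ⟨hγ0, hγx, -⟩ := h.Gam_spec hx₀ hanti hmono hβ2 (hz β hβ2)
  have := h.monotoneOn_G hanti ⟨hγ0, hγx.le⟩ ⟨hx₀, le_rfl⟩ hγx.le
  rw [F]
  linarith

/-- Apply `F_le` with `u = x₀`. As `ρ < 0`, `R(v) < G(v)`, so a suitable `v` makes the bound
arbitrarily negative for all large `β`. -/
lemma cStar_eq_top (hxu : xUpper R ψ = ⊤)
    (hz : ∀ β, x₀ < β → (slopeRatio R ψ β : EReal) < slopeRatioZero R ψ)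
    (hG : Tendsto (G R ψ) atTop atBot) : cStar R ψ = ⊤ := by
  rw [cStar_eq hxu, limsup_coe_eq_bot, EReal.neg_bot]
  rw [tendsto_atBot]
  intro B
  obtain ⟨v, hv1, hv2⟩ := ((hG.eventually_le_atBot (B - 1 + R x₀)).and
    (eventually_gt_atTop x₀)).exists
  filter_upwards [h.eventually_mul_le hx₀ hmono (A := ψ v - ψ x₀) one_pos,
    eventually_gt_atTop v] with β hβ1 hβ2
  have h1 := h.F_le hx₀ hanti hmono (hv2.trans hβ2) (hz β (hv2.trans hβ2)) hx₀ hv2 hβ2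
  have h2 := mul_neg_of_neg_of_pos (h.slopeRatio_neg hx₀ hmono hv2.le)
    (h.ψ_pos v (hx₀.trans hv2))
  simp only [G] at hv1
  linarith

omit hmono in
/-- If `x̄ < ∞`, then `G` has a finite limit at `0`. -/
lemma exists_FZero_eq {s : ℝ} (hs : x₀ < s)
    (hle : ∀ β, s ≤ β → ∀ x, 0 < x → x < β → slopeRatio R ψ x ≤ slopeRatio R ψ β) :
    ∃ g : ℝ, g ≤ G R ψ x₀ ∧ (∀ β, FZero R ψ β = ((G R ψ β - g : ℝ) : EReal)) ∧
      ∀ β, s ≤ β → ∀ u v, 0 < u → u < v → v < β →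
        G R ψ β - g ≤ R v - R u + -slopeRatio R ψ β * (ψ v - ψ u) := by
  set g₀ := limsup (fun γ : ℝ => (G R ψ γ : EReal)) (𝓝[>] 0) with hg₀
  have hdown : ∀ β, s ≤ β → AntitoneOn (fun x => R x - slopeRatio R ψ β * ψ x) (Ioc 0 β) :=
    fun β hβ => h.antitoneOn_sub (convex_Ioc 0 β) (fun x hx => hx.1) fun x hx => by
      rcases hx.2.eq_or_lt with he | hlt
      · rw [he]
      · exact hle β hβ x hx.1 hlt
  -- For `λ = ρ(β)` and `y < u`, `G(y) ≥ (R - λψ)(y) ≥ (R - λψ)(u)`. This bounds the limit of `G` at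
  -- `0` from below, while monotonicity of `G` bounds it from above; hence it is finite.
  have hS : ∀ β, s ≤ β → ∀ u, 0 < u → u < β →
      ((R u - slopeRatio R ψ β * ψ u : ℝ) : EReal) ≤ g₀ := fun β hβ u hu huβ => by
    refine coe_le_limsup ?_
    filter_upwards [Ioo_mem_nhdsGT hu] with y hy
    have h1 := hdown β hβ ⟨hy.1, (hy.2.trans huβ).le⟩ ⟨hu, huβ.le⟩ hy.2.le
    have h2 := mul_le_mul_of_nonneg_right (hle β hβ y hy.1 (hy.2.trans huβ)) (h.ψ_pos y hy.1).le
    simp only at h1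
    rw [G]
    linarith
  have hg1 : g₀ ≤ (G R ψ x₀ : EReal) := by
    refine limsup_le_of_le (by isBoundedDefault) ?_
    filter_upwards [Ioo_mem_nhdsGT hx₀] with y hy
    exact EReal.coe_le_coe_iff.2 (h.monotoneOn_G hanti ⟨hy.1, hy.2.le⟩ ⟨hx₀, le_rfl⟩ hy.2.le)
  have hg2 := hS s le_rfl x₀ hx₀ hs
  obtain ⟨g, hg⟩ : ∃ g : ℝ, (g : EReal) = g₀ := ⟨g₀.toReal, EReal.coe_toReal
    (ne_of_lt (hg1.trans_lt (EReal.coe_lt_top _))) (ne_of_gt ((EReal.bot_lt_coe _).trans_le hg2))⟩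
  refine ⟨g, ?_, fun β => ?_, fun β hβ u v hu huv hvβ => ?_⟩
  · rw [← hg] at hg1
    exact EReal.coe_le_coe_iff.1 hg1
  · rw [FZero, ← hg₀, ← hg, EReal.coe_sub]
  · have h1 := hS β hβ u hu (huv.trans hvβ)
    rw [← hg, EReal.coe_le_coe_iff] at h1
    have h2 := hdown β hβ ⟨hu.trans huv, hvβ.le⟩ ⟨(hu.trans huv).trans hvβ, le_rfl⟩ hvβ.le
    simp only at h2
    rw [G]
    linarith

/-- The critical cost bounds the loss of `R` if `x̄ < ∞`. -/
lemma le_of_cCirc_le {s : ℝ} (hs : x₀ < s)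
    (hle : ∀ β, s ≤ β → ∀ x, 0 < x → x < β → slopeRatio R ψ x ≤ slopeRatio R ψ β) {c : ℝ}
    (hc : cCirc R ψ ≤ (c : EReal)) {u v : ℝ} (hu : 0 < u) (huv : u < v) :
    R u - R v ≤ c := by
  obtain ⟨g, -, hF, hg⟩ := h.exists_FZero_eq hx₀ hanti hs hle
  rw [cCirc, funext hF] at hc
  have := neg_le_of_neg_limsup_le (A := R v - R u) (fun δ hδ => ?_) hc
  · linarith
  · filter_upwards [h.eventually_mul_le hx₀ hmono (A := ψ v - ψ u) hδ, eventually_ge_atTop s,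
      eventually_gt_atTop v] with β hβ1 hβ2 hβ3
    have := hg β hβ2 u v hu huv hβ3
    linarith

omit hmono in
lemma cCirc_lt_top {s : ℝ} (hs : x₀ < s)
    (hle : ∀ β, s ≤ β → ∀ x, 0 < x → x < β → slopeRatio R ψ x ≤ slopeRatio R ψ β) {B : ℝ}
    (hG : ∀ᶠ x in atTop, B ≤ G R ψ x) : cCirc R ψ < ⊤ := by
  obtain ⟨g, -, hF, -⟩ := h.exists_FZero_eq hx₀ hanti hs hle
  rw [cCirc, funext hF, neg_lt_top_iff_ne_bot]
  refine ne_of_gt (lt_of_lt_of_le (EReal.bot_lt_coe (B - g)) (coe_le_limsup ?_))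
  filter_upwards [hG] with β hβ
  linarith

omit hmono in
lemma cCirc_eq_top {s : ℝ} (hs : x₀ < s)
    (hle : ∀ β, s ≤ β → ∀ x, 0 < x → x < β → slopeRatio R ψ x ≤ slopeRatio R ψ β)
    (hG : Tendsto (G R ψ) atTop atBot) : cCirc R ψ = ⊤ := by
  obtain ⟨g, -, hF, -⟩ := h.exists_FZero_eq hx₀ hanti hs hle
  rw [cCirc, funext hF, limsup_coe_eq_bot, EReal.neg_bot]
  exact tendsto_atBot_add_const_right _ (-g) hG

end IsSlopePair

end Slope

/-! ### The slope ratio of the resolvent of a unimodal function -/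

lemma tendsto_integral_nhdsGT_zero {f : ℝ → ℝ} {a : ℝ} (ha : 0 < a)
    (hf : IntervalIntegrable f volume 0 a) :
    Tendsto (fun x => ∫ y in (0 : ℝ)..x, f y) (𝓝[>] 0) (𝓝 0) := by
  have h1 : ContinuousOn (fun x => ∫ y in (0 : ℝ)..x, f y) (uIcc 0 a) :=
    intervalIntegral.continuousOn_primitive_interval
      ((intervalIntegrable_iff' (by simp)).1 hf)
  have h2 := h1 0 left_mem_uIcc
  rw [ContinuousWithinAt, intervalIntegral.integral_same, uIcc_of_le ha.le] at h2
  refine h2.mono_left ?_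
  rw [← nhdsWithin_Ioo_eq_nhdsGT ha]
  exact nhdsWithin_mono _ Ioo_subset_Icc_self

section Unimodal

variable {b σ r φ ψ f R : ℝ → ℝ}

lemma IsGreenPotential.isSlopePair (hR : IsGreenPotential b σ φ ψ f R)
    (h : IsFundamentalPair b σ r φ ψ) (hc : CoefficientsRegular b σ)
    (hf : ContinuousOn f (Ioi 0)) (hr : DiscountRegular r) : IsSlopePair R ψ where
  hasDerivAt_R x hx := by
    rw [slopeRatio, div_mul_cancel₀ _ (h.ψ_deriv x hx).ne']
    exact hasDerivAt_of_contDiffOn_two (hR.regularity h hc hf hr.continuousOn).1 hx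
  hasDerivAt_ψ x hx := hasDerivAt_of_contDiffOn_two h.ψ_C2 hx
  ψ_deriv := h.ψ_deriv
  ψ_pos := h.ψ_pos
  ψ_infty := h.ψ_infty
  differentiable x hx := (hR.hasDerivAt_slopeRatio h hc hf hr hx).differentiableAt
  tendsto_div := hR.tendsto_div_ψ h hc

/-- The standing assumptions for a unimodal ratio `f / r`. -/
structure IsUnimodalPotential (b σ r φ ψ f R : ℝ → ℝ) (ξ : ℝ) : Prop where
  coeff : CoefficientsRegular b σ
  discount : DiscountRegular r
  pair : IsFundamentalPair b σ r φ ψ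
  potential : IsGreenPotential b σ φ ψ f R
  cont : ContinuousOn f (Ioi 0)
  ξ_pos : 0 < ξ
  strictMonoOn : StrictMonoOn (fun x => f x / r x) (Ioo 0 ξ)
  strictAntiOn : StrictAntiOn (fun x => f x / r x) (Ioi ξ)
  flux_zero : Tendsto (flux b σ ψ) (𝓝[>] 0) (𝓝 0)
  flux_infty : Tendsto (flux b σ ψ) atTop atTop

namespace IsUnimodalPotential

variable {ξ : ℝ} (h : IsUnimodalPotential b σ r φ ψ f R ξ)

include h

lemma continuousOn_ratio : ContinuousOn (fun x => f x / r x) (Ioi 0) :=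
  h.cont.div h.discount.continuousOn fun _ hx => (h.discount.pos_of_pos hx).ne'

lemma ratio_lt {x y : ℝ} (hy : 0 < y) (hyx : y < x) (hx : x ≤ ξ) : f y / r y < f x / r x := by
  rcases hx.lt_or_eq with hlt | rfl
  · exact h.strictMonoOn ⟨hy, hyx.trans hlt⟩ ⟨hy.trans hyx, hlt⟩ hyx
  · obtain ⟨z, hz1, hz2⟩ := exists_between hyx
    refine (h.strictMonoOn ⟨hy, hyx⟩ ⟨hy.trans hz1, hz2⟩ hz1).trans_le ?_
    have hcont : Tendsto (fun x => f x / r x) (𝓝[<] x) (𝓝 (f x / r x)) :=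
      (h.continuousOn_ratio.continuousAt (Ioi_mem_nhds h.ξ_pos)).tendsto.mono_left
        nhdsWithin_le_nhds
    refine ge_of_tendsto hcont ?_
    filter_upwards [Ioo_mem_nhdsLT hz2] with w hw
    exact (h.strictMonoOn ⟨hy.trans hz1, hz2⟩ ⟨(hy.trans hz1).trans hw.1, hw.2⟩ hw.1).le

/-- `(G - a) · flux ψ` accumulates `f/r - a` with positive weight; it compares the running average
`G` with a level `a`. -/
lemma hasDerivAt_sub_flux (a : ℝ) {y : ℝ} (hy : 0 < y) :
    HasDerivAt (fun y => G R ψ y * flux b σ ψ y - a * flux b σ ψ y)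
      (speedDensity b σ y * r y * ψ y * (f y / r y - a)) y := by
  have h1 := (h.potential.hasDerivAt_left h.pair h.coeff h.cont hy).sub
    ((h.pair.hasDerivAt_flux_ψ h.coeff hy).const_mul a)
  have hry := (h.discount.pos_of_pos hy).ne'
  refine (h1.congr_deriv ?_).congr_of_eventuallyEq ?_
  · field_simp
  · filter_upwards [Ioi_mem_nhds hy] with z hz
    simp only [Pi.sub_apply]
    rw [h.potential.G_mul_flux h.pair h.coeff h.cont h.discount.continuousOn hz]

lemma weight_pos {y : ℝ} (hy : 0 < y) : 0 < speedDensity b σ y * r y * ψ y :=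
  mul_pos (mul_pos (speedDensity_pos h.coeff hy) (h.discount.pos_of_pos hy)) (h.pair.ψ_pos y hy)

lemma monotoneOn_sub_flux {a : ℝ} {D : Set ℝ} (hD : Convex ℝ D) (hD0 : D ⊆ Ioi 0)
    (hle : ∀ y ∈ D, a ≤ f y / r y) :
    MonotoneOn (fun y => G R ψ y * flux b σ ψ y - a * flux b σ ψ y) D := by
  refine monotoneOn_of_deriv_nonneg hD
    (fun x hx => (h.hasDerivAt_sub_flux a (hD0 hx)).continuousAt.continuousWithinAt)
    (fun x hx => (h.hasDerivAt_sub_flux a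
      (hD0 (interior_subset hx))).differentiableAt.differentiableWithinAt) fun x hx => ?_
  have hx' := interior_subset hx
  rw [(h.hasDerivAt_sub_flux a (hD0 hx')).deriv]
  exact mul_nonneg (h.weight_pos (hD0 hx')).le (sub_nonneg.2 (hle x hx'))

lemma antitoneOn_sub_flux {a : ℝ} {D : Set ℝ} (hD : Convex ℝ D) (hD0 : D ⊆ Ioi 0)
    (hle : ∀ y ∈ D, f y / r y ≤ a) :
    AntitoneOn (fun y => G R ψ y * flux b σ ψ y - a * flux b σ ψ y) D := by
  refine antitoneOn_of_deriv_nonpos hD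
    (fun x hx => (h.hasDerivAt_sub_flux a (hD0 hx)).continuousAt.continuousWithinAt)
    (fun x hx => (h.hasDerivAt_sub_flux a
      (hD0 (interior_subset hx))).differentiableAt.differentiableWithinAt) fun x hx => ?_
  have hx' := interior_subset hx
  rw [(h.hasDerivAt_sub_flux a (hD0 hx')).deriv]
  exact mul_nonpos_of_nonneg_of_nonpos (h.weight_pos (hD0 hx')).le (sub_nonpos.2 (hle x hx'))

/-- The average of a strictly increasing function over `(0, x)` lies below its value at the right
end. -/
lemma G_lt_ratio {x : ℝ} (hx : 0 < x) (hxξ : x ≤ ξ) : G R ψ x < f x / r x := by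
  have hanti : StrictAntiOn (fun y => G R ψ y * flux b σ ψ y - f x / r x * flux b σ ψ y)
      (Ioc 0 x) := by
    refine strictAntiOn_of_hasDerivAt_neg (convex_Ioc 0 x)
      (fun y hy => h.hasDerivAt_sub_flux _ hy.1) fun y hy => ?_
    rw [interior_Ioc] at hy
    exact mul_neg_of_pos_of_neg (h.weight_pos hy.1) (sub_neg.2 (h.ratio_lt hy.1 hy.2 hxξ))
  have hlim : Tendsto (fun y => G R ψ y * flux b σ ψ y - f x / r x * flux b σ ψ y)
      (𝓝[>] 0) (𝓝 0) := by
    have h1 := (tendsto_integral_nhdsGT_zero hx (h.potential.intervalIntegrable_ψ h.pair hx)).sub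
      (h.flux_zero.const_mul (f x / r x))
    rw [mul_zero, sub_zero] at h1
    refine h1.congr' ?_
    filter_upwards [self_mem_nhdsWithin] with z hz
    rw [h.potential.G_mul_flux h.pair h.coeff h.cont h.discount.continuousOn hz]
  -- An intermediate point keeps the inequality strict when the comparison is taken to the limit at
  -- `0`.
  have hx2 : x / 2 ∈ Ioc 0 x := ⟨half_pos hx, (half_lt_self hx).le⟩
  have h2 := hanti hx2 ⟨hx, le_rfl⟩ (half_lt_self hx)
  have h3 : G R ψ (x / 2) * flux b σ ψ (x / 2) - f x / r x * flux b σ ψ (x / 2) ≤ 0 := by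
    refine ge_of_tendsto hlim ?_
    filter_upwards [Ioo_mem_nhdsGT hx2.1] with y hy
    exact hanti.antitoneOn ⟨hy.1, hy.2.le.trans hx2.2⟩ hx2 hy.2.le
  have h4 := h2.trans_le h3
  simp only [← sub_mul] at h4
  have h5 := h.pair.flux_ψ_pos hx
  by_contra! hcon
  exact absurd (mul_nonneg (sub_nonneg.2 hcon) h5.le) (not_le.2 h4)

/-- Beyond `ξ` the ratio decreases, so once the average has caught up with it, all later
contributions exceed the current value. Hence the sign changes only once. -/
lemma ratio_lt_G_of_le {x y : ℝ} (hx : ξ < x) (hxy : x < y) (hxG : f x / r x ≤ G R ψ x) :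
    f y / r y < G R ψ y := by
  have hx0 := h.ξ_pos.trans hx
  have hy0 := hx0.trans hxy
  have hmono : StrictMonoOn (fun z => G R ψ z * flux b σ ψ z - f y / r y * flux b σ ψ z)
      (Icc x y) := by
    refine strictMonoOn_of_hasDerivAt_pos (convex_Icc x y)
      (fun z hz => h.hasDerivAt_sub_flux _ (hx0.trans_le hz.1)) fun z hz => ?_
    rw [interior_Icc] at hz
    exact mul_pos (h.weight_pos (hx0.trans hz.1))
      (sub_pos.2 (h.strictAntiOn (hx.trans hz.1) (hx.trans hxy) hz.2))
  have h1 := hmono ⟨le_rfl, hxy.le⟩ ⟨hxy.le, le_rfl⟩ hxy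
  have h2 := h.strictAntiOn hx (hx.trans hxy) hxy
  have h3 := h.pair.flux_ψ_pos hx0
  have h4 := h.pair.flux_ψ_pos hy0
  simp only [← sub_mul] at h1 h2
  have h5 : 0 < (G R ψ x - f y / r y) * flux b σ ψ x := mul_pos (by linarith) h3
  by_contra! hcon
  have := mul_nonpos_of_nonpos_of_nonneg (sub_nonpos.2 hcon) h4.le
  linarith

lemma hasDerivAt_slope {x : ℝ} (hx : 0 < x) :
    HasDerivAt (slopeRatio R ψ)
      (speedDensity b σ x * r x / flux b σ ψ x * (G R ψ x - f x / r x)) x :=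
  h.potential.hasDerivAt_slopeRatio h.pair h.coeff h.cont h.discount hx

lemma slope_weight_pos {x : ℝ} (hx : 0 < x) :
    0 < speedDensity b σ x * r x / flux b σ ψ x :=
  div_pos (mul_pos (speedDensity_pos h.coeff hx) (h.discount.pos_of_pos hx))
    (h.pair.flux_ψ_pos hx)

lemma deriv_slope_neg_iff {x : ℝ} (hx : 0 < x) :
    deriv (slopeRatio R ψ) x < 0 ↔ G R ψ x < f x / r x := by
  rw [(h.hasDerivAt_slope hx).deriv, ← sub_neg (b := f x / r x), mul_neg_iff]
  simp [h.slope_weight_pos hx, (h.slope_weight_pos hx).le]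

lemma continuousOn_G : ContinuousOn (G R ψ) (Ioi 0) := by
  have hρ : ContinuousOn (slopeRatio R ψ) (Ioi 0) := fun y hy =>
    (h.hasDerivAt_slope hy).continuousAt.continuousWithinAt
  exact (h.potential.regularity h.pair h.coeff h.cont h.discount.continuousOn).1.continuousOn.sub
    (hρ.mul h.pair.continuousOn_ψ)

lemma strictAntiOn_of_xLower_eq_top (hxl : xLower R ψ = ⊤) :
    StrictAntiOn (slopeRatio R ψ) (Ioi 0) := by
  refine strictAntiOn_of_hasDerivAt_neg (convex_Ioi 0) (fun x hx => h.hasDerivAt_slope hx)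
    fun x hx => ?_
  rw [interior_Ioi] at hx
  have hlt : (x : EReal) < xLower R ψ := hxl ▸ EReal.coe_lt_top x
  obtain ⟨y, hy, hxy⟩ := lt_sSup_iff.1 hlt
  rw [← (h.hasDerivAt_slope hx).deriv]
  exact hy x hx hxy

/-- The point `x₀` is a zero of `G - f/r` to the right of `ξ`. It plays the part of `x̲`, of which
only the two monotonicity properties are needed. -/
lemma exists_turning_point (hxl : xLower R ψ < ⊤) :
    ∃ x₀, 0 < x₀ ∧ StrictAntiOn (slopeRatio R ψ) (Ioc 0 x₀) ∧
      StrictMonoOn (slopeRatio R ψ) (Ici x₀) := by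
  obtain ⟨x, hx0, hx⟩ : ∃ x, 0 < x ∧ f x / r x ≤ G R ψ x := by
    by_contra! hcon
    refine hxl.ne (top_unique (le_sSup fun x hx _ => ?_))
    exact (h.deriv_slope_neg_iff hx).2 (hcon x hx)
  have hξx : ξ < x := by
    by_contra! hcon
    exact absurd (h.G_lt_ratio hx0 hcon) (not_lt.2 hx)
  have hcont : ContinuousOn (fun x => G R ψ x - f x / r x) (Icc ξ x) :=
    (h.continuousOn_G.sub h.continuousOn_ratio).mono fun y hy => h.ξ_pos.trans_le hy.1
  obtain ⟨x₀, hx₀, hx₀'⟩ := intermediate_value_Icc hξx.le hcont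
    ⟨(sub_neg.2 (h.G_lt_ratio h.ξ_pos le_rfl)).le, sub_nonneg.2 hx⟩
  have heq : G R ψ x₀ = f x₀ / r x₀ := sub_eq_zero.1 hx₀'
  have hξx₀ : ξ < x₀ := lt_of_le_of_ne hx₀.1 fun he => by
    rw [← he] at heq
    exact (h.G_lt_ratio h.ξ_pos le_rfl).ne heq
  have hx₀0 := h.ξ_pos.trans hξx₀
  refine ⟨x₀, hx₀0, ?_, ?_⟩
  · refine strictAntiOn_of_hasDerivAt_neg (convex_Ioc 0 x₀)
      (fun y hy => h.hasDerivAt_slope hy.1) fun y hy => ?_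
    rw [interior_Ioc] at hy
    refine mul_neg_of_pos_of_neg (h.slope_weight_pos hy.1) (sub_neg.2 ?_)
    rcases le_or_gt y ξ with hyξ | hyξ
    · exact h.G_lt_ratio hy.1 hyξ
    · by_contra! hcon
      exact absurd heq (h.ratio_lt_G_of_le hyξ hy.2 hcon).ne'
  · refine strictMonoOn_of_hasDerivAt_pos (convex_Ici x₀)
      (fun y hy => h.hasDerivAt_slope (hx₀0.trans_le hy)) fun y hy => ?_
    rw [interior_Ici] at hy
    exact mul_pos (h.slope_weight_pos (hx₀0.trans hy))
      (sub_pos.2 (h.ratio_lt_G_of_le hξx₀ hy heq.ge))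

lemma bot_lt_ratioInfty_iff : ⊥ < ratioInfty f r ↔ ∃ l, ∀ x, ξ < x → l ≤ f x / r x := by
  constructor
  · intro hlt
    by_contra! hcon
    refine hlt.ne' (limsup_coe_eq_bot (f := fun x => f x / r x) ?_)
    rw [tendsto_atBot]
    intro B
    obtain ⟨x, hx1, hx2⟩ := hcon B
    filter_upwards [eventually_ge_atTop x] with y hy
    exact (h.strictAntiOn.antitoneOn hx1 (lt_of_lt_of_le hx1 hy) hy).trans hx2.le
  · rintro ⟨l, hl⟩
    refine (EReal.bot_lt_coe l).trans_le (coe_le_limsup (f := fun x => f x / r x) ?_)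
    filter_upwards [eventually_gt_atTop ξ] with x hx using hl x hx

/-- Beyond `N`, `G` averages its value at `N` with values of `f/r` that are at least `l`. -/
lemma exists_eventually_le_G {l : ℝ} (hl : ∀ x, ξ < x → l ≤ f x / r x) :
    ∃ B, ∀ᶠ x in atTop, B ≤ G R ψ x := by
  set N := ξ + 1
  have hN : ξ < N := lt_add_one ξ
  have hN0 := h.ξ_pos.trans hN
  have hmono := h.monotoneOn_sub_flux (convex_Ici N) (fun x hx => hN0.trans_le hx)
    fun y hy => hl y (hN.trans_le hy)
  refine ⟨min (G R ψ N) l, ?_⟩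
  filter_upwards [eventually_ge_atTop N] with x hx
  have h1 := hmono (mem_Ici.2 le_rfl) hx hx
  simp only [← sub_mul] at h1
  have h2 := h.pair.flux_ψ_pos (hN0.trans_le hx)
  have h3 := h.pair.flux_ψ_pos hN0
  have h4 := (h.pair.strictMonoOn_flux_ψ h.coeff h.discount).monotoneOn hN0 (hN0.trans_le hx) hx
  by_contra! hcon
  rw [lt_min_iff] at hcon
  rcases le_total l (G R ψ N) with h5 | h5
  · have h6 := mul_nonneg (sub_nonneg.2 h5) h3.le
    have h7 := mul_neg_of_neg_of_pos (sub_neg.2 hcon.2) h2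
    linarith
  · have h6 : (l - G R ψ N) * flux b σ ψ N ≤ (l - G R ψ N) * flux b σ ψ x :=
      mul_le_mul_of_nonneg_left h4 (sub_nonneg.2 h5)
    have h7 := mul_neg_of_neg_of_pos (sub_neg.2 hcon.1) h2
    linarith

lemma tendsto_G_atBot (hl : ∀ l, ∃ x, ξ < x ∧ f x / r x < l) : Tendsto (G R ψ) atTop atBot := by
  rw [tendsto_atBot]
  intro B
  -- The spare `1` pays for the part of the average before `N`: that contribution is a constant,
  -- exceeded by `flux ψ` in the end.
  obtain ⟨N, hN1, hN2⟩ := hl (B - 1)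
  have hN0 := h.ξ_pos.trans hN1
  have hanti := h.antitoneOn_sub_flux (a := B - 1) (convex_Ici N) (fun x hx => hN0.trans_le hx)
    fun y hy => (h.strictAntiOn.antitoneOn hN1 (lt_of_lt_of_le hN1 hy) hy).trans hN2.le
  filter_upwards [eventually_ge_atTop N, h.flux_infty.eventually_ge_atTop
    (G R ψ N * flux b σ ψ N - (B - 1) * flux b σ ψ N)] with x hx1 hx2
  have h1 := hanti (mem_Ici.2 le_rfl) hx1 hx1
  have h2 := h.pair.flux_ψ_pos (hN0.trans_le hx1)
  refine le_of_mul_le_mul_right ?_ h2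
  simp only at h1
  linarith

/-- The ratio `f / r` is bounded from below at infinity if and only if the critical cost is
finite. -/
lemma bot_lt_ratioInfty_iff_cost (hxl : xLower R ψ < ⊤) : ⊥ < ratioInfty f r ↔
    (xUpper R ψ = ⊤ ∧ cStar R ψ < ⊤) ∨ (xUpper R ψ < ⊤ ∧ cCirc R ψ < ⊤) := by
  have hs := h.potential.isSlopePair h.pair h.coeff h.cont h.discount
  obtain ⟨x₀, hx₀, hanti, hmono⟩ := h.exists_turning_point hxl
  rw [h.bot_lt_ratioInfty_iff]
  rcases IsSlopePair.eq_or_lt_of_xUpper hx₀ hanti hmono with ⟨hxu, hz⟩ | ⟨hxu, s, hs1, hs2⟩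
  · simp only [hxu, true_and, lt_self_iff_false, false_and, or_false]
    constructor
    · rintro ⟨l, hl⟩
      obtain ⟨B, hB⟩ := h.exists_eventually_le_G hl
      exact hs.cStar_lt_top hx₀ hanti hmono hxu hz hB
    · intro hlt
      by_contra! hcon
      exact hlt.ne (hs.cStar_eq_top hx₀ hanti hmono hxu hz (h.tendsto_G_atBot hcon))
  · simp only [hxu, hxu.ne, true_and, false_and, false_or]
    constructor
    · rintro ⟨l, hl⟩
      obtain ⟨B, hB⟩ := h.exists_eventually_le_G hl
      exact hs.cCirc_lt_top hx₀ hanti hs1 hs2 hB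
    · intro hlt
      by_contra! hcon
      exact hlt.ne (hs.cCirc_eq_top hx₀ hanti hs1 hs2 (h.tendsto_G_atBot hcon))

/-- A fixed cost above the critical cost exceeds every loss of `R`. -/
lemma sub_le_cost {c : ℝ} (hc : 0 < c)
    (hcase : (xLower R ψ < ⊤ ∧ ⊥ < ratioInfty f r ∧ (xUpper R ψ = ⊤ → cStar R ψ ≤ (c : EReal)) ∧
      (xUpper R ψ < ⊤ → cCirc R ψ ≤ (c : EReal))) ∨ xLower R ψ = ⊤) {u v : ℝ} (hu : 0 < u)
    (huv : u ≤ v) : R u - R v ≤ c := by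
  have hs := h.potential.isSlopePair h.pair h.coeff h.cont h.discount
  rcases huv.eq_or_lt with rfl | huv
  · simpa using hc.le
  rcases hcase with ⟨hxl, -, h1, h2⟩ | hxl
  · obtain ⟨x₀, hx₀, hanti, hmono⟩ := h.exists_turning_point hxl
    rcases IsSlopePair.eq_or_lt_of_xUpper hx₀ hanti hmono with ⟨hxu, hz⟩ | ⟨hxu, s, hs1, hs2⟩
    · exact hs.le_of_cStar_le hx₀ hanti hmono hxu hz (h1 hxu) hu huv
    · exact hs.le_of_cCirc_le hx₀ hanti hmono hs1 hs2 (h2 hxu) hu huv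
  · have := hs.monotoneOn_of_strictAntiOn (h.strictAntiOn_of_xLower_eq_top hxl) hu
      (hu.trans huv) huv.le
    linarith

end IsUnimodalPotential

end Unimodal

/-! ### The primitive of the marginal profit -/

section Primitive

variable {b σ r φ ψ k : ℝ → ℝ}

lemma opL_add_const_mul {u v : ℝ → ℝ} (hu : ContDiffOn ℝ 2 u (Ioi 0))
    (hv : ContDiffOn ℝ 2 v (Ioi 0)) (a : ℝ) {x : ℝ} (hx : 0 < x) :
    opL b σ r (fun x => u x + a * v x) x = opL b σ r u x + a * opL b σ r v x := by
  have h1 : ∀ y, 0 < y → deriv (fun x => u x + a * v x) y = deriv u y + a * deriv v y :=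
    fun y hy => ((hasDerivAt_of_contDiffOn_two hu hy).add
      ((hasDerivAt_of_contDiffOn_two hv hy).const_mul a)).deriv
  have h2 : deriv (deriv fun x => u x + a * v x) x = deriv (deriv u) x + a * deriv (deriv v) x := by
    refine HasDerivAt.deriv (((hasDerivAt_deriv_of_contDiffOn_two hu hx).add
      ((hasDerivAt_deriv_of_contDiffOn_two hv hx).const_mul a)).congr_of_eventuallyEq ?_)
    filter_upwards [Ioi_mem_nhds hx] with y hy using h1 y hy
  simp only [opL, h1 x hx, h2]
  ring

lemma continuousOn_of_absolutelyContinuousOnInterval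
    (hk : ∀ x y, 0 < x → x ≤ y → AbsolutelyContinuousOnInterval k x y) :
    ContinuousOn k (Ioi 0) := fun x hx => by
  have hx' : (0 : ℝ) < x := hx
  have h := (hk (x / 2) (x + 1) (by linarith) (by linarith)).continuousOn
  rw [uIcc_of_le (by linarith)] at h
  exact (h.continuousAt (Icc_mem_nhds (by linarith) (by linarith))).continuousWithinAt

lemma intervalIntegrable_zero (hk : ContinuousOn k (Ioi 0)) (hk0 : IntegrableOn k (Ioo 0 1))
    {x : ℝ} (hx : 0 < x) : IntervalIntegrable k volume 0 x := by
  refine IntervalIntegrable.trans (b := 1) ?_ (IntervalIntegrable.of_continuousOn_Ioi hk one_pos hx)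
  rwa [intervalIntegrable_iff_integrableOn_Ioo_of_le zero_le_one]

lemma hasDerivAt_primitive (hk : ContinuousOn k (Ioi 0)) (hk0 : IntegrableOn k (Ioo 0 1))
    {x : ℝ} (hx : 0 < x) : HasDerivAt (primitive k) (k x) x :=
  hasDerivAt_integral_of_continuousOn_Ioi hk hx (intervalIntegrable_zero hk hk0 hx)

lemma contDiffOn_primitive (hc : CoefficientsRegular b σ) (hr : DiscountRegular r)
    (hk : ∀ x y, 0 < x → x ≤ y → AbsolutelyContinuousOnInterval k x y)
    (hk0 : IntegrableOn k (Ioo 0 1)) (hL : ContinuousOn (opL b σ r (primitive k)) (Ioi 0)) :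
    ContDiffOn ℝ 2 (primitive k) (Ioi 0) := by
  have hkc := continuousOn_of_absolutelyContinuousOnInterval hk
  have hκ : ∀ x, 0 < x → HasDerivAt (primitive k) (k x) x := fun x hx =>
    hasDerivAt_primitive hkc hk0 hx
  have hκc : ContinuousOn (primitive k) (Ioi 0) := fun x hx =>
    (hκ x hx).continuousAt.continuousWithinAt
  have hdd : ∀ x, 0 < x → deriv (deriv (primitive k)) x = deriv k x := fun x hx => by
    refine EventuallyEq.deriv_eq ?_
    filter_upwards [Ioi_mem_nhds hx] with y hy using (hκ y hy).deriv
  -- `deriv k` has the default value `0` where `k` is not differentiable. `ℒκ` is formed with this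
  -- total function, so its continuity forces that of `deriv k`; the fundamental theorem for
  -- absolutely continuous `k` then makes `k` C¹.
  have hd : ContinuousOn (deriv k) (Ioi 0) := by
    have h1 : ContinuousOn (fun x => (opL b σ r (primitive k) x - b x * k x +
        r x * primitive k x) / ((1 / 2) * σ x ^ 2)) (Ioi 0) :=
      ((hL.sub (hc.continuousOn_b.mul hkc)).add (hr.continuousOn.mul hκc)).div
        (continuousOn_const.mul (hc.continuousOn_σ.pow 2)) fun x hx =>
          (mul_pos one_half_pos (pow_pos (hc.σ_pos x hx) 2)).ne'
    refine h1.congr fun x hx => ?_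
    have hσ := (hc.σ_pos x hx).ne'
    simp only [opL, hdd x hx, (hκ x hx).deriv]
    field_simp
    ring
  refine (contDiffOn_two_of_hasDerivAt hκ (fun x hx => ?_) hd).1
  have hx2 : 0 < x / 2 := half_pos hx
  have h2 := (hasDerivAt_integral_of_continuousOn_Ioi hd hx
    (IntervalIntegrable.of_continuousOn_Ioi hd hx2 hx)).const_add (k (x / 2))
  refine h2.congr_of_eventuallyEq ?_
  filter_upwards [Ioi_mem_nhds (half_lt_self hx)] with y hy
  rw [(hk (x / 2) y hx2 (le_of_lt hy)).integral_deriv_eq_sub]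
  ring

/-- Wronskians give the coordinates of `u` in the basis `φ, ψ`. Since `u/φ` and `ψ/φ` vanish at `0`,
the coefficient of `φ` is zero. -/
lemma IsFundamentalPair.exists_eq_mul_ψ (h : IsFundamentalPair b σ r φ ψ)
    (hc : CoefficientsRegular b σ) {u : ℝ → ℝ} (hu : ContDiffOn ℝ 2 u (Ioi 0))
    (hLu : ∀ x, 0 < x → opL b σ r u x = 0)
    (hu0 : Tendsto (fun x => u x / φ x) (𝓝[>] 0) (𝓝 0)) :
    ∃ K, ∀ x, 0 < x → u x = K * ψ x := by
  have hW := (h.wronskian_pos one_pos).ne'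
  have key : ∀ x, 0 < x → u x * wronskian b σ φ ψ 1 =
      φ x * wronskian b σ u ψ 1 - ψ x * wronskian b σ u φ 1 := fun x hx => by
    rw [wronskian_eq hc r hu h.ψ_C2 hLu h.ψ_ode one_pos hx,
      wronskian_eq hc r hu h.φ_C2 hLu h.φ_ode one_pos hx, ← h.wronskian_const hc hx]
    simp only [wronskian]
    ring
  have hψφ : Tendsto (fun x => ψ x / φ x) (𝓝[>] 0) (𝓝 0) := by
    refine squeeze_zero' ?_ ?_ ((tendsto_const_nhds (x := ψ 1)).div_atTop h.φ_zero)
    · filter_upwards [self_mem_nhdsWithin] with x hx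
      exact (div_pos (h.ψ_pos x hx) (h.φ_pos x hx)).le
    · filter_upwards [Ioo_mem_nhdsGT (one_pos (α := ℝ))] with x hx
      exact div_le_div_of_nonneg_right (h.strictMonoOn_ψ hx.1 (mem_Ioi.2 one_pos) hx.2).le
        (h.φ_pos x hx.1).le
  have hA : wronskian b σ u ψ 1 = 0 := by
    have h1 := (hu0.mul_const (wronskian b σ φ ψ 1)).add (hψφ.mul_const (wronskian b σ u φ 1))
    rw [zero_mul, zero_mul, add_zero] at h1
    refine tendsto_nhds_unique (tendsto_const_nhds.congr' ?_) h1
    filter_upwards [self_mem_nhdsWithin] with x hx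
    have hφ := (h.φ_pos x hx).ne'
    have := key x hx
    field_simp
    linarith
  refine ⟨-wronskian b σ u φ 1 / wronskian b σ φ ψ 1, fun x hx => ?_⟩
  have := key x hx
  rw [hA] at this
  field_simp
  linarith

/-- `ℒ(κ + R) = ℒκ - ℒκ = 0`, and near `0` both terms are `o(φ)`: `κ` tends to `0` there and `R` is
a potential. The limit of `κ/ψ` follows because `R = o(ψ)` at `∞`. -/
lemma exists_primitive_add_eq_mul_ψ {R : ℝ → ℝ} (h : IsFundamentalPair b σ r φ ψ)
    (hc : CoefficientsRegular b σ) (hr : DiscountRegular r)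
    (hk : ∀ x y, 0 < x → x ≤ y → AbsolutelyContinuousOnInterval k x y)
    (hk0 : IntegrableOn k (Ioo 0 1)) (hL : ContinuousOn (opL b σ r (primitive k)) (Ioi 0))
    (hR : IsGreenPotential b σ φ ψ (opL b σ r (primitive k)) R) :
    ∃ K, (∀ x, 0 < x → primitive k x + R x = K * ψ x) ∧
      Tendsto (fun x => primitive k x / ψ x) atTop (𝓝 K) := by
  have hκ := contDiffOn_primitive hc hr hk hk0 hL
  obtain ⟨h1, -, h2⟩ := hR.regularity h hc hL hr.continuousOn
  have hu : ContDiffOn ℝ 2 (fun x => primitive k x + 1 * R x) (Ioi 0) :=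
    hκ.add (contDiffOn_const.mul h1)
  have hκ0 := (tendsto_integral_nhdsGT_zero one_pos (intervalIntegrable_zero
    (continuousOn_of_absolutelyContinuousOnInterval hk) hk0 one_pos)).div_atTop h.φ_zero
  obtain ⟨K, hK⟩ := h.exists_eq_mul_ψ hc hu
    (fun x hx => by rw [opL_add_const_mul hκ h1 1 hx, h2 x hx]; ring)
    (by simpa only [one_mul, add_div, add_zero, primitive] using hκ0.add (hR.tendsto_div_φ h hc))
  simp only [one_mul] at hK
  refine ⟨K, hK, ?_⟩
  have h3 := (hR.tendsto_div_ψ h hc).const_sub K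
  rw [sub_zero] at h3
  refine h3.congr' ?_
  filter_upwards [eventually_gt_atTop 0] with x hx
  have hψ := (h.ψ_pos x hx).ne'
  have := hK x hx
  field_simp
  linarith

end Primitive

lemma DiscountedIntegrable.add {Ω : Type*} {mΩ : MeasurableSpace Ω} {P : Measure Ω}
    [IsProbabilityMeasure P] {ℱ : Filtration ℝ≥0 mΩ} {b σ r f g : ℝ → ℝ} {X : ℝ → ℝ≥0 → Ω → ℝ}
    (hX : ∀ x, 0 < x → IsDiffusion b σ ℱ P x (X x)) (hr : DiscountRegular r)
    (hf : ContinuousOn f (Ioi 0)) (hg : ContinuousOn g (Ioi 0))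
    (hfi : DiscountedIntegrable r P X f) (hgi : DiscountedIntegrable r P X g) :
    DiscountedIntegrable r P X (fun x => f x + g x) := fun x hx => by
  have h := (((hX x hx).integrable_occupation hr hf (hfi x hx)).add
    ((hX x hx).integrable_occupation hr hg (hgi x hx))).abs.lintegral_lt_top
  exact ((hX x hx).lintegral_ofReal_occupation hr (hf.add hg).abs).symm.trans_lt h

/-! ### The HJB equation -/

/-- The gain of a jump of size `z` is `R(x - z) - R(x)`, at most `c`. Hence the impulse term is
nonpositive and the maximum is attained by the differential term, which vanishes identically. -/
lemma solvesHJB_of_sub_le {b σ r h k w R : ℝ → ℝ} {c : ℝ}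
    (hw : ∀ x, 0 < x → opL b σ r w x + h x = 0)
    (hR : ∀ x, 0 < x → HasDerivAt R (deriv w x - k x) x)
    (hd : ContinuousOn (fun x => k x - deriv w x) (Ioi 0))
    (hle : ∀ u v, 0 < u → u ≤ v → R u - R v ≤ c) : SolvesHJB b σ r h k c w := by
  intro x hx
  have hgain : ∀ y ∈ impulseGains k w x, y ≤ c := by
    rintro _ ⟨z, hz, rfl⟩
    have hxz : 0 < x - z := sub_pos.2 hz.2
    have hle' : x - z ≤ x := sub_le_self x hz.1
    have h1 : ∫ s in (x - z)..x, (k s - deriv w s) = -R x - -R (x - z) := by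
      refine intervalIntegral.integral_eq_sub_of_hasDerivAt (f := fun y => -R y) (fun y hy => ?_)
        (IntervalIntegrable.of_continuousOn_Ioi hd hxz hx)
      rw [uIcc_of_le hle'] at hy
      exact (hR y (hxz.trans_le hy.1)).neg.congr_deriv (neg_sub _ _)
    have := hle _ _ hxz hle'
    simp only [h1]
    linarith
  have hne : (impulseGains k w x).Nonempty := ⟨_, 0, ⟨le_rfl, hx⟩, rfl⟩
  refine ⟨⟨c, hgain⟩, ?_⟩
  rw [hw x hx, max_eq_left]
  have := csSup_le hne hgain
  linarith

end ImpulseControl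

/-! ### The critical cost and the solution of the HJB equation -/

theorem mainTheorem7 {Ω : Type*} {mΩ : MeasurableSpace Ω} (P : Measure Ω)
    [IsProbabilityMeasure P] (ℱ : Filtration ℝ≥0 mΩ)
    (b σ r h k φ ψ : ℝ → ℝ) (c : ℝ) (X : ℝ → ℝ≥0 → Ω → ℝ)
    (hcoef : ImpulseControl.CoefficientsRegular b σ)
    (hzero : ImpulseControl.ZeroInaccessible b σ)
    (hinfty : ImpulseControl.InftyNatural b σ)
    (hr : ImpulseControl.DiscountRegular r)
    (hX : ∀ x, 0 < x → ImpulseControl.IsDiffusion b σ ℱ P x (X x))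
    (hφψ : ImpulseControl.IsFundamentalPair b σ r φ ψ)
    (hh : ImpulseControl.RunningPayoffRegular r h P X)
    (hk : ImpulseControl.MarginalProfitRegular b σ r k ψ P X)
    (hΘ : ImpulseControl.ThetaUnimodal b σ r h k)
    (hc : 0 < c) :
    let Θ : ℝ → ℝ := ImpulseControl.Theta b σ r h k
    let RΘ : ℝ → ℝ := ImpulseControl.resolvent r P X Θ
    let xl : EReal := ImpulseControl.xLower RΘ ψ
    let xu : EReal := ImpulseControl.xUpper RΘ ψ
    let cs : EReal := ImpulseControl.cStar RΘ ψ
    let c0 : EReal := ImpulseControl.cCirc RΘ ψ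
    (xl < ⊤ → (⊥ < ImpulseControl.ratioInfty Θ r ↔
      (xu = ⊤ ∧ cs < ⊤) ∨ (xu < ⊤ ∧ c0 < ⊤))) ∧
    ((xl < ⊤ ∧ ⊥ < ImpulseControl.ratioInfty Θ r ∧
        (xu = ⊤ → cs ≤ (c : EReal)) ∧ (xu < ⊤ → c0 ≤ (c : EReal))) ∨ xl = ⊤ →
      ∃ K : ℝ, 0 ≤ K ∧
        Tendsto (fun x => ImpulseControl.primitive k x / ψ x) atTop (𝓝 K) ∧
        ContDiffOn ℝ 2 (fun x => ImpulseControl.resolvent r P X h x + K * ψ x) (Ioi 0) ∧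
        (∃ m : ℝ, ∀ x, 0 < x → m ≤ ImpulseControl.resolvent r P X h x + K * ψ x) ∧
        ImpulseControl.SolvesHJB b σ r h k c
          (fun x => ImpulseControl.resolvent r P X h x + K * ψ x)) := by
  intro Θ RΘ xl xu cs c0
  have hL : ContinuousOn (ImpulseControl.opL b σ r (ImpulseControl.primitive k)) (Ioi 0) :=
    (hΘ.1.sub hh.cont).congr fun x _ => (add_sub_cancel_left _ _).symm
  have hRh := ImpulseControl.isGreenPotential_resolvent hX hcoef hr hφψ hzero hinfty hh.cont
    hh.integrable
  have hRL := ImpulseControl.isGreenPotential_resolvent hX hcoef hr hφψ hzero hinfty hL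
    hk.integrable
  have hRΘ : ImpulseControl.IsGreenPotential b σ φ ψ Θ RΘ :=
    ImpulseControl.isGreenPotential_resolvent hX hcoef hr hφψ hzero hinfty hΘ.1
      (hh.integrable.add hX hr hh.cont hL hk.integrable)
  obtain ⟨ξ, hξ, hmono, hanti⟩ := hΘ.2
  have hU : ImpulseControl.IsUnimodalPotential b σ r φ ψ Θ RΘ ξ :=
    ⟨hcoef, hr, hφψ, hRΘ, hΘ.1, hξ, hmono, hanti,
      hφψ.tendsto_flux_ψ_zero hcoef hr hzero, hφψ.tendsto_flux_ψ_atTop hcoef hr hinfty⟩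
  refine ⟨hU.bot_lt_ratioInfty_iff_cost, fun hcase => ?_⟩
  obtain ⟨K, hK, hKlim⟩ := ImpulseControl.exists_primitive_add_eq_mul_ψ hφψ hcoef hr hk.absCont
    hk.integrable_zero hL hRL
  -- The limit exists, so it coincides with the upper limit assumed to be nonnegative.
  have hK0 : 0 ≤ K := by
    obtain ⟨l, hl0, hl⟩ := hk.limsup_infty
    have hlK := ((continuous_coe_real_ereal.tendsto K).comp hKlim).limsup_eq.symm.trans hl
    exact hl0.trans_eq (EReal.coe_eq_coe_iff.1 hlK).symm
  obtain ⟨hC, -, hode⟩ := hRh.regularity hφψ hcoef hh.cont hr.continuousOn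
  have hw2 : ContDiffOn ℝ 2 (fun x => ImpulseControl.resolvent r P X h x + K * ψ x) (Ioi 0) :=
    hC.add (contDiffOn_const.mul hφψ.ψ_C2)
  have hkc := ImpulseControl.continuousOn_of_absolutelyContinuousOnInterval hk.absCont
  refine ⟨K, hK0, hKlim, hw2, ?_, ImpulseControl.solvesHJB_of_sub_le (R := RΘ) ?_ ?_ ?_ ?_⟩
  · obtain ⟨m, hm⟩ := hh.bddBelow
    obtain ⟨m', hm'⟩ := hRh.bddBelow hφψ hcoef hr hzero hinfty hm
    exact ⟨m', fun x hx =>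
      (hm' x hx).trans (le_add_of_nonneg_right (mul_nonneg hK0 (hφψ.ψ_pos x hx).le))⟩
  · intro x hx
    rw [ImpulseControl.opL_add_const_mul hC hφψ.ψ_C2 K hx, hode x hx, hφψ.ψ_ode x hx]
    ring
  · intro x hx
    have h1 := (ImpulseControl.hasDerivAt_of_contDiffOn_two hw2 hx).sub
      (ImpulseControl.hasDerivAt_primitive hkc hk.integrable_zero hx)
    -- By additivity of potentials and `κ + R_{ℒκ} = Kψ`, one has `w - κ = R_h + R_{ℒκ} = R_Θ`.
    refine h1.congr_of_eventuallyEq ?_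
    filter_upwards [Ioi_mem_nhds hx] with y hy
    have h2 := hRh.add_eq hRL hRΘ (fun _ _ => rfl) hy
    have h3 := hK y hy
    simp only [Pi.sub_apply]
    linarith
  · exact hkc.sub fun x hx => (ImpulseControl.hasDerivAt_deriv_of_contDiffOn_two hw2
      hx).continuousAt.continuousWithinAt
  · exact fun u v hu huv => hU.sub_le_cost hc hcase hu huv
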